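/- **Setting.** Let $M$ be a smooth $4$-dimensional CR-manifold of CR-dimension $1$ with CR-bundle $L\subset\mathbb C\otimes TM$, belonging to general class ${\sf II}$: $\mathbb C\otimes TM=L+\overline L+[L,\overline L]+[L,[L,\overline L]]$. For a local generator $\mathcal L$ of $L$ put $\mathcal T=i[\mathcal L,\overline{\mathcal L}]$, $\mathcal S=[\mathcal L,\mathcal T]$, and let $(\sigma_0,\rho_0,\zeta_0,\overline{\zeta}_0)$ be the coframe dual to $(\mathcal S,\mathcal T,\mathcal L,\overline{\mathcal L})$. *The bundle $P^4$.* $P^1$ is the bundle of coframes $(\sigma,\rho,\zeta,\overline\zeta)$ on $M$ with $\sigma={\sf a}^2\overline{\sf a}\,\sigma_0$, $\rho={\sf c}\,\sigma_0+{\sf a}\overline{\sf a}\,\rho_0$, $\zeta={\sf d}\,\sigma_0+{\sf b}\,\rho_0+{\sf a}\,\zeta_0$, where ${\sf a}\in\mathbb C\setminus\{0\}$, ${\sf b},{\sf c},{\sf d}\in\mathbb C$, and $\overline\zeta$ is the conjugate of $\zeta$. For a local section of $P^1$ write $T^k_{ij}$ for the coefficient of $\theta^i\wedge\theta^j$ in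 $d\theta^k$, $\theta=(\sigma,\rho,\zeta,\overline\zeta)$. The local sections of the reduced bundle $P^4\subset P^1$ are the local sections of $P^1$ with normalized essential torsion: $$T^\sigma_{\rho\overline\zeta}=1,\qquad T^\zeta_{\zeta\overline\zeta}=\tfrac12T^\rho_{\rho\overline\zeta}=\tfrac13T^\sigma_{\sigma\overline\zeta},\qquad T^\rho_{\sigma\zeta}=T^\rho_{\sigma\overline\zeta}=0 .$$ Let $G_4=\{\mathrm{diag}({\sf a}^3,{\sf a}^2,{\sf a},{\sf a}):{\sf a}\in\mathbb R\setminus\{0\}\}$. On $P^4$ let $\sigma,\rho,\zeta,\overline\zeta$ be the tautological forms. In the trivialization $(p,{\sf a})\mapsto({\sf a}^3\sigma_3,{\sf a}^2\rho_3,{\sf a}\zeta_3,{\sf a}\overline\zeta_3)(p)$ given by a local section $(\sigma_3,\rho_3,\zeta_3,\overline\zeta_3)$ with torsion coefficients $T^k_{ij}$, let $$\Lambda=\frac{d{\sf a}}{\sf a}+\lambda,\qquad \lambda=\tfrac12T^\rho_{\sigma\rho}\,\sigma_3-\tfrac13T^\sigma_{\sigma\rho}\,\rho_3-\tfrac13T^\sigma_{\sigma\zeta}\,\zeta_3-\tfrac13T^\sigma_{\sigma\overline\zeta}\,\overline\zeta_3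 .$$ *The model.* Let $\mathfrak G$ be the $5$-dimensional Lie group of the transformations of $\mathbb C^3$ $$z\mapsto tz+w,\qquad w_1\mapsto t^2w_1+2i\bar w t z+i|w|^2+2r,$$ $$w_2\mapsto t^3w_2+4\,\mathrm{Re}(w)\,t^2w_1+2i\bar w t^2z^2+i\bigl(4\,\mathrm{Re}(w)\bar w+2|w|^2\bigr)tz+2i|w|^2\mathrm{Re}(w)+4s,$$ with $t={\sf a}^{-1}$, ${\sf a}\in\mathbb R\setminus\{0\}$, $s,r\in\mathbb R$, $w\in\mathbb C$; let $\mathfrak G_0\cong G_4$ be the closed $1$-dimensional subgroup $s=r=w=0$. Let $\mathfrak g$ be the Lie algebra of $\mathfrak G$ and, in the coordinates $({\sf a},s,r,w)$ at the identity, let the tangent vector $(x,s,r,z)$ be denoted $x\,e_\alpha+s\,e_\sigma+r\,e_\rho+z\,e_\zeta+\bar z\,e_{\overline\zeta}$; $e_\alpha$ spans the Lie algebra of $\mathfrak G_0$. **Theorem.** 1. $\mathfrak G$ acts effectively and transitively on Beloshapka's cubic $\{w_1=\overline{w_1}+2iz\bar z,\ w_2=\overline{w_2}+2iz\bar z(z+\bar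 z)\}$, and $\mathfrak G_0$ is the isotropy group of the origin. The brackets of $\mathfrak g$ are $[e_\alpha,e_\sigma]=-3e_\sigma$, $[e_\alpha,e_\rho]=-2e_\rho$, $[e_\alpha,e_\zeta]=-e_\zeta$, $[e_\alpha,e_{\overline\zeta}]=-e_{\overline\zeta}$, $[e_\rho,e_\zeta]=[e_\rho,e_{\overline\zeta}]=-e_\sigma$, $[e_\zeta,e_{\overline\zeta}]=-i\,e_\rho$, the others being zero. 2. $P^4$ has local sections near every point of $M$; over the domain of a local section, the fibre of $P^4$ at each point is a single free $G_4$-orbit; two local sections differ on the common domain by a smooth function with values in $G_4$, and the forms $\Lambda$ they define on $P^4$ agree. So $P^4$ is a $G_4$-bundle over $M$ with well-defined forms $\Lambda,\sigma,\rho,\zeta,\overline\zeta$. The forms $\Lambda,\sigma,\rho$ are real and $\overline\zeta$ is the conjugate of $\zeta$. 3. The $\mathfrak g$-valued $1$-form $\omega=\Lambda e_\alpha+\sigma e_\sigma+\rho e_\rho+\zeta e_\zeta+\overline\zeta e_{\overline\zeta}$ is a Cartan connection of type $(\mathfrak G,\mathfrak G_0)$ on $P^4$. That is, over the domain of each local section,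 $P^4$ is a smooth principal $\mathfrak G_0$-bundle, $\dim\mathfrak G/\mathfrak G_0=\dim M$, $\omega$ is smooth, and (i) $\omega(X^*)=X$ for the vertical field $X^*$ generated by $X$ in the Lie algebra of $\mathfrak G_0$ (in particular $\omega(e_\alpha^*)=e_\alpha$); (ii) $R_b^*\omega=\mathrm{Ad}(b^{-1})\,\omega$ for every $b\in\mathfrak G_0$; (iii) $\omega_p:T_pP^4\to\mathfrak g$ is an isomorphism for every $p\in P^4$. -/

import Mathlib

open Set TopologicalSpace VectorField
open scoped Manifold ContDiff TensorProduct ComplexConjugate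

noncomputable section

/-! ### Complex tangent vectors and complex vector fields -/

section ComplexTangent

variable {V : Type*} [AddCommGroup V] [Module ℝ V]

/-- The real vector `X` of the complex vector `X + iY` in `ℂ ⊗ V`. -/
def rePart : ℂ ⊗[ℝ] V →ₗ[ℝ] V := (TensorProduct.lid ℝ V).toLinearMap ∘ₗ Complex.reLm.rTensor V

/-- The real vector `Y` of the complex vector `X + iY` in `ℂ ⊗ V`. -/
def imPart : ℂ ⊗[ℝ] V →ₗ[ℝ] V := (TensorProduct.lid ℝ V).toLinearMap ∘ₗ Complex.imLm.rTensor V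

/-- Complex conjugation `X + iY ↦ X - iY` on `ℂ ⊗ V`. -/
def conjVec : ℂ ⊗[ℝ] V →ₗ[ℝ] ℂ ⊗[ℝ] V := Complex.conjAe.toLinearMap.rTensor V

/-- The complex vector `X + iY`. -/
def mkVec (X Y : V) : ℂ ⊗[ℝ] V := (1 : ℂ) ⊗ₜ X + Complex.I ⊗ₜ Y

end ComplexTangent

/-- The standard model `ℝ⁴`. -/
abbrev R4 : Type := EuclideanSpace ℝ (Fin 4)

section Manifold

variable {M : Type*} [TopologicalSpace M] [ChartedSpace R4 M] [IsManifold (𝓡 4) ∞ M]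

variable (M) in
/-- Complex vector fields on `M`, i.e. sections of `ℂ ⊗ TM` (smoothness is imposed separately). -/
abbrev CVectorField : Type _ := ∀ p : M, ℂ ⊗[ℝ] TangentSpace (𝓡 4) p

namespace CVectorField

/-- Smoothness on the set `U` of a complex vector field: its real and imaginary parts are smooth
sections of the tangent bundle. -/
def SmoothOn (Z : CVectorField M) (U : Set M) : Prop :=
  ContMDiffOn (𝓡 4) (𝓡 4).tangent ∞
    (fun p => (⟨p, rePart (Z p)⟩ : TangentBundle (𝓡 4) M)) U ∧
  ContMDiffOn (𝓡 4) (𝓡 4).tangent ∞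
    (fun p => (⟨p, imPart (Z p)⟩ : TangentBundle (𝓡 4) M)) U

/-- The conjugate vector field. -/
def bar (Z : CVectorField M) : CVectorField M := fun p => conjVec (Z p)

/-- The complex bilinear extension of the Lie bracket of vector fields. -/
def bracket (Z W : CVectorField M) : CVectorField M := fun p =>
  mkVec
    (mlieBracket (𝓡 4) (fun q => rePart (Z q)) (fun q => rePart (W q)) p
      - mlieBracket (𝓡 4) (fun q => imPart (Z q)) (fun q => imPart (W q)) p)
    (mlieBracket (𝓡 4) (fun q => rePart (Z q)) (fun q => imPart (W q)) p
      + mlieBracket (𝓡 4) (fun q => imPart (Z q)) (fun q => rePart (W q)) p)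

/-- `T = i [L, L̄]`. -/
def fieldT (L : CVectorField M) : CVectorField M := fun p => Complex.I • bracket L (bar L) p

/-- `S = [L, T]`. -/
def fieldS (L : CVectorField M) : CVectorField M := bracket L (fieldT L)

/-- The frame `(S, T, L, L̄)`. -/
def frame (L : CVectorField M) (p : M) : Fin 4 → ℂ ⊗[ℝ] TangentSpace (𝓡 4) p :=
  ![fieldS L p, fieldT L p, L p, bar L p]

end CVectorField

variable (M) in
/-- A CR structure of CR-dimension `1` on the `4`-dimensional manifold `M`: a smooth complex line
subbundle `L` of `ℂ ⊗ TM` with `L ∩ L̄ = 0` and `[L, L] ⊆ L`. -/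
structure CRStructure where
  /-- the fibre of the CR bundle `L` -/
  fiber : ∀ p : M, Submodule ℂ (ℂ ⊗[ℝ] TangentSpace (𝓡 4) p)
  finrank_fiber : ∀ p, Module.finrank ℂ (fiber p) = 1
  exists_generator : ∀ p, ∃ U : Opens M, p ∈ U ∧ ∃ Z : CVectorField M, Z.SmoothOn U ∧
    ∀ q ∈ U, fiber q = Submodule.span ℂ {Z q}
  transversal : ∀ p, ∀ v ∈ fiber p, conjVec v ∈ fiber p → v = 0
  integrable : ∀ (U : Opens M) (Z W : CVectorField M), Z.SmoothOn U → W.SmoothOn U →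
    (∀ q ∈ U, Z q ∈ fiber q) → (∀ q ∈ U, W q ∈ fiber q) → ∀ q ∈ U, Z.bracket W q ∈ fiber q

namespace CRStructure

variable (𝓛 : CRStructure M)

/-- `Z` is a smooth section of the CR bundle over the open set `U`. -/
def IsSection (Z : CVectorField M) (U : Opens M) : Prop :=
  Z.SmoothOn U ∧ ∀ q ∈ U, Z q ∈ 𝓛.fiber q

/-- `Z` is a local generator of the CR bundle over the open set `U`. -/
def IsGenerator (Z : CVectorField M) (U : Opens M) : Prop :=
  Z.SmoothOn U ∧ ∀ q ∈ U, 𝓛.fiber q = Submodule.span ℂ {Z q}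

/-- General class II: `ℂ ⊗ TM = L + L̄ + [L, L̄] + [L, [L, L̄]]`. -/
def IsClassII : Prop :=
  ∀ p : M, Submodule.span ℂ {v : ℂ ⊗[ℝ] TangentSpace (𝓡 4) p |
    ∃ (U : Opens M) (X Y Z : CVectorField M), p ∈ U ∧
      𝓛.IsSection X U ∧ 𝓛.IsSection Y U ∧ 𝓛.IsSection Z U ∧
      (v = X p ∨ v = X.bar p ∨ v = X.bracket Y.bar p ∨ v = X.bracket (Y.bracket Z.bar) p)} = ⊤

end CRStructure

/-! ### Coframes and the reductions -/

/-- A quadruple `(σ, ρ, ζ, ζ̄)` of complex covectors at `p`, extended complex linearly to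
`ℂ ⊗ T_pM`; the indices `0, 1, 2, 3` stand for `σ, ρ, ζ, ζ̄`. -/
abbrev Coframe (p : M) : Type _ := Fin 4 → (ℂ ⊗[ℝ] TangentSpace (𝓡 4) p →ₗ[ℂ] ℂ)

/-- The value of a complex covector on a real tangent vector. -/
def onReal {p : M} (θ : ℂ ⊗[ℝ] TangentSpace (𝓡 4) p →ₗ[ℂ] ℂ) :
    TangentSpace (𝓡 4) p →ₗ[ℝ] ℂ :=
  θ.restrictScalars ℝ ∘ₗ TensorProduct.mk ℝ ℂ (TangentSpace (𝓡 4) p) 1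

/-- The differential at `p` of a real function on `M`. -/
def diffReal (h : M → ℝ) (p : M) : TangentSpace (𝓡 4) p →ₗ[ℝ] ℝ :=
  (mfderiv (𝓡 4) 𝓘(ℝ, ℝ) h p).toLinearMap

/-- The action of the element `diag (a³, a², a, a)` of the group `G₄` on coframes. -/
def Coframe.scale {p : M} (a : ℝ) (θ : Coframe p) : Coframe p :=
  ![(a : ℂ) ^ 3 • θ 0, (a : ℂ) ^ 2 • θ 1, (a : ℂ) • θ 2, (a : ℂ) • θ 3]

/-- `v` is the frame dual to the coframe `θ`. -/
def IsDual {p : M} (θ : Coframe p) (v : Fin 4 → ℂ ⊗[ℝ] TangentSpace (𝓡 4) p) : Prop :=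
  ∀ i j, θ i (v j) = if i = j then 1 else 0

/-- The bundle `P¹`: the coframes `(σ, ρ, ζ, ζ̄) = g · ω₀` at `p`, where `ω₀` is the coframe dual to
`(S, T, L, L̄)` for a local generator `L` of the CR bundle and `g` is a matrix in `G₁`. The fourth
row of `g · ω₀` is the conjugate of the third. -/
def IsAdapted (𝓛 : CRStructure M) {p : M} (θ : Coframe p) : Prop :=
  (∀ v, θ 3 v = conj (θ 2 (conjVec v))) ∧
  ∃ (U : Opens M) (L : CVectorField M) (ω₀ : Coframe p) (a b c d : ℂ),
    p ∈ U ∧ 𝓛.IsGenerator L U ∧ IsDual ω₀ (L.frame p) ∧ a ≠ 0 ∧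
    θ 0 = (a ^ 2 * conj a) • ω₀ 0 ∧
    θ 1 = c • ω₀ 0 + (a * conj a) • ω₀ 1 ∧
    θ 2 = d • ω₀ 0 + b • ω₀ 1 + a • ω₀ 2

/-- Smoothness on `U` of a family of complex covectors. -/
def SmoothFormOn (θ : ∀ p : M, ℂ ⊗[ℝ] TangentSpace (𝓡 4) p →ₗ[ℂ] ℂ) (U : Opens M) : Prop :=
  ContMDiffOn (𝓡 4).tangent 𝓘(ℝ, ℂ) ∞
    (fun v : TangentBundle (𝓡 4) M => onReal (θ v.1) v.2) {v | v.1 ∈ U}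

/-- A local coframe field over an open set together with its dual frame field
`(e_σ, e_ρ, e_ζ, e_ζ̄)`. -/
structure LocalCoframe (M : Type*) [TopologicalSpace M] [ChartedSpace R4 M]
    [IsManifold (𝓡 4) ∞ M] where
  /-- the domain -/
  U : Opens M
  /-- the coframe -/
  θ : ∀ p : M, Coframe p
  /-- the dual frame -/
  e : Fin 4 → CVectorField M
  smooth_θ : ∀ i, SmoothFormOn (fun p => θ p i) U
  smooth_e : ∀ i, (e i).SmoothOn U
  dual : ∀ p ∈ U, IsDual (θ p) fun i => e i p

namespace LocalCoframe

/-- The torsion coefficient `dθᵏ(eᵢ, eⱼ) = -θᵏ([eᵢ, eⱼ])`, i.e. for `i < j` the coefficient of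
`θⁱ ∧ θʲ` in the structure equation for `dθᵏ`. -/
def tor (D : LocalCoframe M) (k i j : Fin 4) (p : M) : ℂ :=
  -(D.θ p k ((D.e i).bracket (D.e j) p))

/-- A local section of `P⁴`: a local section of `P¹` with the normalizations
`T^σ_{ρζ̄} = 1` (defining `P²`), `T^ζ_{ζζ̄} = T^ρ_{ρζ̄} / 2 = T^σ_{σζ̄} / 3` (defining `P³`) and
`T^ρ_{σζ} = T^ρ_{σζ̄} = 0` (defining `P⁴`) of the essential torsion coefficients. -/
structure IsReduced (D : LocalCoframe M) (𝓛 : CRStructure M) : Prop where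
  adapted : ∀ p ∈ D.U, IsAdapted 𝓛 (D.θ p)
  norm2 : ∀ p ∈ D.U, D.tor 0 1 3 p = 1
  norm3 : ∀ p ∈ D.U, D.tor 2 2 3 p = D.tor 1 1 3 p / 2 ∧ D.tor 2 2 3 p = D.tor 0 0 3 p / 3
  norm4 : ∀ p ∈ D.U, D.tor 1 0 2 p = 0 ∧ D.tor 1 0 3 p = 0

/-- The form `λ = (T^ρ_{σρ} / 2) σ - (T^σ_{σρ} / 3) ρ - (T^σ_{σζ} / 3) ζ - (T^σ_{σζ̄} / 3) ζ̄`
on the base. -/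
def lam (D : LocalCoframe M) (p : M) : ℂ ⊗[ℝ] TangentSpace (𝓡 4) p →ₗ[ℂ] ℂ :=
  (D.tor 1 0 1 p / 2) • D.θ p 0 - (D.tor 0 0 1 p / 3) • D.θ p 1
    - (D.tor 0 0 2 p / 3) • D.θ p 2 - (D.tor 0 0 3 p / 3) • D.θ p 3

end LocalCoframe

/-- The fibre over `p` of the reduced bundle `P⁴`: the values at `p` of its local sections. -/
def P4 (𝓛 : CRStructure M) (p : M) : Set (Coframe p) :=
  {θ | ∃ D : LocalCoframe M, D.IsReduced 𝓛 ∧ p ∈ D.U ∧ D.θ p = θ}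

/-! ### The forms on `P⁴` -/

namespace LocalCoframe

variable (D : LocalCoframe M)

/-- The restriction of `P⁴` to the domain of a local section, trivialized by this section: the pair
`(p, a)` stands for the coframe `diag (a³, a², a, a) · θ_p` at `p`. -/
abbrev Triv : Type _ := D.U × ℝˣ

/-- The model with corners of the `5`-dimensional manifold `P⁴`. -/
abbrev modelP : ModelWithCorners ℝ (R4 × ℝ) (ModelProd R4 ℝ) := (𝓡 4).prod 𝓘(ℝ, ℝ)

/-- The coframe of `M` that is represented by a point of `P⁴`. -/
def coframeAt (x : D.Triv) : Coframe (x.1 : M) := (D.θ x.1).scale (x.2 : ℝ)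

/-- The derivative of the projection of `P⁴` to `M`. -/
def dproj (x : D.Triv) : TangentSpace modelP x →ₗ[ℝ] TangentSpace (𝓡 4) (x.1 : M) :=
  (mfderiv modelP (𝓡 4) (fun y : D.Triv => (y.1 : M)) x).toLinearMap

/-- The differential `da` of the fibre coordinate. -/
def da (x : D.Triv) : TangentSpace modelP x →ₗ[ℝ] ℝ :=
  (mfderiv modelP 𝓘(ℝ, ℝ) (fun y : D.Triv => (y.2 : ℝ)) x).toLinearMap

/-- The tautological forms `σ, ρ, ζ, ζ̄` on `P⁴`. -/
def taut (i : Fin 4) (x : D.Triv) : TangentSpace modelP x →ₗ[ℝ] ℂ :=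
  onReal (D.coframeAt x i) ∘ₗ D.dproj x

/-- The modified Maurer-Cartan form `Λ = da / a + λ` on `P⁴`. In terms of the torsion coefficients
`W` of `P⁴`, which at `(p, a)` are `W^ρ_{σρ} = a⁻³ T^ρ_{σρ}`, `W^σ_{σρ} = a⁻² T^σ_{σρ}`,
`W^σ_{σζ} = a⁻¹ T^σ_{σζ}`, `W^σ_{σζ̄} = a⁻¹ T^σ_{σζ̄}`, one has
`λ = (W^ρ_{σρ} / 2) σ - (W^σ_{σρ} / 3) ρ - (W^σ_{σζ} / 3) ζ - (W^σ_{σζ̄} / 3) ζ̄`. -/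
def Lambda (x : D.Triv) : TangentSpace modelP x →ₗ[ℝ] ℂ :=
  (((x.2 : ℝ)⁻¹ : ℂ)) • (Complex.ofRealCLM.toLinearMap ∘ₗ D.da x)
    + onReal (D.lam x.1) ∘ₗ D.dproj x

end LocalCoframe

end Manifold

/-! ### The model: the symmetry group of Beloshapka's cubic -/

/-- Beloshapka's cubic in `ℂ³`, with coordinates `(z, w₁, w₂)`. -/
def cubic : Set (ℂ × ℂ × ℂ) :=
  {x | x.2.1 = conj x.2.1 + 2 * Complex.I * x.1 * conj x.1 ∧
    x.2.2 = conj x.2.2 + 2 * Complex.I * x.1 * conj x.1 * (x.1 + conj x.1)}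

/-- The `5`-dimensional group `𝔊` of symmetries of Beloshapka's cubic, with global coordinates
`(a, (s, r, w))`, `a ≠ 0`; the element with these coordinates acts on `ℂ³` by `act` below. -/
def CubicGroup : Type := ℝˣ × (ℝ × ℝ × ℂ)

namespace CubicGroup

/-- The model with corners of the `5`-dimensional manifold `ℝˣ × ℝ × ℝ × ℂ`. -/
abbrev model : ModelWithCorners ℝ (ℝ × (ℝ × ℝ × ℂ)) (ModelProd ℝ (ℝ × ℝ × ℂ)) :=
  𝓘(ℝ, ℝ).prod 𝓘(ℝ, ℝ × ℝ × ℂ)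

instance : TopologicalSpace CubicGroup := inferInstanceAs (TopologicalSpace (ℝˣ × (ℝ × ℝ × ℂ)))

instance : ChartedSpace (ModelProd ℝ (ℝ × ℝ × ℂ)) CubicGroup :=
  inferInstanceAs (ChartedSpace (ModelProd ℝ (ℝ × ℝ × ℂ)) (ℝˣ × (ℝ × ℝ × ℂ)))

instance : IsManifold model ∞ CubicGroup :=
  inferInstanceAs (IsManifold model ∞ (ℝˣ × (ℝ × ℝ × ℂ)))

/-- The action on `ℂ³`. -/
def act (g : CubicGroup) (x : ℂ × ℂ × ℂ) : ℂ × ℂ × ℂ :=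
  let t : ℂ := ((g.1 : ℝ)⁻¹ : ℂ)
  let w : ℂ := g.2.2.2
  (t * x.1 + w,
    t ^ 2 * x.2.1 + 2 * Complex.I * conj w * t * x.1 + Complex.I * (w * conj w)
      + 2 * (g.2.2.1 : ℂ),
    t ^ 3 * x.2.2 + 4 * (w.re : ℂ) * t ^ 2 * x.2.1 + 2 * Complex.I * conj w * t ^ 2 * x.1 ^ 2
      + Complex.I * (4 * (w.re : ℂ) * conj w + 2 * (w * conj w)) * t * x.1
      + 2 * Complex.I * (w * conj w) * (w.re : ℂ) + 4 * (g.2.1 : ℂ))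

/-- The group law, which is composition of the transformations `act`. -/
def mul (g h : CubicGroup) : CubicGroup :=
  (g.1 * h.1,
    (g.2.1 + (g.1 : ℝ)⁻¹ ^ 3 * h.2.1 + 2 * (g.1 : ℝ)⁻¹ ^ 2 * g.2.2.2.re * h.2.2.1
        - (g.1 : ℝ)⁻¹ ^ 2 * (conj g.2.2.2 * h.2.2.2 ^ 2).im / 2
        - (g.1 : ℝ)⁻¹ * (g.2.2.2.re * (conj g.2.2.2 * h.2.2.2).im
            + Complex.normSq g.2.2.2 * h.2.2.2.im / 2),
      g.2.2.1 + (g.1 : ℝ)⁻¹ ^ 2 * h.2.2.1 - (g.1 : ℝ)⁻¹ * (conj g.2.2.2 * h.2.2.2).im,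
      g.2.2.2 + ((g.1 : ℝ)⁻¹ : ℂ) * h.2.2.2))

/-- The inverse of a group element. -/
def inv (g : CubicGroup) : CubicGroup :=
  (g.1⁻¹, (-((g.1 : ℝ) ^ 3 * (g.2.1 - 2 * g.2.2.1 * g.2.2.2.re)),
    -((g.1 : ℝ) ^ 2 * g.2.2.1), -(((g.1 : ℝ) : ℂ) * g.2.2.2)))

instance : Group CubicGroup where
  mul := mul
  one := (1, (0, 0, 0))
  inv := inv
  mul_assoc := by
    rintro ⟨a, s, r, w⟩ ⟨a', s', r', w'⟩ ⟨a'', s'', r'', w''⟩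
    change mul (mul _ _) _ = mul _ (mul _ _)
    have h := a.ne_zero
    have h' := a'.ne_zero
    refine Prod.ext (mul_assoc a a' a'') (Prod.ext ?_ (Prod.ext ?_ (Complex.ext ?_ ?_))) <;>
      simp [mul, Complex.normSq_apply, pow_two, ← Complex.ofReal_inv] <;> ring
  one_mul := by
    rintro ⟨a, s, r, w⟩
    change mul (1, (0, 0, 0)) _ = _
    refine Prod.ext (one_mul a) (Prod.ext ?_ (Prod.ext ?_ (Complex.ext ?_ ?_))) <;> simp [mul]
  mul_one := by
    rintro ⟨a, s, r, w⟩
    change mul _ (1, (0, 0, 0)) = _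
    refine Prod.ext (mul_one a) (Prod.ext ?_ (Prod.ext ?_ (Complex.ext ?_ ?_))) <;> simp [mul]
  inv_mul_cancel := by
    rintro ⟨a, s, r, w⟩
    change mul (inv _) _ = (1, (0, 0, 0))
    have h := a.ne_zero
    refine Prod.ext (inv_mul_cancel a) (Prod.ext ?_ (Prod.ext ?_ (Complex.ext ?_ ?_))) <;>
      simp [mul, inv, Complex.normSq_apply, pow_two] <;> ring


theorem contMDiff_coe : ContMDiff model 𝓘(ℝ, ℝ) ∞ (fun g : CubicGroup => (g.1 : ℝ)) :=
  Units.contMDiff_val.comp (contMDiff_fst (M := ℝˣ) (N := ℝ × ℝ × ℂ))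

theorem contMDiff_coe_inv : ContMDiff model 𝓘(ℝ, ℝ) ∞ (fun g : CubicGroup => (g.1 : ℝ)⁻¹) :=
  contMDiff_coe.inv₀ fun g => g.1.ne_zero

theorem contMDiff_tail :
    ContMDiff model 𝓘(ℝ, ℝ × ℝ × ℂ) ∞ (fun g : CubicGroup => g.2) :=
  contMDiff_snd (M := ℝˣ) (N := ℝ × ℝ × ℂ)

instance : LieGroup model ∞ CubicGroup where
  contMDiff_mul := by
    have h1 : ContMDiff (model.prod model) 𝓘(ℝ, ℝ) ∞
        (fun x : CubicGroup × CubicGroup => x.1.1 * x.2.1) :=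
      (contMDiff_mul 𝓘(ℝ, ℝ) ∞).comp
        (((contMDiff_fst (M := ℝˣ) (N := ℝ × ℝ × ℂ)).comp contMDiff_fst).prodMk
          ((contMDiff_fst (M := ℝˣ) (N := ℝ × ℝ × ℂ)).comp contMDiff_snd))
    let F : ℝ × (ℝ × ℝ × ℂ) × (ℝ × ℝ × ℂ) → ℝ × ℝ × ℂ := fun y =>
      (y.2.1.1 + y.1 ^ 3 * y.2.2.1 + 2 * y.1 ^ 2 * Complex.reCLM y.2.1.2.2 * y.2.2.2.1
        - y.1 ^ 2 * Complex.imCLM (Complex.conjCLE y.2.1.2.2 * y.2.2.2.2 ^ 2) / 2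
        - y.1 * (Complex.reCLM y.2.1.2.2 * Complex.imCLM (Complex.conjCLE y.2.1.2.2 * y.2.2.2.2)
            + (Complex.reCLM y.2.1.2.2 * Complex.reCLM y.2.1.2.2
              + Complex.imCLM y.2.1.2.2 * Complex.imCLM y.2.1.2.2)
              * Complex.imCLM y.2.2.2.2 / 2),
      y.2.1.2.1 + y.1 ^ 2 * y.2.2.2.1
        - y.1 * Complex.imCLM (Complex.conjCLE y.2.1.2.2 * y.2.2.2.2),
      y.2.1.2.2 + Complex.ofRealCLM y.1 * y.2.2.2.2)
    have hF : ContDiff ℝ ∞ F := by fun_prop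
    have h2 : ContMDiff (model.prod model) 𝓘(ℝ, ℝ × ℝ × ℂ) ∞
        (fun x : CubicGroup × CubicGroup => F ((x.1.1 : ℝ)⁻¹, x.1.2, x.2.2)) :=
      hF.contMDiff.comp ((contMDiff_coe_inv.comp contMDiff_fst).prodMk_space
        ((contMDiff_tail.comp contMDiff_fst).prodMk_space (contMDiff_tail.comp contMDiff_snd)))
    refine (h1.prodMk h2).congr fun x => ?_
    refine Prod.ext rfl (Prod.ext ?_ (Prod.ext rfl ?_))
    · rfl
    · change _ + _ = _ + _
      simp
  contMDiff_inv := by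
    have h1 : ContMDiff model 𝓘(ℝ, ℝ) ∞ (fun x : CubicGroup => x.1⁻¹) :=
      (contMDiff_inv 𝓘(ℝ, ℝ) ∞).comp (contMDiff_fst (M := ℝˣ) (N := ℝ × ℝ × ℂ))
    let F : ℝ × (ℝ × ℝ × ℂ) → ℝ × ℝ × ℂ := fun y =>
      (-(y.1 ^ 3 * (y.2.1 - 2 * y.2.2.1 * Complex.reCLM y.2.2.2)), -(y.1 ^ 2 * y.2.2.1),
        -(Complex.ofRealCLM y.1 * y.2.2.2))
    have hF : ContDiff ℝ ∞ F := by fun_prop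
    exact h1.prodMk (hF.contMDiff.comp (contMDiff_coe.prodMk_space contMDiff_tail))

/-- The inclusion of the isotropy group `𝔊₀ ≅ G₄ = ℝ ∖ {0}` of the origin of the cubic. -/
def incl : ℝˣ →* CubicGroup where
  toFun a := (a, (0, 0, 0))
  map_one' := rfl
  map_mul' a b := by
    change _ = mul (a, (0, 0, 0)) (b, (0, 0, 0))
    refine Prod.ext rfl (Prod.ext ?_ (Prod.ext ?_ ?_)) <;> simp [mul]

/-- The Lie algebra `𝔤` of `𝔊`. Its elements are the quadruples `(x, (s, r, z))`, standing for
`x e_α + s e_σ + r e_ρ + z e_ζ + z̄ e_ζ̄`. -/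
abbrev Lie𝔤 : Type := GroupLieAlgebra model CubicGroup

/-- The element `x e_α + s e_σ + r e_ρ + z e_ζ + z̄ e_ζ̄` of `𝔤`. -/
def vec : ℝ × (ℝ × ℝ × ℂ) →ₗ[ℝ] Lie𝔤 := LinearMap.id

end CubicGroup

/-! ### Cartan connections -/

section Cartan

variable {EM HM M EP HP P EH HH H EG HG G : Type*}
  [NormedAddCommGroup EM] [NormedSpace ℝ EM] [TopologicalSpace HM]
  [TopologicalSpace M] [ChartedSpace HM M]
  [NormedAddCommGroup EP] [NormedSpace ℝ EP] [TopologicalSpace HP]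
  [TopologicalSpace P] [ChartedSpace HP P]
  [NormedAddCommGroup EH] [NormedSpace ℝ EH] [TopologicalSpace HH]
  [TopologicalSpace H] [ChartedSpace HH H] [Group H]
  [NormedAddCommGroup EG] [NormedSpace ℝ EG] [TopologicalSpace HG]
  [TopologicalSpace G] [ChartedSpace HG G] [Group G]

/-- `π : P → M` with the right action `R` of the Lie group `H` is a smooth principal bundle. -/
structure IsPrincipalBundle (IM : ModelWithCorners ℝ EM HM) (IP : ModelWithCorners ℝ EP HP)
    (IH : ModelWithCorners ℝ EH HH) (π : P → M) (R : P → H → P) : Prop where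
  smooth_proj : ContMDiff IP IM ∞ π
  smooth_act : ContMDiff (IP.prod IH) IP ∞ fun y : P × H => R y.1 y.2
  act_one : ∀ x, R x 1 = x
  act_mul : ∀ x g h, R x (g * h) = R (R x g) h
  proj_act : ∀ x h, π (R x h) = π x
  locally_trivial : ∀ p : M, ∃ (V : Opens M) (φ : OpenPartialHomeomorph (M × H) P), p ∈ V ∧
    φ.source = (V : Set M) ×ˢ univ ∧ φ.target = π ⁻¹' V ∧
    ContMDiffOn (IM.prod IH) IP ∞ φ φ.source ∧ ContMDiffOn IP (IM.prod IH) ∞ φ.symm φ.target ∧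
    ∀ q ∈ V, ∀ h, π (φ (q, h)) = q ∧ ∀ k, φ (q, h * k) = R (φ (q, h)) k

/-- The adjoint representation of the Lie group `G` on its Lie algebra. -/
def Ad (IG : ModelWithCorners ℝ EG HG) (g : G) (X : GroupLieAlgebra IG G) :
    GroupLieAlgebra IG G :=
  (mfderiv IG IG (fun k : G => g * k * g⁻¹) 1 X : EG)

/-- `A` is a Cartan connection of type `(G, H)` on the bundle `π : P → M`, where the Lie group `H` is
regarded as a closed subgroup of the Lie group `G` through `ι`: `P` is a principal `H`-bundle,
`dim G / H = dim M`, and the smooth `𝔤`-valued `1`-form `A` reproduces the fundamental vertical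
fields, is `Ad`-equivariant, and is an isomorphism at each point. -/
structure IsCartanConnection (IM : ModelWithCorners ℝ EM HM) (IP : ModelWithCorners ℝ EP HP)
    [IsManifold IP ∞ P] (IH : ModelWithCorners ℝ EH HH) [LieGroup IH ∞ H]
    (IG : ModelWithCorners ℝ EG HG) [LieGroup IG ∞ G] (ι : H →* G)
    (π : P → M) (R : P → H → P)
    (A : ∀ x : P, TangentSpace IP x →ₗ[ℝ] GroupLieAlgebra IG G) : Prop where
  closed_subgroup : Topology.IsClosedEmbedding ι
  smooth_subgroup : ContMDiff IH IG ∞ ι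
  principal : IsPrincipalBundle IM IP IH π R
  dim_eq : Module.finrank ℝ EG = Module.finrank ℝ EH + Module.finrank ℝ EM
  smooth : ContMDiff (M' := EG) IP.tangent 𝓘(ℝ, EG) ∞ fun v : TangentBundle IP P => A v.1 v.2
  vertical : ∀ (x : P) (X : GroupLieAlgebra IH H),
    (A (R x 1) (mfderiv IH IP (fun h : H => R x h) 1 X) : EG) = (mfderiv IH IG ι 1 X : EG)
  equivariant : ∀ (x : P) (h : H) (v : TangentSpace IP x),
    A (R x h) (mfderiv IP IP (fun y : P => R y h) x v) = Ad IG (ι h)⁻¹ (A x v)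
  isomorphism : ∀ x : P, Function.Bijective (A x)

end Cartan

section Connection

variable {M : Type*} [TopologicalSpace M] [ChartedSpace R4 M] [IsManifold (𝓡 4) ∞ M]

/-- The form `ω = Λ e_α + σ e_σ + ρ e_ρ + ζ e_ζ + ζ̄ e_ζ̄` on `P⁴`, for real forms `Λ, σ, ρ`. -/
def LocalCoframe.omega (D : LocalCoframe M) (x : D.Triv) :
    TangentSpace LocalCoframe.modelP x →ₗ[ℝ] CubicGroup.Lie𝔤 :=
  CubicGroup.vec ∘ₗ
    (Complex.reLm ∘ₗ D.Lambda x).prod ((Complex.reLm ∘ₗ D.taut 0 x).prod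
      ((Complex.reLm ∘ₗ D.taut 1 x).prod (D.taut 2 x)))

end Connection

end

/-! The proof is Cartan's reduction carried out on frames. Replacing a generator L of the CR bundle
by fL multiplies T by f f̄ modulo L, L̄ and multiplies S by f² f̄ modulo T, L, L̄
(`form_fieldT_smul`, `form_fieldS_smul`), and class II makes (S, T, L, L̄) a frame. The rest is
computation with torsion coefficients by three tools: Cartan's formula `form_bracket`, the change of
frame `tor_change`, and the Jacobi identity `jacobi_tor`.

Rigidity. In the frame dual to a reduced coframe, e_ζ generates the CR bundle, e_ζ̄ is its
conjugate, and e_ρ is real because T is. That e_σ is real is not a normalization. The condition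
T^σ_{ρζ̄} = 1 gives it modulo e_ρ, and the σ-component of the Jacobi identity for e_ρ, e_ζ, e_ζ̄
removes the e_ρ part (`conj_e0`). For two reduced sections, e_ζ' = F e_ζ. Reality of σ forces F to
be real, and the transformation laws of the normalized coefficients then kill the off-diagonal
entries successively. What remains is e_i' = F^{w_i} e_i with weights 3, 2, 1, 1 (`θ_e_ratio`).
Under such a change each torsion coefficient in λ acquires a multiple of a derivative of F, and the
constants 1/2 and -1/3 are those for which λ' = λ - dF/F (`lam_ratio`). Hence da/a + λ does not
depend on the section.

Existence. Modulo T, L, L̄ the conjugate of S is A·S with |A| = 1, and a rescaling of L achieves A =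
1. The real part R of S completes a real frame (R, T, L, L̄). Adding P T + q L + q̄ L̄ to R and b L
+ b̄ L̄ to T, the remaining normalizations become equations for P, b, q; the Jacobi identity shows
that the required P is real (`IsPrereduced.exists_isReduced`).

Connection. In a trivialization the tautological forms are a^{w_i} θ^i. Any real λ would then give a
form with the three Cartan properties over one section: the vertical and equivariance properties
come from da/a and from the weights, which are those of the adjoint action of 𝔊₀, and bijectivity
comes from the independence of the coframe together with a count of dimensions. The special λ is
what makes the local forms fit together. -/

noncomputable section

/-! ### Real and imaginary parts, and conjugation, on ℂ ⊗ V. -/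

section ComplexTangentAlgebra

variable {V : Type*} [AddCommGroup V] [Module ℝ V]

@[simp] theorem rePart_tmul (z : ℂ) (x : V) : rePart (z ⊗ₜ[ℝ] x) = z.re • x := by
  simp [rePart]

@[simp] theorem imPart_tmul (z : ℂ) (x : V) : imPart (z ⊗ₜ[ℝ] x) = z.im • x := by
  simp [imPart]

@[simp] theorem conjVec_tmul (z : ℂ) (x : V) : conjVec (z ⊗ₜ[ℝ] x) = conj z ⊗ₜ[ℝ] x := by
  simp [conjVec]

@[simp] theorem rePart_smul (z : ℂ) (v : ℂ ⊗[ℝ] V) :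
    rePart (z • v) = z.re • rePart v - z.im • imPart v := by
  induction v with
  | zero => simp
  | tmul w x => simp [TensorProduct.smul_tmul', sub_smul, mul_smul]
  | add v w hv hw => simp only [smul_add, map_add, hv, hw]; abel

@[simp] theorem imPart_smul (z : ℂ) (v : ℂ ⊗[ℝ] V) :
    imPart (z • v) = z.re • imPart v + z.im • rePart v := by
  induction v with
  | zero => simp
  | tmul w x => simp [TensorProduct.smul_tmul', add_smul, mul_smul]
  | add v w hv hw => simp only [smul_add, map_add, hv, hw]; abel

@[simp] theorem rePart_conjVec (v : ℂ ⊗[ℝ] V) : rePart (conjVec v) = rePart v := by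
  induction v with
  | zero => simp
  | tmul w x => simp
  | add v w hv hw => simp only [map_add, hv, hw]

@[simp] theorem imPart_conjVec (v : ℂ ⊗[ℝ] V) : imPart (conjVec v) = -imPart v := by
  induction v with
  | zero => simp
  | tmul w x => simp
  | add v w hv hw => simp only [map_add, hv, hw]; abel

@[simp] theorem rePart_mkVec (x y : V) : rePart (mkVec x y) = x := by simp [mkVec]

@[simp] theorem imPart_mkVec (x y : V) : imPart (mkVec x y) = y := by simp [mkVec]

theorem mkVec_rePart_imPart (v : ℂ ⊗[ℝ] V) : mkVec (rePart v) (imPart v) = v := by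
  induction v with
  | zero => simp [mkVec]
  | tmul w x =>
    simp only [mkVec, rePart_tmul, imPart_tmul, ← TensorProduct.smul_tmul,
      ← TensorProduct.add_tmul]
    congr 1
    apply Complex.ext <;> simp
  | add v w hv hw =>
    conv_rhs => rw [← hv, ← hw]
    simp only [mkVec, map_add, TensorProduct.tmul_add]
    abel

/-- Identities between complex brackets are reduced to identities between real Lie brackets by this
criterion. -/
theorem complexVec_ext {v w : ℂ ⊗[ℝ] V} (h₁ : rePart v = rePart w) (h₂ : imPart v = imPart w) :
    v = w := by
  rw [← mkVec_rePart_imPart v, ← mkVec_rePart_imPart w, h₁, h₂]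

@[simp] theorem conjVec_conjVec (v : ℂ ⊗[ℝ] V) : conjVec (conjVec v) = v :=
  complexVec_ext (by simp) (by simp)

@[simp] theorem conjVec_smul (z : ℂ) (v : ℂ ⊗[ℝ] V) :
    conjVec (z • v) = conj z • conjVec v :=
  complexVec_ext (by simp) (by simp; abel)

/-- The complex linear extension of a complex valued real covector. -/
def complexify (φ : V →ₗ[ℝ] ℂ) : ℂ ⊗[ℝ] V →ₗ[ℂ] ℂ where
  toFun v := φ (rePart v) + Complex.I * φ (imPart v)
  map_add' v w := by simp only [map_add]; ring
  map_smul' z v := by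
    simp only [rePart_smul, imPart_smul, map_sub, map_add, map_smul, Complex.real_smul,
      RingHom.id_apply, smul_eq_mul]
    conv_rhs => rw [← Complex.re_add_im z]
    linear_combination (-((z.im : ℂ) * φ (imPart v))) * Complex.I_sq

theorem complexify_apply (φ : V →ₗ[ℝ] ℂ) (v : ℂ ⊗[ℝ] V) :
    complexify φ v = φ (rePart v) + Complex.I * φ (imPart v) := rfl

theorem apply_eq_re_add_im (θ : ℂ ⊗[ℝ] V →ₗ[ℂ] ℂ) (v : ℂ ⊗[ℝ] V) :
    θ v = θ ((1 : ℂ) ⊗ₜ[ℝ] rePart v) + Complex.I * θ ((1 : ℂ) ⊗ₜ[ℝ] imPart v) := by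
  conv_lhs => rw [← mkVec_rePart_imPart v, mkVec, map_add]
  congr 1
  rw [← smul_eq_mul, ← map_smul, TensorProduct.smul_tmul']
  simp

end ComplexTangentAlgebra

/-! ### Complex differentials and the complexified Lie bracket: Leibniz rules, conjugation, Jacobi
identity. -/

section Calculus

set_option linter.unusedSectionVars false

variable {M : Type*} [TopologicalSpace M] [ChartedSpace R4 M] [IsManifold (𝓡 4) ∞ M]

/-- Smoothness at a point of a complex function. -/
abbrev SmoothFunAt (f : M → ℂ) (p : M) : Prop := ContMDiffAt (𝓡 4) 𝓘(ℝ, ℂ) ∞ f p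

/-- The complex linear differential of a complex function. -/
def cderiv (f : M → ℂ) (p : M) : ℂ ⊗[ℝ] TangentSpace (𝓡 4) p →ₗ[ℂ] ℂ :=
  complexify (mvfderiv (𝓡 4) f p).toLinearMap

theorem cderiv_apply (f : M → ℂ) (p : M) (v : ℂ ⊗[ℝ] TangentSpace (𝓡 4) p) :
    cderiv f p v = mvfderiv (𝓡 4) f p (rePart v) + Complex.I * mvfderiv (𝓡 4) f p (imPart v) :=
  rfl

theorem SmoothFunAt.mdifferentiableAt {f : M → ℂ} {p : M} (hf : SmoothFunAt f p) :
    MDifferentiableAt (𝓡 4) 𝓘(ℝ, ℂ) f p :=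
  ContMDiffAt.mdifferentiableAt hf (by simp)

theorem cderiv_congr {f g : M → ℂ} {p : M} (h : f =ᶠ[nhds p] g) : cderiv f p = cderiv g p := by
  have : mvfderiv (𝓡 4) f p = mvfderiv (𝓡 4) g p := by
    ext v
    change (mfderiv (𝓡 4) 𝓘(ℝ, ℂ) f p v : ℂ) = (mfderiv (𝓡 4) 𝓘(ℝ, ℂ) g p v : ℂ)
    rw [h.mfderiv_eq]
    rfl
  ext v
  simp only [cderiv, this]

theorem cderiv_const (c : ℂ) (p : M) : cderiv (fun _ : M => c) p = 0 := by
  apply LinearMap.ext; intro v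
  simp [cderiv_apply, mvfderiv_const]

theorem cderiv_add {f g : M → ℂ} {p : M} (hf : SmoothFunAt f p) (hg : SmoothFunAt g p) :
    cderiv (fun q => f q + g q) p = cderiv f p + cderiv g p := by
  apply LinearMap.ext; intro v
  have := mvfderiv_add hf.mdifferentiableAt hg.mdifferentiableAt
  change mvfderiv (𝓡 4) (fun q => f q + g q) p = _ at this
  simp only [cderiv_apply, this, LinearMap.add_apply]
  simp only [_root_.add_apply]
  ring

theorem cderiv_mul {f g : M → ℂ} {p : M} (hf : SmoothFunAt f p) (hg : SmoothFunAt g p) :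
    cderiv (fun q => f q * g q) p = f p • cderiv g p + g p • cderiv f p := by
  apply LinearMap.ext; intro v
  have key : ∀ w, mvfderiv (𝓡 4) (fun q => f q * g q) p w
      = f p * mvfderiv (𝓡 4) g p w + g p * mvfderiv (𝓡 4) f p w := by
    intro w
    have h1 := hf.mdifferentiableAt.hasMFDerivAt.mul hg.mdifferentiableAt.hasMFDerivAt
    have h2 := h1.mfderiv
    change (mfderiv (𝓡 4) 𝓘(ℝ, ℂ) (f * g) p w : ℂ) = _
    rw [h2]
    rfl
  simp only [cderiv_apply, key, LinearMap.add_apply, LinearMap.smul_apply, smul_eq_mul]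
  ring

theorem isManifold_minSmoothness (n : ℕ∞) : IsManifold (𝓡 4) (minSmoothness ℝ n) M := by
  rw [minSmoothness_of_isRCLikeNormedField]
  exact IsManifold.of_le (n := ∞) (by exact_mod_cast le_top)

theorem contMDiffAt_mlieBracket {A B : ∀ q : M, TangentSpace (𝓡 4) q} {p : M}
    (hA : ContMDiffAt (𝓡 4) (𝓡 4).tangent ∞ (fun q => (⟨q, A q⟩ : TangentBundle (𝓡 4) M)) p)
    (hB : ContMDiffAt (𝓡 4) (𝓡 4).tangent ∞ (fun q => (⟨q, B q⟩ : TangentBundle (𝓡 4) M)) p) :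
    ContMDiffAt (𝓡 4) (𝓡 4).tangent ∞
      (fun q => (⟨q, mlieBracket (𝓡 4) A B q⟩ : TangentBundle (𝓡 4) M)) p := by
  have : IsManifold (𝓡 4) (((⊤ : ℕ∞) : WithTop ℕ∞) + 1) M := by
    simpa using! (inferInstance : IsManifold (𝓡 4) ∞ M)
  have := isManifold_minSmoothness (M := M) 2
  exact ContMDiffAt.mlieBracket_vectorField (m := ⊤) (n := ⊤) hA hB (by simp)

theorem mlieBracket_sub_right {A B C : ∀ q : M, TangentSpace (𝓡 4) q} {p : M}
    (hA : MDifferentiableAt (𝓡 4) (𝓡 4).tangent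
      (fun q => (⟨q, A q⟩ : TangentBundle (𝓡 4) M)) p)
    (hB : MDifferentiableAt (𝓡 4) (𝓡 4).tangent
      (fun q => (⟨q, B q⟩ : TangentBundle (𝓡 4) M)) p) :
    mlieBracket (𝓡 4) C (A - B) p = mlieBracket (𝓡 4) C A p - mlieBracket (𝓡 4) C B p := by
  have := isManifold_minSmoothness (M := M) 2
  have h : A - B = A + (-1 : ℝ) • B := by ext q; simp [sub_eq_add_neg]
  rw [h, mlieBracket_add_right (W₁ := (-1 : ℝ) • B) hA
    (mdifferentiableAt_const (c := (-1 : ℝ)) |>.smul_section hB), mlieBracket_const_smul_right hB]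
  simp [sub_eq_add_neg]

namespace CVectorField

/-- Smoothness at a point of a complex vector field. -/
def SmoothAt (Z : CVectorField M) (p : M) : Prop :=
  ContMDiffAt (𝓡 4) (𝓡 4).tangent ∞
    (fun q => (⟨q, rePart (Z q)⟩ : TangentBundle (𝓡 4) M)) p ∧
  ContMDiffAt (𝓡 4) (𝓡 4).tangent ∞
    (fun q => (⟨q, imPart (Z q)⟩ : TangentBundle (𝓡 4) M)) p

theorem smoothOn_iff {Z : CVectorField M} {U : Opens M} :
    Z.SmoothOn U ↔ ∀ p ∈ U, Z.SmoothAt p := by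
  constructor
  · intro h p hp
    exact ⟨h.1.contMDiffAt (U.isOpen.mem_nhds hp), h.2.contMDiffAt (U.isOpen.mem_nhds hp)⟩
  · intro h
    exact ⟨fun p hp => (h p hp).1.contMDiffWithinAt, fun p hp => (h p hp).2.contMDiffWithinAt⟩

variable {Z W X Y : CVectorField M} {f g : M → ℂ} {p : M}

theorem SmoothAt.bar (hZ : Z.SmoothAt p) : Z.bar.SmoothAt p := by
  refine ⟨?_, ?_⟩
  · simpa [CVectorField.bar] using hZ.1
  · simpa [CVectorField.bar] using! hZ.2.neg_section

theorem SmoothAt.add (hZ : Z.SmoothAt p) (hW : W.SmoothAt p) :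
    SmoothAt (fun q => Z q + W q) p := by
  refine ⟨?_, ?_⟩
  · simpa using! hZ.1.add_section hW.1
  · simpa using! hZ.2.add_section hW.2

theorem SmoothAt.smul (hf : SmoothFunAt f p) (hZ : Z.SmoothAt p) :
    SmoothAt (fun q => f q • Z q) p := by
  have hre : ContMDiffAt (𝓡 4) 𝓘(ℝ, ℝ) ∞ (fun q => (f q).re) p :=
    Complex.reCLM.contDiff.contMDiff.contMDiffAt.comp p hf
  have him : ContMDiffAt (𝓡 4) 𝓘(ℝ, ℝ) ∞ (fun q => (f q).im) p :=
    Complex.imCLM.contDiff.contMDiff.contMDiffAt.comp p hf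
  refine ⟨?_, ?_⟩
  · simpa using! (hre.smul_section hZ.1).sub_section (him.smul_section hZ.2)
  · simpa using! (hre.smul_section hZ.2).add_section (him.smul_section hZ.1)

theorem SmoothAt.const_smul (c : ℂ) (hZ : Z.SmoothAt p) : SmoothAt (fun q => c • Z q) p :=
  SmoothAt.smul contMDiffAt_const hZ

theorem SmoothAt.bracket (hZ : Z.SmoothAt p) (hW : W.SmoothAt p) :
    (Z.bracket W).SmoothAt p := by
  refine ⟨?_, ?_⟩
  · simpa [CVectorField.bracket] using! (contMDiffAt_mlieBracket hZ.1 hW.1).sub_section (contMDiffAt_mlieBracket hZ.2 hW.2)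
  · simpa [CVectorField.bracket] using! (contMDiffAt_mlieBracket hZ.1 hW.2).add_section (contMDiffAt_mlieBracket hZ.2 hW.1)

theorem SmoothAt.mdiff_re (hZ : Z.SmoothAt p) : MDifferentiableAt (𝓡 4) (𝓡 4).tangent
    (fun q => (⟨q, rePart (Z q)⟩ : TangentBundle (𝓡 4) M)) p :=
  hZ.1.mdifferentiableAt (by simp)

theorem SmoothAt.mdiff_im (hZ : Z.SmoothAt p) : MDifferentiableAt (𝓡 4) (𝓡 4).tangent
    (fun q => (⟨q, imPart (Z q)⟩ : TangentBundle (𝓡 4) M)) p :=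
  hZ.2.mdifferentiableAt (by simp)

theorem rePart_bracket : rePart (bracket Z W p) =
    mlieBracket (𝓡 4) (fun q => rePart (Z q)) (fun q => rePart (W q)) p
      - mlieBracket (𝓡 4) (fun q => imPart (Z q)) (fun q => imPart (W q)) p :=
  rePart_mkVec _ _

theorem imPart_bracket : imPart (bracket Z W p) =
    mlieBracket (𝓡 4) (fun q => rePart (Z q)) (fun q => imPart (W q)) p
      + mlieBracket (𝓡 4) (fun q => imPart (Z q)) (fun q => rePart (W q)) p :=
  imPart_mkVec _ _

theorem bracket_congr {Z' W' : CVectorField M} (hZ : ∀ᶠ q in nhds p, Z q = Z' q)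
    (hW : ∀ᶠ q in nhds p, W q = W' q) : bracket Z W p = bracket Z' W' p := by
  have hZ1 : (fun q => rePart (Z q)) =ᶠ[nhds p] fun q => rePart (Z' q) :=
    hZ.mono fun q hq => by simp only [hq]
  have hZ2 : (fun q => imPart (Z q)) =ᶠ[nhds p] fun q => imPart (Z' q) :=
    hZ.mono fun q hq => by simp only [hq]
  have hW1 : (fun q => rePart (W q)) =ᶠ[nhds p] fun q => rePart (W' q) :=
    hW.mono fun q hq => by simp only [hq]
  have hW2 : (fun q => imPart (W q)) =ᶠ[nhds p] fun q => imPart (W' q) :=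
    hW.mono fun q hq => by simp only [hq]
  have := isManifold_minSmoothness (M := M) 2
  apply complexVec_ext
  · rw [rePart_bracket, rePart_bracket]
    exact congrArg₂ (· - ·) (hZ1.mlieBracket_vectorField_eq (I := 𝓡 4) hW1)
      (hZ2.mlieBracket_vectorField_eq (I := 𝓡 4) hW2)
  · rw [imPart_bracket, imPart_bracket]
    exact congrArg₂ (· + ·) (hZ1.mlieBracket_vectorField_eq (I := 𝓡 4) hW2)
      (hZ2.mlieBracket_vectorField_eq (I := 𝓡 4) hW1)

theorem bracket_swap (Z W : CVectorField M) (p : M) : bracket Z W p = -bracket W Z p := by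
  apply complexVec_ext
  · rw [map_neg, rePart_bracket, rePart_bracket, mlieBracket_swap_apply (V := fun q => rePart (Z q)),
      mlieBracket_swap_apply (V := fun q => imPart (Z q))]
    abel
  · rw [map_neg, imPart_bracket, imPart_bracket, mlieBracket_swap_apply (V := fun q => rePart (Z q)),
      mlieBracket_swap_apply (V := fun q => imPart (Z q))]
    abel

theorem bracket_add_left (hZ : Z.SmoothAt p) (hX : X.SmoothAt p) :
    bracket (fun q => Z q + X q) W p = bracket Z W p + bracket X W p := by
  have h1 : (fun q => rePart (Z q + X q)) = (fun q => rePart (Z q)) + fun q => rePart (X q) := by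
    ext q; simp
  have h2 : (fun q => imPart (Z q + X q)) = (fun q => imPart (Z q)) + fun q => imPart (X q) := by
    ext q; simp
  have := isManifold_minSmoothness (M := M) 2
  apply complexVec_ext
  · rw [map_add, rePart_bracket, rePart_bracket, rePart_bracket, h1, h2,
      mlieBracket_add_left hZ.mdiff_re hX.mdiff_re, mlieBracket_add_left hZ.mdiff_im hX.mdiff_im]
    abel
  · rw [map_add, imPart_bracket, imPart_bracket, imPart_bracket, h1, h2,
      mlieBracket_add_left hZ.mdiff_re hX.mdiff_re, mlieBracket_add_left hZ.mdiff_im hX.mdiff_im]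
    abel

theorem bracket_smul_left (hf : SmoothFunAt f p) (hZ : Z.SmoothAt p) :
    bracket (fun q => f q • Z q) W p = f p • bracket Z W p - cderiv f p (W p) • Z p := by
  have := isManifold_minSmoothness (M := M) 2
  let u : M → ℝ := fun q => (f q).re
  let v : M → ℝ := fun q => (f q).im
  have hu : MDifferentiableAt (𝓡 4) 𝓘(ℝ, ℝ) u p :=
    (Complex.reCLM.contDiff.contMDiff.contMDiffAt.comp p hf).mdifferentiableAt (n := ∞) (by simp)
  have hv : MDifferentiableAt (𝓡 4) 𝓘(ℝ, ℝ) v p :=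
    (Complex.imCLM.contDiff.contMDiff.contMDiffAt.comp p hf).mdifferentiableAt (n := ∞) (by simp)
  have hdu : ∀ w, (mvfderiv (𝓡 4) f p w).re = mvfderiv (𝓡 4) u p w := by
    intro w
    have h1 := (Complex.reCLM.hasMFDerivAt (x := f p)).comp p
      hf.mdifferentiableAt.hasMFDerivAt
    symm
    change (mfderiv (𝓡 4) 𝓘(ℝ, ℝ) (Complex.reCLM ∘ f) p w : ℝ) = _
    rw [h1.mfderiv]
    rfl
  have hdv : ∀ w, (mvfderiv (𝓡 4) f p w).im = mvfderiv (𝓡 4) v p w := by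
    intro w
    have h1 := (Complex.imCLM.hasMFDerivAt (x := f p)).comp p
      hf.mdifferentiableAt.hasMFDerivAt
    symm
    change (mfderiv (𝓡 4) 𝓘(ℝ, ℝ) (Complex.imCLM ∘ f) p w : ℝ) = _
    rw [h1.mfderiv]
    rfl
  have h1 : (fun q => rePart (f q • Z q))
      = (u • fun q => rePart (Z q)) + ((-v) • fun q => imPart (Z q)) := by
    ext q; simp [u, v, sub_eq_add_neg]
  have h2 : (fun q => imPart (f q • Z q))
      = (u • fun q => imPart (Z q)) + (v • fun q => rePart (Z q)) := by
    ext q; simp [u, v]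
  have e1 : ∀ A, mlieBracket (𝓡 4) (fun q => rePart (f q • Z q)) A p =
      (u p • mlieBracket (𝓡 4) (fun q => rePart (Z q)) A p - mvfderiv (𝓡 4) u p (A p) • rePart (Z p))
      - (v p • mlieBracket (𝓡 4) (fun q => imPart (Z q)) A p
        - mvfderiv (𝓡 4) v p (A p) • imPart (Z p)) := by
    intro A
    rw [h1, mlieBracket_add_left (hu.smul_section hZ.mdiff_re) (hv.neg.smul_section hZ.mdiff_im),
      mlieBracket_smul_left hu hZ.mdiff_re, mlieBracket_smul_left hv.neg hZ.mdiff_im, mvfderiv_neg]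
    simp
    abel
  have e2 : ∀ A, mlieBracket (𝓡 4) (fun q => imPart (f q • Z q)) A p =
      (u p • mlieBracket (𝓡 4) (fun q => imPart (Z q)) A p - mvfderiv (𝓡 4) u p (A p) • imPart (Z p))
      + (v p • mlieBracket (𝓡 4) (fun q => rePart (Z q)) A p
        - mvfderiv (𝓡 4) v p (A p) • rePart (Z p)) := by
    intro A
    rw [h2, mlieBracket_add_left (hu.smul_section hZ.mdiff_im) (hv.smul_section hZ.mdiff_re),
      mlieBracket_smul_left hu hZ.mdiff_im, mlieBracket_smul_left hv hZ.mdiff_re]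
    simp
    abel
  apply complexVec_ext
  · rw [rePart_bracket, e1, e2, map_sub, rePart_smul, rePart_smul, rePart_bracket, imPart_bracket]
    simp only [cderiv_apply, Complex.add_re, Complex.add_im, Complex.mul_re, Complex.mul_im,
      Complex.I_re, Complex.I_im, hdu, hdv]
    change _ = u p • _ - v p • _ - _
    module
  · rw [imPart_bracket, e1, e2, map_sub, imPart_smul, imPart_smul, rePart_bracket, imPart_bracket]
    simp only [cderiv_apply, Complex.add_re, Complex.add_im, Complex.mul_re, Complex.mul_im,
      Complex.I_re, Complex.I_im, hdu, hdv]
    change _ = u p • _ + v p • _ - _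
    module

theorem bracket_add_right (hZ : Z.SmoothAt p) (hX : X.SmoothAt p) :
    bracket W (fun q => Z q + X q) p = bracket W Z p + bracket W X p := by
  rw [bracket_swap, bracket_add_left hZ hX, bracket_swap W Z, bracket_swap W X]
  abel

theorem bracket_smul_right (hf : SmoothFunAt f p) (hZ : Z.SmoothAt p) :
    bracket W (fun q => f q • Z q) p = f p • bracket W Z p + cderiv f p (W p) • Z p := by
  rw [bracket_swap, bracket_smul_left hf hZ, bracket_swap W Z]
  module

theorem bar_bracket (hZ : Z.SmoothAt p) (hW : W.SmoothAt p) :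
    conjVec (bracket Z W p) = bracket Z.bar W.bar p := by
  have := isManifold_minSmoothness (M := M) 2
  have h1 : ∀ Z : CVectorField M, (fun q => rePart (Z.bar q)) = fun q => rePart (Z q) := by
    intro Z; ext q; simp [bar]
  have h2 : ∀ Z : CVectorField M, (fun q => imPart (Z.bar q))
      = (-1 : ℝ) • fun q => imPart (Z q) := by
    intro Z; ext q; simp [bar]
  apply complexVec_ext
  · rw [rePart_conjVec, rePart_bracket, rePart_bracket, h1, h1, h2, h2,
      mlieBracket_const_smul_left hZ.mdiff_im,
      mlieBracket_const_smul_right hW.mdiff_im]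
    simp
  · rw [imPart_conjVec, imPart_bracket, imPart_bracket, h1, h1, h2, h2,
      mlieBracket_const_smul_left hZ.mdiff_im,
      mlieBracket_const_smul_right hW.mdiff_im]
    simp only [neg_smul, one_smul]
    abel

theorem bracket_bracket (X : CVectorField M) (hY : Y.SmoothAt p) (hZ : Z.SmoothAt p) :
    rePart (bracket X (bracket Y Z) p) =
      mlieBracket (𝓡 4) (fun q => rePart (X q))
        (mlieBracket (𝓡 4) (fun q => rePart (Y q)) (fun q => rePart (Z q))) p
      - mlieBracket (𝓡 4) (fun q => rePart (X q))
        (mlieBracket (𝓡 4) (fun q => imPart (Y q)) (fun q => imPart (Z q))) p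
      - mlieBracket (𝓡 4) (fun q => imPart (X q))
        (mlieBracket (𝓡 4) (fun q => rePart (Y q)) (fun q => imPart (Z q))) p
      - mlieBracket (𝓡 4) (fun q => imPart (X q))
        (mlieBracket (𝓡 4) (fun q => imPart (Y q)) (fun q => rePart (Z q))) p ∧
    imPart (bracket X (bracket Y Z) p) =
      mlieBracket (𝓡 4) (fun q => rePart (X q))
        (mlieBracket (𝓡 4) (fun q => rePart (Y q)) (fun q => imPart (Z q))) p
      + mlieBracket (𝓡 4) (fun q => rePart (X q))
        (mlieBracket (𝓡 4) (fun q => imPart (Y q)) (fun q => rePart (Z q))) p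
      + mlieBracket (𝓡 4) (fun q => imPart (X q))
        (mlieBracket (𝓡 4) (fun q => rePart (Y q)) (fun q => rePart (Z q))) p
      - mlieBracket (𝓡 4) (fun q => imPart (X q))
        (mlieBracket (𝓡 4) (fun q => imPart (Y q)) (fun q => imPart (Z q))) p := by
  have := isManifold_minSmoothness (M := M) 2
  have h1 : (fun q => rePart (bracket Y Z q)) =
      mlieBracket (𝓡 4) (fun q => rePart (Y q)) (fun q => rePart (Z q))
      - mlieBracket (𝓡 4) (fun q => imPart (Y q)) (fun q => imPart (Z q)) := by
    ext q; rw [rePart_bracket]; rfl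
  have h2 : (fun q => imPart (bracket Y Z q)) =
      mlieBracket (𝓡 4) (fun q => rePart (Y q)) (fun q => imPart (Z q))
      + mlieBracket (𝓡 4) (fun q => imPart (Y q)) (fun q => rePart (Z q)) := by
    ext q; rw [imPart_bracket]; rfl
  have hn : (∞ : WithTop ℕ∞) ≠ 0 := by simp
  rw [rePart_bracket, imPart_bracket, h1, h2,
    mlieBracket_sub_right ((contMDiffAt_mlieBracket hY.1 hZ.1).mdifferentiableAt hn)
      ((contMDiffAt_mlieBracket hY.2 hZ.2).mdifferentiableAt hn),
    mlieBracket_sub_right ((contMDiffAt_mlieBracket hY.1 hZ.1).mdifferentiableAt hn)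
      ((contMDiffAt_mlieBracket hY.2 hZ.2).mdifferentiableAt hn),
    mlieBracket_add_right ((contMDiffAt_mlieBracket hY.1 hZ.2).mdifferentiableAt hn)
      ((contMDiffAt_mlieBracket hY.2 hZ.1).mdifferentiableAt hn),
    mlieBracket_add_right ((contMDiffAt_mlieBracket hY.1 hZ.2).mdifferentiableAt hn)
      ((contMDiffAt_mlieBracket hY.2 hZ.1).mdifferentiableAt hn)]
  constructor <;> abel

/-- Expanding into real and imaginary parts, the real part is a combination of the four real Jacobi
identities for triples with an even number of imaginary parts, and the imaginary part of the four
with an odd number. -/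
theorem jacobi (hX : X.SmoothAt p) (hY : Y.SmoothAt p) (hZ : Z.SmoothAt p) :
    bracket X (bracket Y Z) p + bracket Y (bracket Z X) p + bracket Z (bracket X Y) p = 0 := by
  have := isManifold_minSmoothness (M := M) 3
  have key : ∀ {A B C : ∀ q : M, TangentSpace (𝓡 4) q},
      ContMDiffAt (𝓡 4) (𝓡 4).tangent ∞ (fun q => (⟨q, A q⟩ : TangentBundle (𝓡 4) M)) p →
      ContMDiffAt (𝓡 4) (𝓡 4).tangent ∞ (fun q => (⟨q, B q⟩ : TangentBundle (𝓡 4) M)) p →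
      ContMDiffAt (𝓡 4) (𝓡 4).tangent ∞ (fun q => (⟨q, C q⟩ : TangentBundle (𝓡 4) M)) p →
      mlieBracket (𝓡 4) A (mlieBracket (𝓡 4) B C) p =
        -mlieBracket (𝓡 4) B (mlieBracket (𝓡 4) C A) p
        - mlieBracket (𝓡 4) C (mlieBracket (𝓡 4) A B) p := by
    intro A B C hA hB hC
    have hn : minSmoothness ℝ 2 ≤ (∞ : WithTop ℕ∞) := by
      rw [minSmoothness_of_isRCLikeNormedField]
      exact (mod_cast le_top : ((2 : ℕ∞) : WithTop ℕ∞) ≤ ∞)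
    have h := leibniz_identity_mlieBracket_apply (hA.of_le hn) (hB.of_le hn) (hC.of_le hn)
    have h1 : mlieBracket (𝓡 4) B (mlieBracket (𝓡 4) C A) p
        = -mlieBracket (𝓡 4) B (mlieBracket (𝓡 4) A C) p := by
      have h2 : mlieBracket (𝓡 4) C A = (-1 : ℝ) • mlieBracket (𝓡 4) A C := by
        rw [mlieBracket_swap]; simp
      have := isManifold_minSmoothness (M := M) 2
      rw [h2, mlieBracket_const_smul_right
        ((contMDiffAt_mlieBracket hA hC).mdifferentiableAt (by simp))]
      simp
    rw [h, h1, mlieBracket_swap_apply (V := C)]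
    abel
  apply complexVec_ext
  · rw [map_add, map_add, (bracket_bracket X hY hZ).1, (bracket_bracket Y hZ hX).1,
      (bracket_bracket Z hX hY).1, key hX.1 hY.1 hZ.1, key hX.1 hY.2 hZ.2, key hX.2 hY.1 hZ.2,
      key hX.2 hY.2 hZ.1, map_zero]
    abel
  · rw [map_add, map_add, (bracket_bracket X hY hZ).2, (bracket_bracket Y hZ hX).2,
      (bracket_bracket Z hX hY).2, key hX.1 hY.1 hZ.2, key hX.1 hY.2 hZ.1, key hX.2 hY.1 hZ.1,
      key hX.2 hY.2 hZ.2, map_zero]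
    abel

end CVectorField

end Calculus

/-! ### Smooth covectors, dual coframes, torsion coefficients and Cartan's formula. -/

section Forms

set_option linter.unusedSectionVars false

variable {M : Type*} [TopologicalSpace M] [ChartedSpace R4 M] [IsManifold (𝓡 4) ∞ M]

section SmoothFun

variable {f g : M → ℂ} {p : M}

theorem SmoothFunAt.add (hf : SmoothFunAt f p) (hg : SmoothFunAt g p) :
    SmoothFunAt (fun q => f q + g q) p :=
  ContMDiffAt.add hf hg

theorem SmoothFunAt.mul (hf : SmoothFunAt f p) (hg : SmoothFunAt g p) :
    SmoothFunAt (fun q => f q * g q) p := by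
  have h : ContDiff ℝ ∞ fun x : ℂ × ℂ => x.1 * x.2 := contDiff_mul
  exact h.contMDiff.contMDiffAt.comp p (hf.prodMk_space hg)

theorem SmoothFunAt.neg (hf : SmoothFunAt f p) : SmoothFunAt (fun q => -f q) p :=
  ContMDiffAt.neg hf

theorem SmoothFunAt.sub (hf : SmoothFunAt f p) (hg : SmoothFunAt g p) :
    SmoothFunAt (fun q => f q - g q) p :=
  ContMDiffAt.sub hf hg

theorem SmoothFunAt.conj (hf : SmoothFunAt f p) : SmoothFunAt (fun q => conj (f q)) p :=
  Complex.conjCLE.toContinuousLinearMap.contDiff.contMDiff.contMDiffAt.comp p hf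

theorem SmoothFunAt.inv (hf : SmoothFunAt f p) (h : f p ≠ 0) :
    SmoothFunAt (fun q => (f q)⁻¹) p :=
  ((contDiffAt_inv ℝ h).contMDiffAt).comp p hf

theorem SmoothFunAt.div (hf : SmoothFunAt f p) (hg : SmoothFunAt g p) (h : g p ≠ 0) :
    SmoothFunAt (fun q => f q / g q) p := by
  simp only [div_eq_mul_inv]
  exact hf.mul (hg.inv h)

theorem smoothFunAt_const (c : ℂ) : SmoothFunAt (fun _ : M => c) p := contMDiffAt_const

theorem SmoothFunAt.congr (hf : SmoothFunAt f p) (h : ∀ᶠ q in nhds p, g q = f q) :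
    SmoothFunAt g p :=
  ContMDiffAt.congr_of_eventuallyEq hf h

theorem smoothFunAt_sum {ι : Type*} (s : Finset ι) {F : ι → M → ℂ}
    (h : ∀ i ∈ s, SmoothFunAt (F i) p) : SmoothFunAt (fun q => ∑ i ∈ s, F i q) p := by
  classical
  induction s using Finset.induction_on with
  | empty => simpa using smoothFunAt_const 0
  | insert i s hi ih =>
    simp only [Finset.sum_insert hi]
    exact (h i (by simp)).add (ih fun j hj => h j (by simp [hj]))

theorem smoothFunAt_prod {ι : Type*} (s : Finset ι) {F : ι → M → ℂ}
    (h : ∀ i ∈ s, SmoothFunAt (F i) p) : SmoothFunAt (fun q => ∏ i ∈ s, F i q) p := by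
  classical
  induction s using Finset.induction_on with
  | empty => simpa using smoothFunAt_const 1
  | insert i s hi ih =>
    simp only [Finset.prod_insert hi]
    exact (h i (by simp)).mul (ih fun j hj => h j (by simp [hj]))

theorem smoothFunAt_det {n : Type*} [Fintype n] [DecidableEq n] {A : M → Matrix n n ℂ}
    (h : ∀ i j, SmoothFunAt (fun q => A q i j) p) : SmoothFunAt (fun q => (A q).det) p := by
  simp only [Matrix.det_apply']
  exact smoothFunAt_sum _ fun σ _ => (smoothFunAt_const _).mul
    (smoothFunAt_prod _ fun i _ => h _ _)

theorem smoothFunAt_adjugate {n : Type*} [Fintype n] [DecidableEq n] {A : M → Matrix n n ℂ}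
    (h : ∀ i j, SmoothFunAt (fun q => A q i j) p) (i j : n) :
    SmoothFunAt (fun q => (A q).adjugate i j) p := by
  simp only [Matrix.adjugate_apply]
  refine smoothFunAt_det fun k l => ?_
  by_cases hk : k = j
  · subst hk
    simpa using smoothFunAt_const _
  · simpa [Matrix.updateRow_ne hk] using h k l

end SmoothFun

/-- Smoothness at a point of a family of complex covectors. -/
def SmoothFormAt (θ : ∀ p : M, ℂ ⊗[ℝ] TangentSpace (𝓡 4) p →ₗ[ℂ] ℂ) (p : M) : Prop :=
  ∀ v : TangentBundle (𝓡 4) M, v.1 = p → ContMDiffAt (𝓡 4).tangent 𝓘(ℝ, ℂ) ∞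
    (fun v : TangentBundle (𝓡 4) M => onReal (θ v.1) v.2) v

theorem isOpen_tangentBundle_over (U : Opens M) :
    IsOpen {v : TangentBundle (𝓡 4) M | v.1 ∈ U} :=
  U.isOpen.preimage (FiberBundle.continuous_proj _ _)

theorem smoothFormOn_iff {θ : ∀ p : M, ℂ ⊗[ℝ] TangentSpace (𝓡 4) p →ₗ[ℂ] ℂ} {U : Opens M} :
    SmoothFormOn θ U ↔ ∀ p ∈ U, SmoothFormAt θ p := by
  constructor
  · rintro h p hp v rfl
    exact h.contMDiffAt ((isOpen_tangentBundle_over U).mem_nhds hp)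
  · intro h v hv
    exact (h v.1 hv v rfl).contMDiffWithinAt

namespace SmoothFormAt

variable {θ η : ∀ p : M, ℂ ⊗[ℝ] TangentSpace (𝓡 4) p →ₗ[ℂ] ℂ} {p : M}

theorem add (hθ : SmoothFormAt θ p) (hη : SmoothFormAt η p) :
    SmoothFormAt (fun q => θ q + η q) p := fun v hv =>
  (hθ v hv).add (hη v hv)

theorem smul {f : M → ℂ} (hf : SmoothFunAt f p) (hθ : SmoothFormAt θ p) :
    SmoothFormAt (fun q => f q • θ q) p := by
  rintro v rfl
  have h : ContDiff ℝ ∞ fun x : ℂ × ℂ => x.1 * x.2 := contDiff_mul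
  have hf' : ContMDiffAt (𝓡 4).tangent 𝓘(ℝ, ℂ) ∞
      (fun v : TangentBundle (𝓡 4) M => f v.1) v :=
    ContMDiffAt.comp v hf (Bundle.contMDiffAt_proj _)
  exact h.contMDiff.contMDiffAt.comp v (hf'.prodMk_space (hθ v rfl))

theorem sum {ι : Type*} (s : Finset ι)
    {F : ι → ∀ p : M, ℂ ⊗[ℝ] TangentSpace (𝓡 4) p →ₗ[ℂ] ℂ}
    (h : ∀ i ∈ s, SmoothFormAt (F i) p) : SmoothFormAt (fun q => ∑ i ∈ s, F i q) p := by
  classical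
  induction s using Finset.induction_on with
  | empty =>
    intro v hv
    simpa [onReal] using contMDiffAt_const
  | insert i s hi ih =>
    simp only [Finset.sum_insert hi]
    exact (h i (by simp)).add (ih fun j hj => h j (by simp [hj]))

theorem congr (hθ : SmoothFormAt θ p) (h : ∀ᶠ q in nhds p, η q = θ q) : SmoothFormAt η p := by
  rintro v rfl
  refine (hθ v rfl).congr_of_eventuallyEq ?_
  have := (FiberBundle.continuous_proj R4 (TangentSpace (𝓡 4) (M := M))).continuousAt
    (x := v) |>.eventually h
  filter_upwards [this] with w hw
  have hw' : η w.1 = θ w.1 := hw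
  rw [hw']

theorem apply {Z : CVectorField M} (hθ : SmoothFormAt θ p) (hZ : Z.SmoothAt p) :
    SmoothFunAt (fun q => θ q (Z q)) p := by
  have h1 : SmoothFunAt (fun q => onReal (θ q) (rePart (Z q))) p :=
    ContMDiffAt.comp p (g := fun v : TangentBundle (𝓡 4) M => onReal (θ v.1) v.2)
      (f := fun q => (⟨q, rePart (Z q)⟩ : TangentBundle (𝓡 4) M)) (hθ _ rfl) hZ.1
  have h2 : SmoothFunAt (fun q => onReal (θ q) (imPart (Z q))) p :=
    ContMDiffAt.comp p (g := fun v : TangentBundle (𝓡 4) M => onReal (θ v.1) v.2)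
      (f := fun q => (⟨q, imPart (Z q)⟩ : TangentBundle (𝓡 4) M)) (hθ _ rfl) hZ.2
  refine (h1.add ((smoothFunAt_const Complex.I).mul h2)).congr (Filter.Eventually.of_forall ?_)
  intro q
  exact apply_eq_re_add_im (θ q) (Z q)

end SmoothFormAt

@[simp] theorem onReal_complexify {p : M} (φ : TangentSpace (𝓡 4) p →ₗ[ℝ] ℂ)
    (v : TangentSpace (𝓡 4) p) : onReal (complexify φ) v = φ v := by
  simp [onReal, complexify_apply]

theorem smoothFormAt_cderiv {f : M → ℂ} {U : Opens M} (hf : ContMDiffOn (𝓡 4) 𝓘(ℝ, ℂ) ∞ f U)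
    {p : M} (hp : p ∈ U) : SmoothFormAt (fun q => cderiv f q) p := by
  have : IsManifold (𝓡 4) 1 M := IsManifold.of_le (n := ∞) (by simp)
  have h1 := hf.contMDiffOn_tangentMapWithin (m := ∞) (by simp) U.isOpen.uniqueMDiffOn
  have h2 : ContMDiffOn (𝓡 4).tangent 𝓘(ℝ, ℂ) ∞
      (fun v : TangentBundle (𝓡 4) M => (tangentMapWithin (𝓡 4) 𝓘(ℝ, ℂ) f U v).2)
      {v : TangentBundle (𝓡 4) M | v.1 ∈ U} :=
    (contMDiff_snd_tangentBundle_modelSpace ℂ 𝓘(ℝ, ℂ)).comp_contMDiffOn h1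
  refine smoothFormOn_iff.1 ?_ p hp
  refine h2.congr fun v hv => ?_
  refine (onReal_complexify _ _).trans ?_
  change (mfderiv (𝓡 4) 𝓘(ℝ, ℂ) f v.1 v.2 : ℂ) = _
  change _ = (mfderivWithin (𝓡 4) 𝓘(ℝ, ℂ) f U v.1 v.2 : ℂ)
  rw [mfderivWithin_of_isOpen U.isOpen hv]

/-- The `k`-th coordinate of the preferred chart at `p₀`. -/
def chartCoord (p₀ : M) (k : Fin 4) (q : M) : ℂ := ((extChartAt (𝓡 4) p₀ q) k : ℝ)

/-- The domain of the preferred chart at `p₀`. -/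
def chartDomain (p₀ : M) : Opens M := ⟨(chartAt R4 p₀).source, (chartAt R4 p₀).open_source⟩

theorem mem_chartDomain (p₀ : M) : p₀ ∈ chartDomain p₀ := mem_chart_source R4 p₀

/-- A coordinate of the Euclidean space as a complex valued real linear form. -/
def coordL (k : Fin 4) : R4 →L[ℝ] ℂ := Complex.ofRealCLM ∘L EuclideanSpace.proj k

theorem coordL_apply (k : Fin 4) (x : R4) : coordL k x = (x k : ℝ) := rfl

theorem coordL_im (k : Fin 4) (x : R4) : (coordL k x).im = 0 := by simp [coordL_apply]

theorem contMDiffOn_chartCoord (p₀ : M) (k : Fin 4) :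
    ContMDiffOn (𝓡 4) 𝓘(ℝ, ℂ) ∞ (chartCoord p₀ k) (chartDomain p₀) :=
  (coordL k).contDiff.contMDiff.comp_contMDiffOn (contMDiffOn_extChartAt (I := 𝓡 4) (x := p₀))

/-- The coordinates are real functions, so their complexified differentials vanish on v only if they
vanish on its real and imaginary parts separately; the differential of a chart is invertible. -/
theorem cderiv_chartCoord_injective {p₀ q : M} (hq : q ∈ chartDomain p₀)
    {v : ℂ ⊗[ℝ] TangentSpace (𝓡 4) q} (h : ∀ k, cderiv (chartCoord p₀ k) q v = 0) : v = 0 := by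
  have hd : MDifferentiableAt (𝓡 4) 𝓘(ℝ, R4) (extChartAt (𝓡 4) p₀) q :=
    (contMDiffAt_extChartAt' (n := ∞) hq).mdifferentiableAt (by simp)
  have key : ∀ k w, mvfderiv (𝓡 4) (chartCoord p₀ k) q w
      = coordL k (mfderiv (𝓡 4) 𝓘(ℝ, R4) (extChartAt (𝓡 4) p₀) q w) := by
    intro k w
    have h1 := ((coordL k).hasMFDerivAt (x := extChartAt (𝓡 4) p₀ q)).comp q hd.hasMFDerivAt
    change (mfderiv (𝓡 4) 𝓘(ℝ, ℂ) (coordL k ∘ extChartAt (𝓡 4) p₀) q w : ℂ) = _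
    rw [h1.mfderiv]
    rfl
  have : IsManifold (𝓡 4) 1 M := IsManifold.of_le (n := ∞) (by simp)
  have hinv := isInvertible_mfderiv_extChartAt (I := 𝓡 4) (x := p₀) (y := q)
    (by rwa [extChartAt_source])
  have hz : ∀ w, (∀ k, coordL k (mfderiv (𝓡 4) 𝓘(ℝ, R4) (extChartAt (𝓡 4) p₀) q w) = 0) →
      w = 0 := by
    intro w hw
    apply hinv.injective
    rw [map_zero]
    apply PiLp.ext
    intro k
    exact Complex.ofReal_injective (hw k)
  have hk : ∀ k, mvfderiv (𝓡 4) (chartCoord p₀ k) q (rePart v) = 0 ∧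
      mvfderiv (𝓡 4) (chartCoord p₀ k) q (imPart v) = 0 := by
    intro k
    have := h k
    rw [cderiv_apply, key, key] at this
    rw [key, key]
    have h1 := congrArg Complex.re this
    have h2 := congrArg Complex.im this
    have e1 := coordL_im k (mfderiv (𝓡 4) 𝓘(ℝ, R4) (extChartAt (𝓡 4) p₀) q (rePart v))
    have e2 := coordL_im k (mfderiv (𝓡 4) 𝓘(ℝ, R4) (extChartAt (𝓡 4) p₀) q (imPart v))
    simp only [Complex.add_re, Complex.mul_re, Complex.I_re, Complex.I_im,
      Complex.add_im, Complex.mul_im, Complex.zero_re, Complex.zero_im, zero_mul,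
      one_mul, zero_add] at h1 h2
    rw [e2, sub_zero, add_zero] at h1
    rw [e1, zero_add] at h2
    exact ⟨Complex.ext h1 e1, Complex.ext h2 e2⟩
  apply complexVec_ext
  · rw [map_zero]
    exact hz _ fun k => by rw [← key]; exact (hk k).1
  · rw [map_zero]
    exact hz _ fun k => by rw [← key]; exact (hk k).2

theorem finrank_complexTangent (p : M) :
    Module.finrank ℂ (ℂ ⊗[ℝ] TangentSpace (𝓡 4) p) = 4 := by
  rw [Module.finrank_baseChange]
  exact finrank_euclideanSpace_fin

namespace LocalCoframe

/-- The basis given by four linearly independent complex vectors. -/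
def basisOf {p : M} {v : Fin 4 → ℂ ⊗[ℝ] TangentSpace (𝓡 4) p} (h : LinearIndependent ℂ v) :
    Module.Basis (Fin 4) ℂ (ℂ ⊗[ℝ] TangentSpace (𝓡 4) p) :=
  basisOfLinearIndependentOfCardEqFinrank h
    (by rw [finrank_complexTangent, Fintype.card_fin])

@[simp] theorem basisOf_apply {p : M} {v : Fin 4 → ℂ ⊗[ℝ] TangentSpace (𝓡 4) p}
    (h : LinearIndependent ℂ v) (i : Fin 4) : basisOf h i = v i := by
  simp [basisOf]

open Classical in
/-- The coframe dual to a frame, and zero where the fields are linearly dependent. -/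
def dualCoframe (e : Fin 4 → CVectorField M) (p : M) : Coframe p := fun i =>
  if h : LinearIndependent ℂ (fun i => e i p) then (basisOf h).coord i else 0

theorem isDual_dualCoframe {e : Fin 4 → CVectorField M} {p : M}
    (h : LinearIndependent ℂ (fun i => e i p)) : IsDual (dualCoframe e p) fun i => e i p := by
  intro i j
  have := (basisOf h).repr_self j
  rw [basisOf_apply] at this
  rw [dualCoframe, dif_pos h, Module.Basis.coord_apply, this, Finsupp.single_apply]
  simp [eq_comm]

end LocalCoframe

section IsDual

variable {p : M} {θ : Coframe p} {v : Fin 4 → ℂ ⊗[ℝ] TangentSpace (𝓡 4) p}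

theorem IsDual.linearIndependent (h : IsDual θ v) : LinearIndependent ℂ v := by
  rw [Fintype.linearIndependent_iff]
  intro g hg i
  have := congrArg (θ i) hg
  simpa [h i _] using this

theorem IsDual.sum_smul (h : IsDual θ v) (w : ℂ ⊗[ℝ] TangentSpace (𝓡 4) p) :
    ∑ i, θ i w • v i = w := by
  have hs := (LocalCoframe.basisOf h.linearIndependent).sum_repr w
  simp only [LocalCoframe.basisOf_apply] at hs
  set c := (LocalCoframe.basisOf h.linearIndependent).repr w
  have : ∀ i, θ i w = c i := by
    intro i
    rw [← hs]
    simp [h i _]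
  simp only [this, hs]

theorem IsDual.vec_ext (h : IsDual θ v) {w w' : ℂ ⊗[ℝ] TangentSpace (𝓡 4) p}
    (hw : ∀ i, θ i w = θ i w') : w = w' := by
  rw [← h.sum_smul w, ← h.sum_smul w']
  simp only [hw]

theorem IsDual.form_ext (h : IsDual θ v) {φ ψ : ℂ ⊗[ℝ] TangentSpace (𝓡 4) p →ₗ[ℂ] ℂ}
    (hφ : ∀ i, φ (v i) = ψ (v i)) : φ = ψ := by
  apply LinearMap.ext
  intro w
  rw [← h.sum_smul w, map_sum, map_sum]
  simp only [map_smul, hφ]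

theorem IsDual.of_linearIndependent (h : LinearIndependent ℂ v) : ∃ θ : Coframe p, IsDual θ v := by
  refine ⟨fun i => (LocalCoframe.basisOf h).coord i, fun i j => ?_⟩
  have := (LocalCoframe.basisOf h).repr_self j
  rw [LocalCoframe.basisOf_apply] at this
  rw [Module.Basis.coord_apply, this, Finsupp.single_apply]
  simp [eq_comm]

end IsDual

namespace LocalCoframe

/-- Cramer's rule: in a chart the frame is the matrix A of the values dxᵏ(e_j), and the dual coframe
is A⁻¹ applied to the dxᵏ. The adjugate and the determinant of A are polynomials in its smooth
entries. -/
theorem smoothFormAt_dualCoframe {e : Fin 4 → CVectorField M} {U : Opens M}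
    (he : ∀ i, (e i).SmoothOn U) (h : ∀ p ∈ U, LinearIndependent ℂ (fun i => e i p))
    {p : M} (hp : p ∈ U) (i : Fin 4) : SmoothFormAt (fun q => dualCoframe e q i) p := by
  let A : M → Matrix (Fin 4) (Fin 4) ℂ := fun q k j => cderiv (chartCoord p k) q (e j q)
  have hform : ∀ k, SmoothFormAt (fun q => cderiv (chartCoord p k) q) p := fun k =>
    smoothFormAt_cderiv (contMDiffOn_chartCoord p k) (mem_chartDomain p)
  have hA : ∀ k j, SmoothFunAt (fun q => A q k j) p := fun k j =>
    (hform k).apply (CVectorField.smoothOn_iff.1 (he j) p hp)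
  have hinj : ∀ q ∈ U ⊓ chartDomain p, IsUnit (A q).det := by
    intro q hq
    rw [← Matrix.isUnit_iff_isUnit_det, ← Matrix.mulVec_injective_iff_isUnit]
    refine (injective_iff_map_eq_zero (Matrix.mulVecLin (A q))).2 ?_
    intro c hc
    have : ∑ j, c j • e j q = 0 := by
      apply cderiv_chartCoord_injective hq.2
      intro k
      have := congrFun hc k
      rw [Matrix.mulVecLin_apply] at this
      simpa [Matrix.mulVec, dotProduct, A, mul_comm] using this
    have h2 := Fintype.linearIndependent_iff.1 (h q hq.1) c this
    exact funext h2
  have hdet : (A p).det ≠ 0 := (hinj p ⟨hp, mem_chartDomain p⟩).ne_zero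
  have hmain : ∀ q ∈ U ⊓ chartDomain p, dualCoframe e q i
      = ∑ k, (((A q).det)⁻¹ * (A q).adjugate i k) • cderiv (chartCoord p k) q := by
    intro q hq
    have hdual := isDual_dualCoframe (h q hq.1)
    apply hdual.form_ext
    intro j
    rw [hdual i j]
    have h3 := congrFun (congrFun (Matrix.adjugate_mul (A q)) i) j
    rw [Matrix.mul_apply] at h3
    simp only [LinearMap.sum_apply, LinearMap.smul_apply, smul_eq_mul, mul_assoc]
    rw [← Finset.mul_sum]
    change _ = _ * ∑ k, (A q).adjugate i k * A q k j
    rw [h3, Matrix.smul_apply, Matrix.one_apply, smul_eq_mul, ← mul_assoc,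
      inv_mul_cancel₀ (hinj q hq).ne_zero, one_mul]
  refine SmoothFormAt.congr (SmoothFormAt.sum Finset.univ fun k _ =>
    SmoothFormAt.smul (((smoothFunAt_det hA).inv hdet).mul (smoothFunAt_adjugate hA i k)) (hform k))
    (Filter.eventually_of_mem ((U ⊓ chartDomain p).isOpen.mem_nhds ⟨hp, mem_chartDomain p⟩) hmain)

/-- The local coframe dual to a smooth frame. -/
def ofFrame (U : Opens M) (e : Fin 4 → CVectorField M) (he : ∀ i, (e i).SmoothOn U)
    (h : ∀ p ∈ U, LinearIndependent ℂ (fun i => e i p)) : LocalCoframe M where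
  U := U
  θ := dualCoframe e
  e := e
  smooth_θ i := smoothFormOn_iff.2 fun _ hp => smoothFormAt_dualCoframe he h hp i
  smooth_e := he
  dual p hp := isDual_dualCoframe (h p hp)

variable (D : LocalCoframe M) {p : M}

theorem θ_e (hp : p ∈ D.U) (k i : Fin 4) : D.θ p k (D.e i p) = if k = i then 1 else 0 :=
  D.dual p hp k i

theorem smoothAt_e (hp : p ∈ D.U) (i : Fin 4) : (D.e i).SmoothAt p :=
  CVectorField.smoothOn_iff.1 (D.smooth_e i) p hp

theorem smoothFormAt_θ (hp : p ∈ D.U) (i : Fin 4) : SmoothFormAt (fun q => D.θ q i) p :=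
  smoothFormOn_iff.1 (D.smooth_θ i) p hp

theorem smoothFunAt_tor (hp : p ∈ D.U) (k i j : Fin 4) : SmoothFunAt (D.tor k i j) p :=
  ((D.smoothFormAt_θ hp k).apply ((D.smoothAt_e hp i).bracket (D.smoothAt_e hp j))).neg

theorem eventually_mem (hp : p ∈ D.U) : ∀ᶠ q in nhds p, q ∈ D.U := D.U.isOpen.mem_nhds hp

theorem tor_swap (k i j : Fin 4) (p : M) : D.tor k i j p = -D.tor k j i p := by
  simp only [tor]
  rw [CVectorField.bracket_swap, map_neg]

theorem tor_self (k i : Fin 4) (p : M) : D.tor k i i p = 0 :=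
  self_eq_neg.1 (D.tor_swap k i i p)

variable {D} in
-- X is expanded in the frame on a whole neighbourhood of p, since the bracket differentiates the
-- components; the Leibniz rule and duality give the rest.
theorem bracket_eq_of_components {X : CVectorField M} (hp : p ∈ D.U) (hX : X.SmoothAt p)
    (Y : CVectorField M) (k : Fin 4) :
    D.θ p k (X.bracket Y p) = ∑ i, D.θ p i (X p) * D.θ p k ((D.e i).bracket Y p)
      - cderiv (fun q => D.θ q k (X q)) p (Y p) := by
  have hc : ∀ i, SmoothFunAt (fun q => D.θ q i (X q)) p := fun i =>
    (D.smoothFormAt_θ hp i).apply hX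
  have hs : ∀ i, CVectorField.SmoothAt (fun q => D.θ q i (X q) • D.e i q) p := fun i =>
    CVectorField.SmoothAt.smul (hc i) (D.smoothAt_e hp i)
  have h1 : X.bracket Y p = CVectorField.bracket (fun q => ((D.θ q 0 (X q) • D.e 0 q
      + D.θ q 1 (X q) • D.e 1 q) + D.θ q 2 (X q) • D.e 2 q) + D.θ q 3 (X q) • D.e 3 q) Y p := by
    refine CVectorField.bracket_congr ?_ (Filter.Eventually.of_forall fun _ => rfl)
    filter_upwards [D.eventually_mem hp] with q hq
    rw [← Fin.sum_univ_four (fun i => D.θ q i (X q) • D.e i q)]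
    exact ((D.dual q hq).sum_smul (X q)).symm
  rw [h1, CVectorField.bracket_add_left (((hs 0).add (hs 1)).add (hs 2)) (hs 3),
    CVectorField.bracket_add_left ((hs 0).add (hs 1)) (hs 2),
    CVectorField.bracket_add_left (hs 0) (hs 1)]
  simp only [CVectorField.bracket_smul_left (hc _) (D.smoothAt_e hp _), map_add, map_sub, map_smul,
    smul_eq_mul, D.dual p hp k _, Fin.sum_univ_four]
  fin_cases k <;> simp <;> ring

/-- Cartan's formula for the differential of a member of the coframe. -/
theorem form_bracket {X Y : CVectorField M} (hp : p ∈ D.U) (hX : X.SmoothAt p) (hY : Y.SmoothAt p)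
    (k : Fin 4) :
    D.θ p k (X.bracket Y p) = cderiv (fun q => D.θ q k (Y q)) p (X p)
      - cderiv (fun q => D.θ q k (X q)) p (Y p)
      - ∑ i, ∑ j, D.tor k i j p * (D.θ p i (X p) * D.θ p j (Y p)) := by
  -- The second argument is expanded by skew-symmetry; the first is expanded afterwards.
  have h1 : ∀ i, D.θ p k ((D.e i).bracket Y p) = cderiv (fun q => D.θ q k (Y q)) p (D.e i p)
      - ∑ j, D.tor k i j p * D.θ p j (Y p) := by
    intro i
    rw [CVectorField.bracket_swap, map_neg, bracket_eq_of_components hp hY]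
    simp only [tor]
    simp only [CVectorField.bracket_swap (D.e i) (D.e _), map_neg]
    rw [neg_sub]
    congr 1
    exact Finset.sum_congr rfl fun j _ => by ring
  rw [bracket_eq_of_components hp hX]
  simp only [h1, mul_sub, Finset.sum_sub_distrib]
  have h2 : ∑ i, D.θ p i (X p) * cderiv (fun q => D.θ q k (Y q)) p (D.e i p)
      = cderiv (fun q => D.θ q k (Y q)) p (X p) := by
    conv_rhs => rw [← (D.dual p hp).sum_smul (X p)]
    simp
  rw [h2]
  simp only [Finset.mul_sum]
  have h3 : ∀ i j, D.θ p i (X p) * (D.tor k i j p * D.θ p j (Y p))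
      = D.tor k i j p * (D.θ p i (X p) * D.θ p j (Y p)) := fun i j => by ring
  simp only [h3]
  ring

end LocalCoframe

end Forms

/-! ### Generators of the CR bundle, and the coefficients fixed by adaptedness alone. -/

section Generators

set_option linter.unusedSectionVars false

variable {M : Type*} [TopologicalSpace M] [ChartedSpace R4 M] [IsManifold (𝓡 4) ∞ M]

open CVectorField

theorem smoothFunAt_cderiv {f : M → ℂ} {U : Opens M} (hf : ∀ q ∈ U, SmoothFunAt f q) {p : M}
    (hp : p ∈ U) {Z : CVectorField M} (hZ : Z.SmoothAt p) :
    SmoothFunAt (fun q => cderiv f q (Z q)) p :=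
  (smoothFormAt_cderiv (U := U) (fun q hq => (hf q hq).contMDiffWithinAt) hp).apply hZ

theorem CVectorField.bracket_self (L : CVectorField M) (p : M) : bracket L L p = 0 := by
  have h := bracket_swap L L p
  have h2 : (2 : ℂ) • bracket L L p = 0 := by
    rw [two_smul]
    nth_rewrite 1 [h]
    exact neg_add_cancel _
  exact (smul_eq_zero.1 h2).resolve_left two_ne_zero

/-- The terms in L and L̄ are kept explicitly, because this bracket is bracketed once more with a
multiple of L. -/
theorem bracket_bar_smul {L : CVectorField M} {f g : M → ℂ} {p : M} (hL : L.SmoothAt p)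
    (hf : SmoothFunAt f p) (hg : SmoothFunAt g p) :
    bracket (fun q => f q • L q) (bar fun q => g q • L q) p =
      ((f p * conj (g p)) • bracket L (bar L) p
        + (f p * cderiv (fun q => conj (g q)) p (L p)) • bar L p)
        + (-(conj (g p) * cderiv f p (bar L p))) • L p := by
  have hbar : (bar fun q => g q • L q) = fun q => conj (g q) • bar L q := by
    ext1 q
    simp [bar]
  rw [hbar, bracket_smul_left hf hL, bracket_smul_right hg.conj hL.bar, map_smul, smul_eq_mul]
  module

/-- Brackets of multiples of `L` modulo `L, L̄, [L, L̄]`. -/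
theorem form_bracket_bracket_smul {L : CVectorField M} {U : Opens M} {f g h : M → ℂ} {p : M}
    (hp : p ∈ U) (hL : L.SmoothOn U) (hf : ∀ q ∈ U, SmoothFunAt f q)
    (hg : ∀ q ∈ U, SmoothFunAt g q) (hh : ∀ q ∈ U, SmoothFunAt h q)
    (φ : ℂ ⊗[ℝ] TangentSpace (𝓡 4) p →ₗ[ℂ] ℂ) (h1 : φ (L p) = 0) (h2 : φ (bar L p) = 0)
    (h3 : φ (bracket L (bar L) p) = 0) :
    φ (bracket (fun q => f q • L q) (bracket (fun q => g q • L q) (bar fun q => h q • L q)) p)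
      = f p * g p * conj (h p) * φ (bracket L (bracket L (bar L)) p) := by
  have hL' := smoothOn_iff.1 hL
  -- The inner bracket has to be rewritten near p, not only at p, as it gets differentiated.
  -- Bracketing its L and L̄ terms with fL only produces L, L̄ and [L, L̄], all killed by φ.
  have hc : bracket (fun q => f q • L q) (bracket (fun q => g q • L q) (bar fun q => h q • L q)) p
      = bracket (fun q => f q • L q) (fun q => ((g q * conj (h q)) • bracket L (bar L) q
        + (g q * cderiv (fun q => conj (h q)) q (L q)) • bar L q)
        + (-(conj (h q) * cderiv g q (bar L q))) • L q) p := by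
    refine bracket_congr (Filter.Eventually.of_forall fun _ => rfl) ?_
    filter_upwards [U.isOpen.mem_nhds hp] with q hq
    exact bracket_bar_smul (hL' q hq) (hg q hq) (hh q hq)
  have s0 := hL' p hp
  have s1 := s0.bracket s0.bar
  have k1 : SmoothFunAt (fun q => g q * conj (h q)) p := (hg p hp).mul (hh p hp).conj
  have k2 : SmoothFunAt (fun q => g q * cderiv (fun q => conj (h q)) q (L q)) p :=
    (hg p hp).mul (smoothFunAt_cderiv (fun q hq => (hh q hq).conj) hp s0)
  have k3 : SmoothFunAt (fun q => -(conj (h q) * cderiv g q (bar L q))) p :=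
    ((hh p hp).conj.mul (smoothFunAt_cderiv hg hp s0.bar)).neg
  rw [hc, bracket_smul_left (hf p hp) s0,
    bracket_add_right ((SmoothAt.smul k1 s1).add (SmoothAt.smul k2 s0.bar)) (SmoothAt.smul k3 s0),
    bracket_add_right (SmoothAt.smul k1 s1) (SmoothAt.smul k2 s0.bar), bracket_smul_right k1 s1,
    bracket_smul_right k2 s0.bar, bracket_smul_right k3 s0, bracket_self]
  simp only [map_sub, map_add, map_smul, h1, h2, h3, map_zero, smul_eq_mul]
  ring

theorem fieldS_eq {L : CVectorField M} {p : M} (hL : L.SmoothAt p) :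
    fieldS L p = Complex.I • bracket L (bracket L (bar L)) p := by
  rw [fieldS]
  change bracket L (fun q => Complex.I • bracket L (bar L) q) p = _
  rw [bracket_smul_right (smoothFunAt_const _) (hL.bracket hL.bar), cderiv_const]
  simp

theorem SmoothAt_fieldT {L : CVectorField M} {p : M} (hL : L.SmoothAt p) :
    (fieldT L).SmoothAt p := (hL.bracket hL.bar).const_smul _

theorem SmoothAt_fieldS {L : CVectorField M} {p : M} (hL : L.SmoothAt p) :
    (fieldS L).SmoothAt p := hL.bracket (SmoothAt_fieldT hL)

theorem conjVec_fieldT {L : CVectorField M} {p : M} (hL : L.SmoothAt p) :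
    conjVec (fieldT L p) = fieldT L p := by
  have hbb : bar (bar L) = L := by
    ext1 q; simp [bar]
  rw [fieldT, conjVec_smul, bar_bracket hL hL.bar, hbb, bracket_swap, Complex.conj_I]
  simp

theorem form_fieldT_smul {L : CVectorField M} {f : M → ℂ} {p : M}
    (hL : L.SmoothAt p) (hf : SmoothFunAt f p)
    (φ : ℂ ⊗[ℝ] TangentSpace (𝓡 4) p →ₗ[ℂ] ℂ) (h1 : φ (L p) = 0) (h2 : φ (bar L p) = 0) :
    φ (fieldT (fun q => f q • L q) p) = f p * conj (f p) * φ (fieldT L p) := by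
  rw [fieldT, bracket_bar_smul hL hf hf, fieldT]
  simp only [map_add, map_smul, h1, h2, smul_eq_mul]
  ring

/-- This is the origin of the factor a²ā by which σ scales in the structure group of P¹. -/
theorem form_fieldS_smul {L : CVectorField M} {U : Opens M} {f : M → ℂ} {p : M}
    (hp : p ∈ U) (hL : L.SmoothOn U) (hf : ∀ q ∈ U, SmoothFunAt f q)
    (φ : ℂ ⊗[ℝ] TangentSpace (𝓡 4) p →ₗ[ℂ] ℂ) (h1 : φ (L p) = 0) (h2 : φ (bar L p) = 0)
    (h3 : φ (fieldT L p) = 0) :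
    φ (fieldS (fun q => f q • L q) p) = f p * f p * conj (f p) * φ (fieldS L p) := by
  have hL' := smoothOn_iff.1 hL p hp
  have h3' : φ (bracket L (bar L) p) = 0 := by
    simpa [fieldT] using h3
  rw [fieldS_eq (SmoothAt.smul (hf p hp) hL'), fieldS_eq hL', map_smul, map_smul,
    form_bracket_bracket_smul hp hL hf hf hf φ h1 h2 h3', smul_eq_mul, smul_eq_mul]
  ring

namespace CRStructure

variable (𝓛 : CRStructure M)

variable {𝓛} in
theorem IsGenerator.ne_zero {L : CVectorField M} {U : Opens M} (h : 𝓛.IsGenerator L U) {p : M}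
    (hp : p ∈ U) : L p ≠ 0 := by
  intro h0
  have h1 := 𝓛.finrank_fiber p
  rw [h.2 p hp, h0, Submodule.span_zero_singleton, finrank_bot] at h1
  exact zero_ne_one h1

variable {𝓛} in
/-- Smooth sections of the CR bundle are smooth multiples of a generator. -/
theorem IsGenerator.exists_smul {L X : CVectorField M} {U V : Opens M} (h : 𝓛.IsGenerator L U)
    (hX : 𝓛.IsSection X V) :
    ∃ f : M → ℂ, ∀ q ∈ U ⊓ V, SmoothFunAt f q ∧ X q = f q • L q := by
  have hex : ∀ q, ∃ a : ℂ, q ∈ U ⊓ V → X q = a • L q := by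
    intro q
    by_cases hq : q ∈ U ⊓ V
    · have := hX.2 q hq.2
      rw [h.2 q hq.1, Submodule.mem_span_singleton] at this
      obtain ⟨a, ha⟩ := this
      exact ⟨a, fun _ => ha.symm⟩
    · exact ⟨0, fun h => absurd h hq⟩
  choose f hf using hex
  refine ⟨f, fun q hq => ⟨?_, hf q hq⟩⟩
  -- Since L does not vanish at q, some coordinate differential dxᵏ is nonzero on it; near q the
  -- coefficient is the smooth quotient dxᵏ(X) / dxᵏ(L).
  obtain ⟨k, hk⟩ : ∃ k, cderiv (chartCoord q k) q (L q) ≠ 0 := by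
    by_contra hcon
    push Not at hcon
    exact h.ne_zero hq.1 (cderiv_chartCoord_injective (mem_chartDomain q) hcon)
  have hform : SmoothFormAt (fun r => cderiv (chartCoord q k) r) q :=
    smoothFormAt_cderiv (contMDiffOn_chartCoord q k) (mem_chartDomain q)
  have h1 := hform.apply (smoothOn_iff.1 h.1 q hq.1)
  have h2 := hform.apply (smoothOn_iff.1 hX.1 q hq.2)
  refine (h2.div h1 hk).congr ?_
  filter_upwards [(U ⊓ V).isOpen.mem_nhds hq, h1.continuousAt.eventually_ne hk] with r hr hr'
  rw [hf r hr, map_smul, smul_eq_mul, mul_div_assoc, div_self hr', mul_one]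

variable {𝓛} in
-- Otherwise a nonzero covector kills S, T, L, L̄. All sections are multiples of L, so by the
-- Leibniz rule it also kills every vector in the class II span, which is the whole space.
theorem IsGenerator.linearIndependent_frame (h𝓛 : 𝓛.IsClassII) {L : CVectorField M} {U : Opens M}
    (h : 𝓛.IsGenerator L U) {p : M} (hp : p ∈ U) : LinearIndependent ℂ (frame L p) := by
  have hL := smoothOn_iff.1 h.1 p hp
  apply linearIndependent_of_top_le_span_of_card_eq_finrank
  · by_contra hcon
    obtain ⟨φ, hφ0, hφ⟩ := Submodule.exists_le_ker_of_lt_top _ (lt_top_iff_ne_top.2 fun h => hcon h.ge)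
    have hv : ∀ i, φ (frame L p i) = 0 := fun i =>
      hφ (Submodule.subset_span (mem_range_self i))
    have hS : φ (fieldS L p) = 0 := hv 0
    have hT : φ (fieldT L p) = 0 := hv 1
    have h1 : φ (L p) = 0 := hv 2
    have h2 : φ (bar L p) = 0 := hv 3
    have h3 : φ (bracket L (bar L) p) = 0 := by simpa [fieldT] using hT
    have h4 : φ (bracket L (bracket L (bar L)) p) = 0 := by
      simpa [fieldS_eq hL] using hS
    apply hφ0
    rw [← LinearMap.ker_eq_top, eq_top_iff, ← h𝓛 p, Submodule.span_le]
    rintro v ⟨V, X, Y, Z, hpV, hX, hY, hZ, hv⟩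
    obtain ⟨f, hf⟩ := h.exists_smul hX
    obtain ⟨g, hg⟩ := h.exists_smul hY
    obtain ⟨k, hk⟩ := h.exists_smul hZ
    have hpW : p ∈ U ⊓ V := ⟨hp, hpV⟩
    have ev : ∀ᶠ q in nhds p, q ∈ U ⊓ V := (U ⊓ V).isOpen.mem_nhds hpW
    have eX : ∀ᶠ q in nhds p, X q = f q • L q := ev.mono fun q hq => (hf q hq).2
    have eY : ∀ᶠ q in nhds p, Y q = g q • L q := ev.mono fun q hq => (hg q hq).2
    have eY' : ∀ᶠ q in nhds p, bar Y q = bar (fun q => g q • L q) q :=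
      eY.mono fun q hq => by simp only [bar, hq]
    have eZ' : ∀ᶠ q in nhds p, bar Z q = bar (fun q => k q • L q) q :=
      ev.mono fun q hq => by simp only [bar, (hk q hq).2]
    change φ v = 0
    rcases hv with rfl | rfl | rfl | rfl
    · rw [(hf p hpW).2, map_smul, h1, smul_zero]
    · rw [bar, (hf p hpW).2, conjVec_smul, map_smul]
      change _ • φ (bar L p) = 0
      rw [h2, smul_zero]
    · rw [bracket_congr eX eY', bracket_bar_smul hL (hf p hpW).1 (hg p hpW).1]
      simp [h1, h2, h3]
    · have e2 : ∀ᶠ q in nhds p, bracket Y (bar Z) q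
          = bracket (fun q => g q • L q) (bar fun q => k q • L q) q := by
        filter_upwards [eY.eventually_nhds, eZ'.eventually_nhds] with q h1 h2
        exact bracket_congr h1 h2
      have hLW : L.SmoothOn (U ⊓ V : Opens M) :=
        smoothOn_iff.2 fun q hq => smoothOn_iff.1 h.1 q hq.1
      rw [bracket_congr eX e2, form_bracket_bracket_smul hpW hLW (fun q hq => (hf q hq).1)
        (fun q hq => (hg q hq).1) (fun q hq => (hk q hq).1) φ h1 h2 h3, h4, mul_zero]
  · rw [finrank_complexTangent, Fintype.card_fin]

end CRStructure

namespace LocalCoframe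

variable {𝓛 : CRStructure M} {D : LocalCoframe M}

/-- The values at `p` of a coframe adapted to a generator of the CR bundle. -/
theorem _root_.IsAdapted.exists_generator {p : M} {θ : Coframe p} (h : IsAdapted 𝓛 θ) :
    ∃ (U : Opens M) (L : CVectorField M) (a : ℂ), p ∈ U ∧ 𝓛.IsGenerator L U ∧ a ≠ 0 ∧
      θ 0 (L p) = 0 ∧ θ 0 (bar L p) = 0 ∧ θ 0 (fieldT L p) = 0 ∧
      θ 0 (fieldS L p) = a ^ 2 * conj a ∧ θ 1 (L p) = 0 ∧ θ 1 (bar L p) = 0 ∧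
      θ 1 (fieldT L p) = a * conj a ∧ θ 2 (L p) = a ∧ θ 2 (bar L p) = 0 ∧
      θ 3 (L p) = 0 ∧ θ 3 (bar L p) = conj a := by
  obtain ⟨hconj, U, L, ω₀, a, b, c, d, hp, hL, hω, ha, h0, h1, h2⟩ := h
  have w : ∀ i j, ω₀ i (frame L p j) = if i = j then 1 else 0 := hω
  have t2 : ∀ i, ω₀ i (L p) = if i = 2 then 1 else 0 := fun i => w i 2
  have t3 : ∀ i, ω₀ i (bar L p) = if i = 3 then 1 else 0 := fun i => w i 3
  have t1 : ∀ i, ω₀ i (fieldT L p) = if i = 1 then 1 else 0 := fun i => w i 1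
  have t0 : ∀ i, ω₀ i (fieldS L p) = if i = 0 then 1 else 0 := fun i => w i 0
  have e22 : θ 2 (L p) = a := by simp [h2, t2]
  have e23 : θ 2 (bar L p) = 0 := by simp [h2, t3]
  have ebar : conjVec (bar L p) = L p := by simp [bar]
  refine ⟨U, L, a, hp, hL, ha, ?_, ?_, ?_, ?_, ?_, ?_, ?_, e22, e23, ?_, ?_⟩
  · simp [h0, t2]
  · simp [h0, t3]
  · simp [h0, t1]
  · simp [h0, t0]
  · simp [h1, t2]
  · simp [h1, t3]
  · simp [h1, t1]
  · rw [hconj]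
    change conj (θ 2 (bar L p)) = 0
    rw [e23, map_zero]
  · rw [hconj, ebar, e22]

namespace IsReduced

variable (h : D.IsReduced 𝓛)

include h

theorem conj_θ2 {p : M} (hp : p ∈ D.U) (v : ℂ ⊗[ℝ] TangentSpace (𝓡 4) p) :
    D.θ p 3 v = conj (D.θ p 2 (conjVec v)) := (h.adapted p hp).1 v

theorem conj_θ3 {p : M} (hp : p ∈ D.U) (v : ℂ ⊗[ℝ] TangentSpace (𝓡 4) p) :
    D.θ p 2 v = conj (D.θ p 3 (conjVec v)) := by
  rw [h.conj_θ2 hp]; simp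

/-- Adaptedness identifies a e_ζ with a generator L at p, and ā e_ζ̄ with L̄, by comparing the
values of the coframe. -/
theorem conj_e2 {p : M} (hp : p ∈ D.U) : conjVec (D.e 2 p) = D.e 3 p := by
  obtain ⟨U, L, a, hpU, hL, ha, h02, h03, h0T, h0S, h12, h13, h1T, h22, h23, h32, h33⟩ :=
    (h.adapted p hp).exists_generator
  have e2 : a • D.e 2 p = L p := by
    apply (D.dual p hp).vec_ext
    intro i
    rw [map_smul, D.θ_e hp i 2]
    fin_cases i <;> simp [h02, h12, h22, h32]
  have e3 : conj a • D.e 3 p = bar L p := by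
    apply (D.dual p hp).vec_ext
    intro i
    rw [map_smul, D.θ_e hp i 3]
    fin_cases i <;> simp [h03, h13, h23, h33]
  have ha' : conj a ≠ 0 := (map_ne_zero _).2 ha
  have : conj a • conjVec (D.e 2 p) = conj a • D.e 3 p := by
    rw [e3, ← conjVec_smul, e2]; rfl
  exact smul_right_injective _ ha' this

theorem conj_e3 {p : M} (hp : p ∈ D.U) : conjVec (D.e 3 p) = D.e 2 p := by
  rw [← h.conj_e2 hp, conjVec_conjVec]

theorem isSection_e2 : 𝓛.IsSection (D.e 2) D.U := by
  refine ⟨D.smooth_e 2, fun p hp => ?_⟩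
  obtain ⟨U, L, a, hpU, hL, ha, h02, h03, h0T, h0S, h12, h13, h1T, h22, h23, h32, h33⟩ :=
    (h.adapted p hp).exists_generator
  have e2 : a • D.e 2 p = L p := by
    apply (D.dual p hp).vec_ext
    intro i
    rw [map_smul, D.θ_e hp i 2]
    fin_cases i <;> simp [h02, h12, h22, h32]
  rw [hL.2 p hpU, Submodule.mem_span_singleton]
  exact ⟨a⁻¹, by rw [← e2, smul_smul, inv_mul_cancel₀ ha, one_smul]⟩

theorem isGenerator_e2 : 𝓛.IsGenerator (D.e 2) D.U := by
  refine ⟨D.smooth_e 2, fun p hp => ?_⟩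
  obtain ⟨U, L, a, hpU, hL, ha, h02, h03, h0T, h0S, h12, h13, h1T, h22, h23, h32, h33⟩ :=
    (h.adapted p hp).exists_generator
  have e2 : a • D.e 2 p = L p := by
    apply (D.dual p hp).vec_ext
    intro i
    rw [map_smul, D.θ_e hp i 2]
    fin_cases i <;> simp [h02, h12, h22, h32]
  rw [hL.2 p hpU, ← e2, Submodule.span_singleton_smul_eq (IsUnit.mk0 a ha)]

/-- The values of the coframe on the fields `T` and `S` of its own generator. -/
theorem values_fieldT {p : M} (hp : p ∈ D.U) :
    D.θ p 0 (fieldT (D.e 2) p) = 0 ∧ D.θ p 1 (fieldT (D.e 2) p) = 1 ∧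
      D.θ p 0 (fieldS (D.e 2) p) = 1 := by
  obtain ⟨U, L, a, hpU, hL, ha, h02, h03, h0T, h0S, h12, h13, h1T, h22, h23, h32, h33⟩ :=
    (h.adapted p hp).exists_generator
  obtain ⟨f, hf⟩ := hL.exists_smul h.isSection_e2
  have hpW : p ∈ U ⊓ D.U := ⟨hpU, hp⟩
  have ev : ∀ᶠ q in nhds p, D.e 2 q = f q • L q :=
    Filter.eventually_of_mem ((U ⊓ D.U).isOpen.mem_nhds hpW) fun q hq => (hf q hq).2
  have hLW : L.SmoothOn (U ⊓ D.U : Opens M) :=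
    smoothOn_iff.2 fun q hq => smoothOn_iff.1 hL.1 q hq.1
  -- The coframe at p is adapted through L with parameter a, while e_ζ = fL near p. Thus f = a⁻¹ at
  -- p, and the scaling factors f f̄ and f² f̄ cancel aā and a²ā.
  have hfa : f p * a = 1 := by
    have := D.θ_e hp 2 2
    rw [(hf p hpW).2, map_smul, h22, smul_eq_mul] at this
    simpa using this
  have hfa' : conj (f p) * conj a = 1 := by rw [← map_mul, hfa, map_one]
  have hbar : ∀ᶠ q in nhds p, bar (D.e 2) q = bar (fun q => f q • L q) q :=
    ev.mono fun q hq => by simp only [bar, hq]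
  have hT : ∀ᶠ q in nhds p, fieldT (D.e 2) q = fieldT (fun q => f q • L q) q := by
    filter_upwards [ev.eventually_nhds, hbar.eventually_nhds] with q h1 h2
    simp only [fieldT]
    rw [bracket_congr h1 h2]
  have hS : fieldS (D.e 2) p = fieldS (fun q => f q • L q) p := bracket_congr ev hT
  have hLp := smoothOn_iff.1 hL.1 p hpU
  rw [hT.self_of_nhds, hS, form_fieldT_smul hLp (hf p hpW).1 _ h02 h03,
    form_fieldT_smul hLp (hf p hpW).1 _ h12 h13,
    form_fieldS_smul hpW hLW (fun q hq => (hf q hq).1) _ h02 h03 h0T, h0T, h1T, h0S]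
  refine ⟨by ring, ?_, ?_⟩
  · linear_combination conj (f p) * conj a * hfa + hfa'
  · linear_combination (f p * a + 1) * conj (f p) * conj a * hfa + hfa'

theorem bar_e2_eventually {p : M} (hp : p ∈ D.U) : ∀ᶠ q in nhds p, bar (D.e 2) q = D.e 3 q :=
  (D.eventually_mem hp).mono fun _ hq => h.conj_e2 hq

theorem fieldT_e2 {p : M} (hp : p ∈ D.U) :
    fieldT (D.e 2) p = Complex.I • bracket (D.e 2) (D.e 3) p := by
  rw [fieldT, bracket_congr (Filter.Eventually.of_forall fun _ => rfl) (h.bar_e2_eventually hp)]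

theorem tor_023 {p : M} (hp : p ∈ D.U) : D.tor 0 2 3 p = 0 := by
  have := (h.values_fieldT hp).1
  rw [h.fieldT_e2 hp, map_smul, smul_eq_mul] at this
  rw [tor, (mul_eq_zero.1 this).resolve_left Complex.I_ne_zero, neg_zero]

theorem tor_123 {p : M} (hp : p ∈ D.U) : D.tor 1 2 3 p = Complex.I := by
  have := (h.values_fieldT hp).2.1
  rw [h.fieldT_e2 hp, map_smul, smul_eq_mul] at this
  rw [tor]
  linear_combination Complex.I * this - D.θ p 1 (bracket (D.e 2) (D.e 3) p) * Complex.I_sq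

/-- Automatic, unlike its counterpart for ζ̄: it is the σ-component of S = [e_ζ, T], because T is
e_ρ modulo e_ζ and e_ζ̄ and T^σ_{ζζ̄} = 0. -/
theorem tor_012 {p : M} (hp : p ∈ D.U) : D.tor 0 1 2 p = 1 := by
  have h1 := (h.values_fieldT hp).2.2
  rw [fieldS, D.form_bracket hp (D.smoothAt_e hp 2) (SmoothAt_fieldT (D.smoothAt_e hp 2))] at h1
  have e1 : (fun q => D.θ q 0 (fieldT (D.e 2) q)) =ᶠ[nhds p] fun _ => 0 :=
    (D.eventually_mem hp).mono fun q hq => (h.values_fieldT hq).1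
  have e2 : (fun q => D.θ q 0 (D.e 2 q)) =ᶠ[nhds p] fun _ => 0 :=
    (D.eventually_mem hp).mono fun q hq => D.dual q hq 0 2
  rw [cderiv_congr e1, cderiv_congr e2, cderiv_const (0 : ℂ) p] at h1
  simp only [Fin.sum_univ_four, D.θ_e hp _ 2, (h.values_fieldT hp).1,
    (h.values_fieldT hp).2.1, D.tor_self, h.tor_023 hp] at h1
  rw [D.tor_swap]
  simpa using h1

end IsReduced

end LocalCoframe

end Generators

/-! ### Jacobi identity and change of frame for torsion; reality of the reduced frame. -/

section Uniqueness

set_option linter.unusedSectionVars false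

variable {M : Type*} [TopologicalSpace M] [ChartedSpace R4 M] [IsManifold (𝓡 4) ∞ M]

open CVectorField

namespace LocalCoframe

variable (D : LocalCoframe M) {p : M}

theorem cderiv_θ_e (hp : p ∈ D.U) (k i : Fin 4) :
    cderiv (fun q => D.θ q k (D.e i q)) p = 0 := by
  have h : (fun q => D.θ q k (D.e i q)) =ᶠ[nhds p] fun _ => if k = i then 1 else 0 :=
    (D.eventually_mem hp).mono fun q hq => D.θ_e hq k i
  rw [cderiv_congr h, cderiv_const]

/-- Cartan's formula for e_a and [e_b, e_c]: the components of the inner bracket are minus torsion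
coefficients, whence the single derivative term. -/
theorem form_bracket_bracket (hp : p ∈ D.U) (k a b c : Fin 4) :
    D.θ p k (bracket (D.e a) (bracket (D.e b) (D.e c)) p)
      = -cderiv (D.tor k b c) p (D.e a p) + ∑ j, D.tor k a j p * D.tor j b c p := by
  rw [D.form_bracket hp (D.smoothAt_e hp a) ((D.smoothAt_e hp b).bracket (D.smoothAt_e hp c)),
    D.cderiv_θ_e hp]
  have h1 : cderiv (fun q => D.θ q k (bracket (D.e b) (D.e c) q)) p = -cderiv (D.tor k b c) p := by
    have h2 := cderiv_add (D.smoothFunAt_tor hp k b c) (D.smoothFunAt_tor hp k b c).neg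
    simp only [add_neg_cancel, cderiv_const] at h2
    rw [eq_neg_iff_add_eq_zero, add_comm, h2]
    simp [tor]
  simp only [h1, D.θ_e hp]
  simp [tor]

/-- The Jacobi identity in terms of torsion coefficients, where `Tᵏ` of the three pairs is locally
constant. -/
theorem jacobi_tor (hp : p ∈ D.U) (k a b c : Fin 4) (h1 : cderiv (D.tor k b c) p = 0)
    (h2 : cderiv (D.tor k c a) p = 0) (h3 : cderiv (D.tor k a b) p = 0) :
    ∑ j, D.tor k a j p * D.tor j b c p + ∑ j, D.tor k b j p * D.tor j c a p
      + ∑ j, D.tor k c j p * D.tor j a b p = 0 := by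
  have h := congrArg (D.θ p k) (jacobi (D.smoothAt_e hp a) (D.smoothAt_e hp b) (D.smoothAt_e hp c))
  rw [map_add, map_add, D.form_bracket_bracket hp, D.form_bracket_bracket hp,
    D.form_bracket_bracket hp, h1, h2, h3] at h
  simpa using h

variable {D} in
theorem smoothFunAt_θ_e {D' : LocalCoframe M} (hp : p ∈ D.U) (hp' : p ∈ D'.U) (k i : Fin 4) :
    SmoothFunAt (fun q => D.θ q k (D'.e i q)) p :=
  (D.smoothFormAt_θ hp k).apply (D'.smoothAt_e hp' i)

variable {D} in
-- The k-th component of [e_i', e_j'] is computed twice: by expanding the bracket in the frame of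
-- `D'`, and by Cartan's formula for the coframe of `D`.
theorem tor_change {D' : LocalCoframe M} (hp : p ∈ D.U) (hp' : p ∈ D'.U) (k i j : Fin 4) :
    ∑ l, D'.tor l i j p * D.θ p k (D'.e l p) =
      cderiv (fun q => D.θ q k (D'.e i q)) p (D'.e j p)
      - cderiv (fun q => D.θ q k (D'.e j q)) p (D'.e i p)
      + ∑ a, ∑ b, D.tor k a b p * (D.θ p a (D'.e i p) * D.θ p b (D'.e j p)) := by
  have h1 := D.form_bracket hp (D'.smoothAt_e hp' i) (D'.smoothAt_e hp' j) k
  have h2 := congrArg (D.θ p k) ((D'.dual p hp').sum_smul (bracket (D'.e i) (D'.e j) p))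
  rw [h1] at h2
  simp only [map_sum, map_smul, smul_eq_mul] at h2
  simp only [tor, neg_mul, Finset.sum_neg_distrib] at h2 ⊢
  rw [h2]
  ring

/-- The permutation of the indices induced by complex conjugation. -/
def conjIdx : Fin 4 → Fin 4 := ![0, 1, 3, 2]

/-- The frame is `(real, real, e, ē)`. -/
def IsRealFrame : Prop := ∀ p ∈ D.U, ∀ i, conjVec (D.e i p) = D.e (conjIdx i) p

namespace IsRealFrame

variable {D} (h : D.IsRealFrame)

include h

theorem conj_θ (hp : p ∈ D.U) (k : Fin 4) (v : ℂ ⊗[ℝ] TangentSpace (𝓡 4) p) :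
    conj (D.θ p k v) = D.θ p (conjIdx k) (conjVec v) := by
  have h1 : conjVec v = ∑ i, conj (D.θ p i v) • D.e (conjIdx i) p := by
    conv_lhs => rw [← (D.dual p hp).sum_smul v]
    simp [h p hp]
  rw [h1]
  simp only [Fin.sum_univ_four, map_add, map_smul, D.θ_e hp]
  fin_cases k <;> simp [conjIdx]

theorem conj_tor (hp : p ∈ D.U) (k i j : Fin 4) :
    conj (D.tor k i j p) = D.tor (conjIdx k) (conjIdx i) (conjIdx j) p := by
  have hbar : ∀ i, ∀ᶠ q in nhds p, bar (D.e i) q = D.e (conjIdx i) q := fun i =>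
    (D.eventually_mem hp).mono fun q hq => h q hq i
  rw [tor, map_neg, h.conj_θ hp, bar_bracket (D.smoothAt_e hp i) (D.smoothAt_e hp j),
    bracket_congr (hbar i) (hbar j), tor]

theorem onReal_im (hp : p ∈ D.U) {k : Fin 4} (hk : conjIdx k = k) (v : TangentSpace (𝓡 4) p) :
    (onReal (D.θ p k) v).im = 0 := by
  rw [← Complex.conj_eq_iff_im]
  change conj (D.θ p k ((1 : ℂ) ⊗ₜ[ℝ] v)) = D.θ p k ((1 : ℂ) ⊗ₜ[ℝ] v)
  rw [h.conj_θ hp, hk, conjVec_tmul, map_one]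

/-- Conjugation fixes the σ and ρ terms and exchanges the ζ and ζ̄ terms, which enter with the same
real constant. -/
theorem onReal_lam_im (hp : p ∈ D.U) (v : TangentSpace (𝓡 4) p) :
    (onReal (D.lam p) v).im = 0 := by
  rw [← Complex.conj_eq_iff_im]
  change conj (D.lam p ((1 : ℂ) ⊗ₜ[ℝ] v)) = D.lam p ((1 : ℂ) ⊗ₜ[ℝ] v)
  have hv : conjVec ((1 : ℂ) ⊗ₜ[ℝ] v) = (1 : ℂ) ⊗ₜ[ℝ] v := by simp
  simp only [lam, LinearMap.sub_apply, LinearMap.smul_apply, smul_eq_mul, map_sub, map_mul,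
    map_div₀, h.conj_θ hp, h.conj_tor hp, hv, conjIdx, map_ofNat]
  simp only [Matrix.cons_val]
  ring

end IsRealFrame

namespace IsReduced

variable {D} {𝓛 : CRStructure M} (h : D.IsReduced 𝓛)

include h

/-- T is real and equals e_ρ plus a combination of e_ζ and e_ζ̄ with conjugate coefficients;
subtracting this real combination leaves a real vector. -/
theorem conj_e1 (hp : p ∈ D.U) : conjVec (D.e 1 p) = D.e 1 p := by
  have hT := (D.dual p hp).sum_smul (fieldT (D.e 2) p)
  simp only [Fin.sum_univ_four, (h.values_fieldT hp).1, (h.values_fieldT hp).2.1, zero_smul,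
    one_smul, zero_add] at hT
  have hT' := congrArg conjVec hT
  have h2 : D.θ p 3 (fieldT (D.e 2) p) = conj (D.θ p 2 (fieldT (D.e 2) p)) := by
    rw [h.conj_θ2 hp, conjVec_fieldT (D.smoothAt_e hp 2)]
  simp only [map_add, conjVec_smul, conjVec_fieldT (D.smoothAt_e hp 2), h.conj_e2 hp,
    h.conj_e3 hp, h2, Complex.conj_conj] at hT'
  rw [h2] at hT
  have := hT'.trans hT.symm
  rw [add_right_comm] at this
  exact add_right_cancel (add_right_cancel this)

theorem θ_conj (hp : p ∈ D.U) (k : Fin 4) (v : ℂ ⊗[ℝ] TangentSpace (𝓡 4) p) :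
    D.θ p k (conjVec v) = ∑ i, conj (D.θ p i v) * D.θ p k (conjVec (D.e i p)) := by
  conv_lhs => rw [← (D.dual p hp).sum_smul v]
  simp

theorem bar_eventually (hp : p ∈ D.U) :
    (∀ᶠ q in nhds p, bar (D.e 1) q = D.e 1 q) ∧ (∀ᶠ q in nhds p, bar (D.e 2) q = D.e 3 q) ∧
      ∀ᶠ q in nhds p, bar (D.e 3) q = D.e 2 q :=
  ⟨(D.eventually_mem hp).mono fun _ hq => h.conj_e1 hq,
    (D.eventually_mem hp).mono fun _ hq => h.conj_e2 hq,
    (D.eventually_mem hp).mono fun _ hq => h.conj_e3 hq⟩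

/-- The brackets [e_ζ, e_ρ] and [e_ζ̄, e_ρ] are conjugate, and both have σ-component 1, by `tor_012`
and the normalization of T^σ_{ρζ̄}. Comparing them settles σ; for ζ and ζ̄ it suffices that these
forms are conjugate. -/
theorem θ_conj_e0 (hp : p ∈ D.U) : D.θ p 0 (conjVec (D.e 0 p)) = 1 ∧
    D.θ p 2 (conjVec (D.e 0 p)) = 0 ∧ D.θ p 3 (conjVec (D.e 0 p)) = 0 := by
  obtain ⟨b1, b2, b3⟩ := h.bar_eventually hp
  refine ⟨?_, ?_, ?_⟩
  · have h1 := h.θ_conj hp 0 (bracket (D.e 2) (D.e 1) p)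
    rw [bar_bracket (D.smoothAt_e hp 2) (D.smoothAt_e hp 1), bracket_congr b2 b1] at h1
    have h2 : D.θ p 0 (bracket (D.e 3) (D.e 1) p) = 1 := by
      have := h.norm2 p hp
      rw [tor_swap, tor, neg_neg] at this
      exact this
    have h3 : D.θ p 0 (bracket (D.e 2) (D.e 1) p) = 1 := by
      have := h.tor_012 hp
      rw [tor_swap, tor, neg_neg] at this
      exact this
    simp only [Fin.sum_univ_four, h2, h3, h.conj_e1 hp, h.conj_e2 hp, h.conj_e3 hp, D.θ_e hp] at h1
    simpa using h1.symm
  · rw [h.conj_θ3 hp, conjVec_conjVec, D.θ_e hp]; simp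
  · rw [h.conj_θ2 hp, conjVec_conjVec, D.θ_e hp]; simp

/-- By the preceding result the conjugate of e_σ is e_σ + k e_ρ. The possible defect k enters the
conjugates of T^σ_{σζ} and T^ρ_{ρζ}. After conjugation, the σ-component of the Jacobi identity for
e_ρ, e_ζ, e_ζ̄ reads 2k = 0 once the conditions on T^ζ_{ζζ̄}, T^ρ_{ρζ̄}, T^σ_{σζ̄} are inserted. -/
theorem conj_e0 (hp : p ∈ D.U) : conjVec (D.e 0 p) = D.e 0 p := by
  obtain ⟨b1, b2, b3⟩ := h.bar_eventually hp
  obtain ⟨h00, h02, h03⟩ := h.θ_conj_e0 hp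
  set k := D.θ p 1 (conjVec (D.e 0 p)) with hk
  have hθ0 : ∀ v, conj (D.θ p 0 v) = D.θ p 0 (conjVec v) := by
    intro v
    rw [h.θ_conj hp]
    simp [Fin.sum_univ_four, h.conj_e1 hp, h.conj_e2 hp, h.conj_e3 hp, D.θ_e hp, h00]
  have hθ1 : ∀ v, conj (D.θ p 1 v) = D.θ p 1 (conjVec v) - k * conj (D.θ p 0 v) := by
    intro v
    rw [h.θ_conj hp 1]
    simp [Fin.sum_univ_four, h.conj_e1 hp, h.conj_e2 hp, h.conj_e3 hp, D.θ_e hp, ← hk]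
    ring
  have s := D.smoothAt_e hp
  -- The bracket [e_σ, e_ζ] has conjugate [e_σ + k e_ρ, e_ζ̄], and T^σ_{ρζ̄} = 1 turns the extra
  -- field into the summand k.
  have hB : conj (D.tor 0 0 2 p) = D.tor 0 0 3 p + k := by
    have e1 : (fun q => D.θ q 0 (bar (D.e 0) q)) =ᶠ[nhds p] fun _ => 1 :=
      (D.eventually_mem hp).mono fun q hq => (h.θ_conj_e0 hq).1
    rw [tor, map_neg, hθ0, bar_bracket (s 0) (s 2),
      bracket_congr (Filter.Eventually.of_forall fun _ => rfl) b2,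
      D.form_bracket hp (s 0).bar (s 3), D.cderiv_θ_e hp, cderiv_congr e1, cderiv_const (1 : ℂ) p]
    have e2 : ∀ i, D.θ p i (bar (D.e 0) p) = D.θ p i (conjVec (D.e 0 p)) := fun i => rfl
    simp only [Fin.sum_univ_four, e2, h00, h02, h03, ← hk, D.θ_e hp, h.norm2 p hp]
    simp
  have h112 : conj (D.tor 1 1 2 p) = D.tor 1 1 3 p - k := by
    have h3 : D.θ p 0 (bracket (D.e 1) (D.e 2) p) = -1 := by
      have := h.tor_012 hp
      rw [tor] at this
      linear_combination -this
    rw [tor, map_neg, hθ1, h3, bar_bracket (s 1) (s 2), bracket_congr b1 b2, tor]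
    simp
    ring
  have h323 : conj (D.tor 3 2 3 p) = -D.tor 2 2 3 p := by
    rw [tor, h.conj_θ2 hp, bar_bracket (s 2) (s 3), bracket_congr b2 b3, bracket_swap, tor]
    simp
  -- The three σ-coefficients involved are locally constant, so the Jacobi identity is purely
  -- algebraic.
  have c1 : cderiv (D.tor 0 2 3) p = 0 := by
    have e : D.tor 0 2 3 =ᶠ[nhds p] fun _ => 0 :=
      (D.eventually_mem hp).mono fun q hq => h.tor_023 hq
    rw [cderiv_congr e, cderiv_const]
  have c2 : cderiv (D.tor 0 3 1) p = 0 := by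
    have e : D.tor 0 3 1 =ᶠ[nhds p] fun _ => -1 :=
      (D.eventually_mem hp).mono fun q hq => by rw [tor_swap, h.norm2 q hq]
    rw [cderiv_congr e, cderiv_const]
  have c3 : cderiv (D.tor 0 1 2) p = 0 := by
    have e : D.tor 0 1 2 =ᶠ[nhds p] fun _ => 1 :=
      (D.eventually_mem hp).mono fun q hq => h.tor_012 hq
    rw [cderiv_congr e, cderiv_const]
  have hJ := D.jacobi_tor hp 0 1 2 3 c1 c2 c3
  simp only [Fin.sum_univ_four, D.tor_self, D.tor_swap _ 1 0, D.tor_swap _ 2 0, D.tor_swap _ 2 1,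
    D.tor_swap _ 3 0, D.tor_swap _ 3 1, D.tor_swap _ 3 2, h.tor_023 hp, h.tor_012 hp,
    h.norm2 p hp] at hJ
  have hJ' := congrArg conj hJ
  obtain ⟨n1, n2⟩ := h.norm3 p hp
  simp only [map_add, map_mul, map_neg, map_zero, map_one, hB, h112, h323] at hJ'
  have hk0 : k = 0 := by
    have e1 : conj (D.tor 2 2 3 p) = conj (D.tor 1 1 3 p) / 2 := by rw [n1, map_div₀, map_ofNat]
    have e2 : conj (D.tor 2 2 3 p) = conj (D.tor 0 0 3 p) / 3 := by rw [n2, map_div₀, map_ofNat]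
    linear_combination hJ' / 2 + 3 / 2 * n2 - n1 + e1 - 3 / 2 * e2
  apply (D.dual p hp).vec_ext
  intro i
  rw [D.θ_e hp]
  fin_cases i
  · simpa using h00
  · simpa [← hk] using hk0
  · simpa using h02
  · simpa using h03

theorem isRealFrame : D.IsRealFrame := by
  intro p hp i
  fin_cases i
  · exact h.conj_e0 hp
  · exact h.conj_e1 hp
  · exact h.conj_e2 hp
  · exact h.conj_e3 hp

/-- The components of the frame of a second reduced coframe, first step. -/
theorem components {D' : LocalCoframe M} (h' : D'.IsReduced 𝓛) (hp : p ∈ D.U) (hp' : p ∈ D'.U) :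
    ∃ f : ℝ, f ≠ 0 ∧ D.θ p 2 (D'.e 2 p) = f ∧ D.θ p 0 (D'.e 2 p) = 0 ∧ D.θ p 1 (D'.e 2 p) = 0 ∧
      D.θ p 3 (D'.e 2 p) = 0 ∧ D.θ p 0 (D'.e 3 p) = 0 ∧ D.θ p 1 (D'.e 3 p) = 0 ∧
      D.θ p 2 (D'.e 3 p) = 0 ∧ D.θ p 3 (D'.e 3 p) = f ∧ D.θ p 0 (D'.e 1 p) = 0 ∧
      D.θ p 1 (D'.e 1 p) = f ^ 2 ∧ D.θ p 0 (D'.e 0 p) = f ^ 3 ∧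
      D.θ p 3 (D'.e 1 p) = conj (D.θ p 2 (D'.e 1 p)) ∧
      D.θ p 3 (D'.e 0 p) = conj (D.θ p 2 (D'.e 0 p)) := by
  obtain ⟨f, hf⟩ := h.isGenerator_e2.exists_smul h'.isSection_e2
  have hpW : p ∈ D.U ⊓ D'.U := ⟨hp, hp'⟩
  have hLW : (D.e 2).SmoothOn (D.U ⊓ D'.U : Opens M) :=
    smoothOn_iff.2 fun q hq => D.smoothAt_e hq.1 2
  have ev : ∀ᶠ q in nhds p, D'.e 2 q = f q • D.e 2 q :=
    Filter.eventually_of_mem ((D.U ⊓ D'.U).isOpen.mem_nhds hpW) fun q hq => (hf q hq).2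
  have hbar : ∀ᶠ q in nhds p, bar (D'.e 2) q = bar (fun q => f q • D.e 2 q) q :=
    ev.mono fun q hq => by simp only [bar, hq]
  have hT : ∀ᶠ q in nhds p, fieldT (D'.e 2) q = fieldT (fun q => f q • D.e 2 q) q := by
    filter_upwards [ev.eventually_nhds, hbar.eventually_nhds] with q h1 h2
    simp only [fieldT]
    rw [bracket_congr h1 h2]
  have hS : fieldS (D'.e 2) p = fieldS (fun q => f q • D.e 2 q) p := bracket_congr ev hT
  have e2 : D'.e 2 p = f p • D.e 2 p := (hf p hpW).2
  have e3 : D'.e 3 p = conj (f p) • D.e 3 p := by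
    rw [← h'.conj_e2 hp', e2, conjVec_smul, h.conj_e2 hp]
  have hbar2 : bar (D.e 2) p = D.e 3 p := h.conj_e2 hp
  obtain ⟨t0, t1, s0⟩ := h.values_fieldT hp
  obtain ⟨t0', t1', s0'⟩ := h'.values_fieldT hp'
  have k02 : D.θ p 0 (D.e 2 p) = 0 := D.θ_e hp 0 2
  have k03 : D.θ p 0 (bar (D.e 2) p) = 0 := by rw [hbar2]; exact D.θ_e hp 0 3
  have k12 : D.θ p 1 (D.e 2 p) = 0 := D.θ_e hp 1 2
  have k13 : D.θ p 1 (bar (D.e 2) p) = 0 := by rw [hbar2]; exact D.θ_e hp 1 3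
  have T0 : D.θ p 0 (fieldT (D'.e 2) p) = 0 := by
    rw [hT.self_of_nhds, form_fieldT_smul (D.smoothAt_e hp 2) (hf p hpW).1 _ k02 k03, t0, mul_zero]
  have T1 : D.θ p 1 (fieldT (D'.e 2) p) = f p * conj (f p) := by
    rw [hT.self_of_nhds, form_fieldT_smul (D.smoothAt_e hp 2) (hf p hpW).1 _ k12 k13, t1, mul_one]
  have S0 : D.θ p 0 (fieldS (D'.e 2) p) = f p * f p * conj (f p) := by
    rw [hS, form_fieldS_smul hpW hLW (fun q hq => (hf q hq).1) _ k02 k03 t0, s0, mul_one]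
  have hdT := (D'.dual p hp').sum_smul (fieldT (D'.e 2) p)
  have hdS := (D'.dual p hp').sum_smul (fieldS (D'.e 2) p)
  simp only [Fin.sum_univ_four, t0', t1', s0', zero_smul, one_smul, zero_add] at hdT hdS
  have a10 : D.θ p 0 (D'.e 1 p) = 0 := by
    have := congrArg (D.θ p 0) hdT
    rw [T0, e2, e3] at this
    simpa [D.θ_e hp] using this
  have a11 : D.θ p 1 (D'.e 1 p) = f p * conj (f p) := by
    have := congrArg (D.θ p 1) hdT
    rw [T1, e2, e3] at this
    simpa [D.θ_e hp] using this
  have a00 : D.θ p 0 (D'.e 0 p) = f p * f p * conj (f p) := by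
    have := congrArg (D.θ p 0) hdS
    rw [S0, e2, e3] at this
    simpa [D.θ_e hp, a10] using this
  have hf0 : f p ≠ 0 := by
    intro h0
    have := D'.θ_e hp' 2 2
    rw [e2, h0, zero_smul, map_zero] at this
    simp at this
  -- Both e_σ' and σ are real, so their pairing f² f̄ is real; as f is nonzero, f itself is real.
  -- This reduces the complex parameter a to a real one.
  have hreal : conj (f p) = f p := by
    have h1 := h.isRealFrame.conj_θ hp 0 (D'.e 0 p)
    rw [h'.conj_e0 hp'] at h1
    change conj (D.θ p 0 (D'.e 0 p)) = D.θ p 0 (D'.e 0 p) at h1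
    rw [a00, map_mul, map_mul, Complex.conj_conj] at h1
    have h2 : conj (f p) ≠ 0 := (map_ne_zero _).2 hf0
    have h3 : f p * conj (f p) * (conj (f p) - f p) = 0 := by linear_combination h1
    rcases mul_eq_zero.1 h3 with h4 | h4
    · exact absurd h4 (mul_ne_zero hf0 h2)
    · exact sub_eq_zero.1 h4
  have hre : (((f p).re : ℝ) : ℂ) = f p := Complex.conj_eq_iff_re.1 hreal
  refine ⟨(f p).re, ?_, ?_⟩
  · intro h0
    rw [h0] at hre
    exact hf0 hre.symm
  rw [hre, e2, e3, hreal]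
  simp only [map_smul, D.θ_e hp, a10, a11, a00, hreal]
  refine ⟨by simp, by simp, by simp, by simp, by simp, by simp, by simp, by simp, trivial, by ring,
    by ring, ?_, ?_⟩
  · have := h.isRealFrame.conj_θ hp 2 (D'.e 1 p)
    rw [h'.conj_e1 hp'] at this
    exact this.symm
  · have := h.isRealFrame.conj_θ hp 2 (D'.e 0 p)
    rw [h'.conj_e0 hp'] at this
    exact this.symm

end IsReduced

end LocalCoframe

end Uniqueness

/-! ### Rigidity: two reduced sections differ by a function with values in G₄. -/

section Uniqueness

set_option linter.unusedSectionVars false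

variable {M : Type*} [TopologicalSpace M] [ChartedSpace R4 M] [IsManifold (𝓡 4) ∞ M]

open CVectorField

theorem cderiv_sq {F : M → ℂ} {p : M} (hF : SmoothFunAt F p) :
    cderiv (fun q => F q ^ 2) p = (2 * F p) • cderiv F p := by
  simp only [pow_two]
  rw [cderiv_mul hF hF, ← add_smul, two_mul]

theorem cderiv_cube {F : M → ℂ} {p : M} (hF : SmoothFunAt F p) :
    cderiv (fun q => F q ^ 3) p = (3 * F p ^ 2) • cderiv F p := by
  have h : (fun q => F q ^ 3) = fun q => F q * (F q * F q) := by
    ext q; ring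
  rw [h, cderiv_mul hF (hF.mul hF), cderiv_mul hF hF]
  module

namespace LocalCoframe

variable {D D' : LocalCoframe M} {𝓛 : CRStructure M} {p : M}

/-- The factor between the third members of the frames of two reduced coframes. -/
def ratio (D D' : LocalCoframe M) (q : M) : ℂ := D.θ q 2 (D'.e 2 q)

namespace IsReduced

variable (h : D.IsReduced 𝓛) (h' : D'.IsReduced 𝓛)

include h h'

theorem smoothFunAt_ratio (hp : p ∈ D.U) (hp' : p ∈ D'.U) : SmoothFunAt (ratio D D') p :=
  smoothFunAt_θ_e hp hp' 2 2

theorem ratio_ne_zero (hp : p ∈ D.U) (hp' : p ∈ D'.U) : ratio D D' p ≠ 0 := by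
  obtain ⟨f, hf, e, -⟩ := h.components h' hp hp'
  rw [ratio, e]
  exact_mod_cast hf

theorem ratio_real (hp : p ∈ D.U) (hp' : p ∈ D'.U) : ((ratio D D' p).re : ℂ) = ratio D D' p := by
  obtain ⟨f, hf, e, -⟩ := h.components h' hp hp'
  rw [ratio, e, Complex.ofReal_re]

theorem components_ratio (hp : p ∈ D.U) (hp' : p ∈ D'.U) :
    (∀ i, D.θ p i (D'.e 2 p) = if i = 2 then ratio D D' p else 0) ∧
    (∀ i, D.θ p i (D'.e 3 p) = if i = 3 then ratio D D' p else 0) ∧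
    D.θ p 0 (D'.e 1 p) = 0 ∧ D.θ p 1 (D'.e 1 p) = ratio D D' p ^ 2 ∧
    D.θ p 0 (D'.e 0 p) = ratio D D' p ^ 3 ∧
    D.θ p 3 (D'.e 1 p) = conj (D.θ p 2 (D'.e 1 p)) ∧
    D.θ p 3 (D'.e 0 p) = conj (D.θ p 2 (D'.e 0 p)) := by
  obtain ⟨f, hf, e, a1, a2, a3, a4, a5, a6, a7, a8, a9, a10, a11, a12⟩ := h.components h' hp hp'
  have hr : ratio D D' p = f := e
  rw [hr]
  refine ⟨fun i => ?_, fun i => ?_, a8, a9, a10, a11, a12⟩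
  · fin_cases i <;> simp [*]
  · fin_cases i <;> simp [*]

theorem eventually_mem_inf (hp : p ∈ D.U) (hp' : p ∈ D'.U) :
    ∀ᶠ q in nhds p, q ∈ D.U ∧ q ∈ D'.U :=
  (D.eventually_mem hp).and (D'.eventually_mem hp')

/-- Let β be the ζ-component of e_ρ' and μ the ρ-component of e_σ'. The laws for T^ζ_{ζζ̄},
T^ρ_{ρζ̄}, T^σ_{σζ̄} contain the derivative of F along e_ζ̄' with factors proportional to 1, 2, 3,
exactly as these coefficients are tied together. Eliminating it leaves μ = 3iβF and μ = -3iβF. -/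
theorem θ2_e1_and_θ1_e0_eq_zero (hp : p ∈ D.U) (hp' : p ∈ D'.U) :
    D.θ p 2 (D'.e 1 p) = 0 ∧ D.θ p 1 (D'.e 0 p) = 0 := by
  obtain ⟨c2, c3, c01, c11, c00, c31, c30⟩ := h.components_ratio h' hp hp'
  have ev := h.eventually_mem_inf h' hp hp'
  have sF := h.smoothFunAt_ratio h' hp hp'
  have hF := h.ratio_ne_zero h' hp hp'
  have z : ∀ k i, (∀ q, q ∈ D.U → q ∈ D'.U → D.θ q k (D'.e i q) = 0) →
      cderiv (fun q => D.θ q k (D'.e i q)) p = 0 := by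
    intro k i hz
    have : (fun q => D.θ q k (D'.e i q)) =ᶠ[nhds p] fun _ => 0 := ev.mono fun q hq => hz q hq.1 hq.2
    rw [cderiv_congr this, cderiv_const]
  have d11 : cderiv (fun q => D.θ q 1 (D'.e 1 q)) p
      = (2 * ratio D D' p) • cderiv (ratio D D') p := by
    have : (fun q => D.θ q 1 (D'.e 1 q)) =ᶠ[nhds p] fun q => ratio D D' q ^ 2 :=
      ev.mono fun q hq => (h.components_ratio h' hq.1 hq.2).2.2.2.1
    rw [cderiv_congr this, cderiv_sq sF]
  have d00 : cderiv (fun q => D.θ q 0 (D'.e 0 q)) p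
      = (3 * ratio D D' p ^ 2) • cderiv (ratio D D') p := by
    have : (fun q => D.θ q 0 (D'.e 0 q)) =ᶠ[nhds p] fun q => ratio D D' q ^ 3 :=
      ev.mono fun q hq => (h.components_ratio h' hq.1 hq.2).2.2.2.2.1
    rw [cderiv_congr this, cderiv_cube sF]
  have d22 : cderiv (fun q => D.θ q 2 (D'.e 2 q)) p = cderiv (ratio D D') p := rfl
  have d23 := z 2 3 fun q h1 h2 => by simpa using (h.components_ratio h' h1 h2).2.1 2
  have d13 := z 1 3 fun q h1 h2 => by simpa using (h.components_ratio h' h1 h2).2.1 1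
  have d03 := z 0 3 fun q h1 h2 => by simpa using (h.components_ratio h' h1 h2).2.1 0
  have t1 := tor_change hp hp' 2 2 3
  have t2 := tor_change hp hp' 1 1 3
  have t3 := tor_change hp hp' 0 0 3
  simp only [Fin.sum_univ_four, d11, d00, d22, d23, d13, d03, c2, c3, c01, c11, c00, D.tor_self,
    h.tor_023 hp, h.tor_123 hp, h'.tor_023 hp', h'.tor_123 hp', h.norm2 p hp, h'.norm2 p hp',
    D.tor_swap _ 3 2, LinearMap.smul_apply, LinearMap.zero_apply, smul_eq_mul, Fin.isValue,
    Fin.reduceEq, if_true, if_false] at t1 t2 t3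
  obtain ⟨n1, n2⟩ := h.norm3 p hp
  obtain ⟨n1', n2'⟩ := h'.norm3 p hp'
  set F := ratio D D' p
  set β := D.θ p 2 (D'.e 1 p)
  set μ := D.θ p 1 (D'.e 0 p)
  set dF := cderiv (ratio D D') p (D'.e 3 p)
  have hx2 : D.tor 1 1 3 p = 2 * D.tor 2 2 3 p := by rw [n1]; ring
  have hx3 : D.tor 0 0 3 p = 3 * D.tor 2 2 3 p := by rw [n2]; ring
  have hx2' : D'.tor 1 1 3 p = 2 * D'.tor 2 2 3 p := by rw [n1']; ring
  have hx3' : D'.tor 0 0 3 p = 3 * D'.tor 2 2 3 p := by rw [n2']; ring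
  rw [hx2, hx2'] at t2
  rw [hx3, hx3'] at t3
  -- The sum of the two relations between μ and β, multiplied by F.
  have hμF : μ * F = 0 := by
    linear_combination (F * (t2 - 2 * F * t1) - (t3 - 3 * F ^ 2 * t1)) / 2
  have hμ : μ = 0 := (mul_eq_zero.1 hμF).resolve_right hF
  refine ⟨?_, hμ⟩
  have h3 : β * (Complex.I * F) = 0 := by
    linear_combination (hμ - (t2 - 2 * F * t1)) / 3
  exact (mul_eq_zero.1 h3).resolve_right (mul_ne_zero Complex.I_ne_zero hF)

/-- With β = μ = 0, the ζ-component ν of e_σ' changes T^ρ_{σζ̄} by a nonzero multiple of iνF, as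
T^ρ_{ζζ̄} = i; this coefficient vanishes in both frames. -/
theorem θ2_e0_eq_zero (hp : p ∈ D.U) (hp' : p ∈ D'.U) : D.θ p 2 (D'.e 0 p) = 0 := by
  obtain ⟨c2, c3, c01, c11, c00, c31, c30⟩ := h.components_ratio h' hp hp'
  have ev := h.eventually_mem_inf h' hp hp'
  have hF := h.ratio_ne_zero h' hp hp'
  obtain ⟨hβ, hμ⟩ := h.θ2_e1_and_θ1_e0_eq_zero h' hp hp'
  have z : ∀ k i, (∀ q, q ∈ D.U → q ∈ D'.U → D.θ q k (D'.e i q) = 0) →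
      cderiv (fun q => D.θ q k (D'.e i q)) p = 0 := by
    intro k i hz
    have : (fun q => D.θ q k (D'.e i q)) =ᶠ[nhds p] fun _ => 0 := ev.mono fun q hq => hz q hq.1 hq.2
    rw [cderiv_congr this, cderiv_const]
  have d10 := z 1 0 fun q h1 h2 => (h.θ2_e1_and_θ1_e0_eq_zero h' h1 h2).2
  have d13 := z 1 3 fun q h1 h2 => by simpa using (h.components_ratio h' h1 h2).2.1 1
  have t := tor_change hp hp' 1 0 3
  simp only [Fin.sum_univ_four, d10, d13, c2, c3, c11, c00, hμ, D.tor_self,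
    h.tor_123 hp, (h.norm4 p hp).2, (h'.norm4 p hp').2, LinearMap.zero_apply,
    Fin.isValue, Fin.reduceEq, if_true, if_false] at t
  have h3 : D.θ p 2 (D'.e 0 p) * (Complex.I * ratio D D' p) = 0 := by
    linear_combination -t
  exact (mul_eq_zero.1 h3).resolve_right (mul_ne_zero Complex.I_ne_zero hF)

/-- The frames of two reduced coframes differ by the action of `G₄`. -/
theorem θ_e_ratio (hp : p ∈ D.U) (hp' : p ∈ D'.U) (k i : Fin 4) :
    D.θ p k (D'.e i p) = if k = i then ratio D D' p ^ (![3, 2, 1, 1] i : ℕ) else 0 := by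
  obtain ⟨c2, c3, c01, c11, c00, c31, c30⟩ := h.components_ratio h' hp hp'
  obtain ⟨hβ, hμ⟩ := h.θ2_e1_and_θ1_e0_eq_zero h' hp hp'
  have hν := h.θ2_e0_eq_zero h' hp hp'
  rw [hβ, map_zero] at c31
  rw [hν, map_zero] at c30
  fin_cases i <;> fin_cases k <;> simp [*]

/-- The law for T^ρ_{σρ} differentiates F² with a minus sign, and the laws for the T^σ_{σj}
differentiate F³ with a plus sign. The constants 1/2 and -1/3 make each component of λ' - λ equal to
that of -dF/F. -/
theorem lam_ratio (hp : p ∈ D.U) (hp' : p ∈ D'.U) :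
    D'.lam p = D.lam p - (ratio D D' p)⁻¹ • cderiv (ratio D D') p := by
  have key := h.θ_e_ratio h' hp hp'
  have ev := h.eventually_mem_inf h' hp hp'
  have sF := h.smoothFunAt_ratio h' hp hp'
  have hF := h.ratio_ne_zero h' hp hp'
  have z : ∀ k i, k ≠ i → cderiv (fun q => D.θ q k (D'.e i q)) p = 0 := by
    intro k i hki
    have : (fun q => D.θ q k (D'.e i q)) =ᶠ[nhds p] fun _ => 0 :=
      ev.mono fun q hq => by simp only [h.θ_e_ratio h' hq.1 hq.2, if_neg hki]
    rw [cderiv_congr this, cderiv_const]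
  have d11 : cderiv (fun q => D.θ q 1 (D'.e 1 q)) p
      = (2 * ratio D D' p) • cderiv (ratio D D') p := by
    have : (fun q => D.θ q 1 (D'.e 1 q)) =ᶠ[nhds p] fun q => ratio D D' q ^ 2 :=
      ev.mono fun q hq => (h.components_ratio h' hq.1 hq.2).2.2.2.1
    rw [cderiv_congr this, cderiv_sq sF]
  have d00 : cderiv (fun q => D.θ q 0 (D'.e 0 q)) p
      = (3 * ratio D D' p ^ 2) • cderiv (ratio D D') p := by
    have : (fun q => D.θ q 0 (D'.e 0 q)) =ᶠ[nhds p] fun q => ratio D D' q ^ 3 :=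
      ev.mono fun q hq => (h.components_ratio h' hq.1 hq.2).2.2.2.2.1
    rw [cderiv_congr this, cderiv_cube sF]
  have t1 := tor_change hp hp' 1 0 1
  have t2 := tor_change hp hp' 0 0 1
  have t3 := tor_change hp hp' 0 0 2
  have t4 := tor_change hp hp' 0 0 3
  apply (D'.dual p hp').form_ext
  intro j
  simp only [lam, LinearMap.sub_apply, LinearMap.smul_apply, smul_eq_mul, D'.θ_e hp', key]
  simp only [Fin.sum_univ_four, d00, d11, z 1 0 (by decide), z 0 1 (by decide), z 0 2 (by decide),
    z 0 3 (by decide), LinearMap.smul_apply, LinearMap.zero_apply, smul_eq_mul, key,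
    D.tor_self] at t1 t2 t3 t4
  have hi := mul_inv_cancel₀ hF
  fin_cases j
  · simp at t1 ⊢
    apply mul_left_cancel₀ (pow_ne_zero 3 hF)
    linear_combination (ratio D D' p / 2) * t1
      + (ratio D D' p ^ 2 * cderiv (ratio D D') p (D'.e 0 p)) * hi
  · simp at t2 ⊢
    apply mul_left_cancel₀ (pow_ne_zero 3 hF)
    linear_combination -t2 / 3
      + (ratio D D' p ^ 2 * cderiv (ratio D D') p (D'.e 1 p)) * hi
  · simp at t3 ⊢
    apply mul_left_cancel₀ (pow_ne_zero 3 hF)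
    linear_combination -t3 / 3
      + (ratio D D' p ^ 2 * cderiv (ratio D D') p (D'.e 2 p)) * hi
  · simp at t4 ⊢
    apply mul_left_cancel₀ (pow_ne_zero 3 hF)
    linear_combination -t4 / 3
      + (ratio D D' p ^ 2 * cderiv (ratio D D') p (D'.e 3 p)) * hi

/-- Coframes transform inversely to frames, hence the ratio with the two sections exchanged. -/
theorem eq_scale (hp : p ∈ D.U) (hp' : p ∈ D'.U) :
    D'.θ p = (D.θ p).scale (ratio D' D p).re := by
  funext k
  apply (D.dual p hp).form_ext
  intro i
  rw [h'.θ_e_ratio h hp' hp]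
  have hr := h'.ratio_real h hp' hp
  have hd : ∀ k, D.θ p k (D.e i p) = if k = i then 1 else 0 := fun k => D.θ_e hp k i
  fin_cases k <;> simp only [Coframe.scale, hr, Fin.zero_eta, Fin.mk_one, Fin.reduceFinMk,
    Matrix.cons_val, LinearMap.smul_apply, hd, smul_eq_mul] <;> fin_cases i <;> simp

/-- The point with fibre coordinate a over `D'` has fibre coordinate ar over `D`. Thus the last
clause says precisely that the two expressions da/a + λ are the same form on P⁴. -/
theorem exists_scale : ∃ r : M → ℝ, ContMDiffOn (𝓡 4) 𝓘(ℝ, ℝ) ∞ r (D.U ∩ D'.U) ∧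
    ∀ p ∈ D.U ⊓ D'.U, r p ≠ 0 ∧ D'.θ p = (D.θ p).scale (r p) ∧
      ∀ v : TangentSpace (𝓡 4) p, onReal (D'.lam p) v = onReal (D.lam p) v
        + (((r p)⁻¹ * diffReal r p v : ℝ) : ℂ) := by
  refine ⟨fun q => (ratio D' D q).re, ?_, ?_⟩
  · intro q hq
    exact (Complex.reCLM.contDiff.contMDiff.contMDiffAt.comp q
      (h'.smoothFunAt_ratio h hq.2 hq.1)).contMDiffWithinAt
  · rintro p ⟨hp, hp'⟩
    have hr := h'.ratio_real h hp' hp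
    refine ⟨?_, h.eq_scale h' hp hp', ?_⟩
    · intro h0
      apply h'.ratio_ne_zero h hp' hp
      have h0' : (ratio D' D p).re = 0 := h0
      rw [← hr, h0', Complex.ofReal_zero]
    · intro v
      have sm := h'.smoothFunAt_ratio h hp' hp
      have hre : MDifferentiableAt (𝓡 4) 𝓘(ℝ, ℝ) (fun q => (ratio D' D q).re) p :=
        (Complex.reCLM.contDiff.contMDiff.contMDiffAt.comp p sm).mdifferentiableAt (n := ∞)
          (by simp)
      have h1 : cderiv (ratio D' D) p ((1 : ℂ) ⊗ₜ[ℝ] v)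
          = (diffReal (fun q => (ratio D' D q).re) p v : ℂ) := by
        have e : ratio D' D =ᶠ[nhds p] Complex.ofRealCLM ∘ fun q => (ratio D' D q).re :=
          (h.eventually_mem_inf h' hp hp').mono fun q hq => (h'.ratio_real h hq.2 hq.1).symm
        rw [cderiv_congr e]
        simp only [cderiv_apply, rePart_tmul, imPart_tmul, Complex.one_re, Complex.one_im,
          one_smul, zero_smul, map_zero, mul_zero, add_zero]
        have h2 := (Complex.ofRealCLM.hasMFDerivAt (x := (ratio D' D p).re)).comp p
          hre.hasMFDerivAt
        change (mfderiv (𝓡 4) 𝓘(ℝ, ℂ) (Complex.ofRealCLM ∘ fun q => (ratio D' D q).re) p v : ℂ) = _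
        rw [h2.mfderiv]
        rfl
      have h3 := congrArg (fun φ => φ ((1 : ℂ) ⊗ₜ[ℝ] v)) (h'.lam_ratio h hp' hp)
      simp only [LinearMap.sub_apply, LinearMap.smul_apply, smul_eq_mul, h1] at h3
      change D'.lam p ((1 : ℂ) ⊗ₜ[ℝ] v) = D.lam p ((1 : ℂ) ⊗ₜ[ℝ] v) + _
      push_cast
      rw [h3, hr]
      ring

end IsReduced

/-! ### The action of G₄ on reduced sections, and the fibres of P⁴. -/

/-- The coefficients of `diag (a³, a², a, a)`. -/
def weightCoeff (a : ℝ) : Fin 4 → ℂ := ![(a : ℂ) ^ 3, (a : ℂ) ^ 2, a, a]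

theorem _root_.Coframe.scale_apply {p : M} (a : ℝ) (θ : Coframe p) (i : Fin 4) :
    θ.scale a i = weightCoeff a i • θ i := by
  fin_cases i <;> rfl

theorem weightCoeff_ne_zero {a : ℝ} (ha : a ≠ 0) (i : Fin 4) : weightCoeff a i ≠ 0 := by
  have : (a : ℂ) ≠ 0 := by exact_mod_cast ha
  fin_cases i <;> simp [weightCoeff, this]

variable (D) in
/-- The multiple of a local coframe by a constant element of `G₄`. -/
def scaleBy (a : ℝ) (ha : a ≠ 0) : LocalCoframe M where
  U := D.U
  θ p := (D.θ p).scale a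
  e i p := (weightCoeff a i)⁻¹ • D.e i p
  smooth_θ i := smoothFormOn_iff.2 fun p hp => by
    simp only [Coframe.scale_apply]
    exact SmoothFormAt.smul (smoothFunAt_const _) (D.smoothFormAt_θ hp i)
  smooth_e i := smoothOn_iff.2 fun p hp => SmoothAt.const_smul _ (D.smoothAt_e hp i)
  dual p hp := fun i j => by
    have hd := D.θ_e hp i j
    simp only [Coframe.scale_apply, LinearMap.smul_apply, map_smul, hd, smul_eq_mul]
    split_ifs with hij
    · subst hij
      simpa using inv_mul_cancel₀ (weightCoeff_ne_zero ha i)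
    · simp

theorem tor_scaleBy {a : ℝ} (ha : a ≠ 0) (hp : p ∈ D.U) (k i j : Fin 4) :
    (D.scaleBy a ha).tor k i j p
      = weightCoeff a k * (weightCoeff a i)⁻¹ * (weightCoeff a j)⁻¹ * D.tor k i j p := by
  have h1 : bracket ((D.scaleBy a ha).e i) ((D.scaleBy a ha).e j) p
      = ((weightCoeff a i)⁻¹ * (weightCoeff a j)⁻¹) • bracket (D.e i) (D.e j) p := by
    change bracket (fun q => (weightCoeff a i)⁻¹ • D.e i q)
      (fun q => (weightCoeff a j)⁻¹ • D.e j q) p = _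
    rw [bracket_smul_left (smoothFunAt_const _) (D.smoothAt_e hp i),
      bracket_smul_right (smoothFunAt_const _) (D.smoothAt_e hp j), cderiv_const, cderiv_const]
    simp [smul_smul]
  rw [tor, h1]
  change -(((D.θ p).scale a) k _) = _
  rw [Coframe.scale_apply, tor]
  simp
  ring

/-- T^k_{ij} has weight w_k - w_i - w_j: this is 0 for T^σ_{ρζ̄} and -1 for the three coefficients
compared in P³, so every normalization is homogeneous. -/
theorem IsReduced.scaleBy (h : D.IsReduced 𝓛) {a : ℝ} (ha : a ≠ 0) :
    (D.scaleBy a ha).IsReduced 𝓛 := by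
  have hac : (a : ℂ) ≠ 0 := by exact_mod_cast ha
  refine ⟨?_, ?_, ?_, ?_⟩
  · intro p hp
    obtain ⟨hc, U, L, ω₀, α, b, c, d, hpU, hL, hω, hα, h0, h1, h2⟩ := h.adapted p hp
    refine ⟨?_, U, L, ω₀, a * α, a * b, a ^ 2 * c, a * d, hpU, hL, hω, mul_ne_zero hac hα, ?_, ?_, ?_⟩
    · intro v
      change ((D.θ p).scale a) 3 v = conj (((D.θ p).scale a) 2 (conjVec v))
      simp [Coframe.scale, hc v]
    · change ((D.θ p).scale a) 0 = _
      simp only [Coframe.scale, Matrix.cons_val, h0, smul_smul, map_mul, Complex.conj_ofReal]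
      congr 1
      ring
    · change ((D.θ p).scale a) 1 = _
      simp only [Coframe.scale, Matrix.cons_val, h1, smul_add, smul_smul, map_mul,
        Complex.conj_ofReal]
      congr 2
      ring
    · change ((D.θ p).scale a) 2 = _
      simp only [Coframe.scale, Matrix.cons_val, h2, smul_add, smul_smul]
  · intro p hp
    rw [tor_scaleBy (D := D) ha hp, h.norm2 p hp]
    simp [weightCoeff]
    field_simp
  · intro p hp
    rw [tor_scaleBy (D := D) ha hp, tor_scaleBy (D := D) ha hp, tor_scaleBy (D := D) ha hp, ← sub_eq_zero]
    obtain ⟨h1, h2⟩ := h.norm3 p hp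
    have h1' : D.tor 1 1 3 p = 2 * D.tor 2 2 3 p := by rw [h1]; ring
    have h2' : D.tor 0 0 3 p = 3 * D.tor 2 2 3 p := by rw [h2]; ring
    rw [h1', h2']
    simp [weightCoeff]
    constructor <;> field_simp
    ring
  · intro p hp
    rw [tor_scaleBy (D := D) ha hp, tor_scaleBy (D := D) ha hp, (h.norm4 p hp).1, (h.norm4 p hp).2]
    simp

/-- Orbits stay in P⁴ because constant multiples of a reduced section are reduced. The action is
free since ζ(e_ζ) recovers a, and transitive by rigidity. -/
theorem IsReduced.bijOn_P4 (h : D.IsReduced 𝓛) (hp : p ∈ D.U) :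
    BijOn (fun a : ℝˣ => (D.θ p).scale (a : ℝ)) univ (P4 𝓛 p) := by
  refine ⟨?_, ?_, ?_⟩
  · intro a _
    exact ⟨D.scaleBy a a.ne_zero, h.scaleBy a.ne_zero, hp, rfl⟩
  · intro a _ b _ hab
    have h1 := congrArg (fun θ : Coframe p => θ 2 (D.e 2 p)) hab
    simp only [Coframe.scale, Matrix.cons_val, LinearMap.smul_apply, D.θ_e hp] at h1
    ext
    simpa using h1
  · rintro θ ⟨D', h', hp', rfl⟩
    have hr : (ratio D' D p).re ≠ 0 := by
      intro h0
      apply h'.ratio_ne_zero h hp' hp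
      rw [← h'.ratio_real h hp' hp, h0, Complex.ofReal_zero]
    exact ⟨Units.mk0 _ hr, mem_univ _, (h.eq_scale h' hp hp').symm⟩

end LocalCoframe

end Uniqueness

/-! ### Existence of sections: a generator with S real modulo T, L, L̄. -/

section Existence

set_option linter.unusedSectionVars false

variable {M : Type*} [TopologicalSpace M] [ChartedSpace R4 M] [IsManifold (𝓡 4) ∞ M]

open CVectorField

/-- The conjugate of a complex covector. -/
def conjForm {V : Type*} [AddCommGroup V] [Module ℝ V] (φ : ℂ ⊗[ℝ] V →ₗ[ℂ] ℂ) :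
    ℂ ⊗[ℝ] V →ₗ[ℂ] ℂ where
  toFun v := conj (φ (conjVec v))
  map_add' v w := by simp
  map_smul' z v := by simp

theorem conjForm_apply {V : Type*} [AddCommGroup V] [Module ℝ V] (φ : ℂ ⊗[ℝ] V →ₗ[ℂ] ℂ)
    (v : ℂ ⊗[ℝ] V) : conjForm φ v = conj (φ (conjVec v)) := rfl

variable {𝓛 : CRStructure M}

namespace CRStructure

theorem smoothOn_frame {L : CVectorField M} {U : Opens M} (hL : L.SmoothOn U) (i : Fin 4) :
    SmoothOn (fun q => frame L q i) U := by
  refine smoothOn_iff.2 fun q hq => ?_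
  have h := smoothOn_iff.1 hL q hq
  fin_cases i
  · exact SmoothAt_fieldS h
  · exact SmoothAt_fieldT h
  · exact h
  · exact h.bar

/-- A generator `L` for which `S` is real modulo `T, L, L̄`. -/
theorem exists_normalized_generator (h𝓛 : 𝓛.IsClassII) (p : M) :
    ∃ (U : Opens M) (L : CVectorField M), p ∈ U ∧ 𝓛.IsGenerator L U ∧
      ∀ q ∈ U, ∀ φ : ℂ ⊗[ℝ] TangentSpace (𝓡 4) q →ₗ[ℂ] ℂ, φ (L q) = 0 → φ (bar L q) = 0 →
        φ (fieldT L q) = 0 → φ (conjVec (fieldS L q)) = φ (fieldS L q) := by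
  obtain ⟨U, hpU, L, hLs, hL'⟩ := 𝓛.exists_generator p
  have hL : 𝓛.IsGenerator L U := ⟨hLs, hL'⟩
  let D : LocalCoframe M := LocalCoframe.ofFrame U (fun i q => frame L q i)
    (smoothOn_frame hLs) fun q hq => hL.linearIndependent_frame h𝓛 hq
  -- Modulo T, L, L̄ the conjugate of S is A·S; conjugating twice gives |A| = 1.
  let A : M → ℂ := fun q => D.θ q 0 (bar (fieldS L) q)
  have hAs : ∀ q ∈ U, SmoothFunAt A q := fun q hq =>
    (D.smoothFormAt_θ (p := q) hq 0).apply (SmoothAt_fieldS (smoothOn_iff.1 hLs q hq)).bar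
  have d0 : ∀ q ∈ U, ∀ i, D.θ q i (fieldS L q) = if i = 0 then 1 else 0 :=
    fun q hq i => D.θ_e (p := q) hq i 0
  have d1 : ∀ q ∈ U, ∀ i, D.θ q i (fieldT L q) = if i = 1 then 1 else 0 :=
    fun q hq i => D.θ_e (p := q) hq i 1
  have d2 : ∀ q ∈ U, ∀ i, D.θ q i (L q) = if i = 2 then 1 else 0 :=
    fun q hq i => D.θ_e (p := q) hq i 2
  have d3 : ∀ q ∈ U, ∀ i, D.θ q i (bar L q) = if i = 3 then 1 else 0 :=
    fun q hq i => D.θ_e (p := q) hq i 3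
  have hexp : ∀ q ∈ U, ∀ φ : ℂ ⊗[ℝ] TangentSpace (𝓡 4) q →ₗ[ℂ] ℂ, φ (L q) = 0 →
      φ (bar L q) = 0 → φ (fieldT L q) = 0 → ∀ v, φ v = D.θ q 0 v * φ (fieldS L q) := by
    intro q hq φ h1 h2 h3 v
    have hs := congrArg φ ((D.dual q hq).sum_smul v)
    rw [← hs, Fin.sum_univ_four, map_add, map_add, map_add, map_smul, map_smul, map_smul, map_smul]
    change _ * φ (fieldS L q) + _ * φ (fieldT L q) + _ * φ (L q) + _ * φ (bar L q) = _
    rw [h1, h2, h3]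
    ring
  have hA1 : ∀ q ∈ U, A q * conj (A q) = 1 := by
    intro q hq
    have h1 := hexp q hq (conjForm (D.θ q 0)) ?_ ?_ ?_ (bar (fieldS L) q)
    · simp only [conjForm_apply, bar, conjVec_conjVec, d0 q hq, if_true, map_one] at h1
      exact h1.symm
    · simpa [conjForm_apply, bar] using d3 q hq 0
    · simpa [conjForm_apply, bar] using d2 q hq 0
    · rw [conjForm_apply, conjVec_fieldT (smoothOn_iff.1 hLs q hq), d1 q hq]
      simp
  -- One of μ = 1 and μ = i works: if both expressions vanished, then 2i = 0.
  obtain ⟨μ, hμ⟩ : ∃ μ : ℂ, μ + A p * conj μ ≠ 0 := by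
    by_contra hcon
    push Not at hcon
    have h1 := hcon 1
    have h2 := hcon Complex.I
    rw [map_one] at h1
    rw [Complex.conj_I] at h2
    have : (2 : ℂ) * Complex.I = 0 := by linear_combination h2 + Complex.I * h1
    simp at this
  -- As in Hilbert's Theorem 90, averaging produces a solution of A w̄ = w. Replacing L by wL
  -- multiplies S by w² w̄ and its conjugate by w̄² w, so the factor A becomes A w̄ / w = 1.
  let w : M → ℂ := fun q => μ + A q * conj μ
  have hw : ∀ q ∈ U, SmoothFunAt w q := fun q hq =>
    (smoothFunAt_const μ).add ((hAs q hq).mul (smoothFunAt_const _))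
  have hwA : ∀ q ∈ U, A q * conj (w q) = w q := by
    intro q hq
    simp only [w, map_add, map_mul, Complex.conj_conj]
    linear_combination μ * hA1 q hq
  have hVo : IsOpen {q | q ∈ U ∧ w q ≠ 0} := by
    have hc : ContinuousOn w U := fun q hq => (hw q hq).continuousAt.continuousWithinAt
    exact hc.isOpen_inter_preimage U.isOpen isOpen_ne
  let V : Opens M := ⟨{q | q ∈ U ∧ w q ≠ 0}, hVo⟩
  have hVL : L.SmoothOn V := smoothOn_iff.2 fun q hq => smoothOn_iff.1 hLs q hq.1
  refine ⟨V, fun q => w q • L q, ⟨hpU, hμ⟩, ⟨?_, ?_⟩, ?_⟩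
  · exact smoothOn_iff.2 fun q hq => SmoothAt.smul (hw q hq.1) (smoothOn_iff.1 hLs q hq.1)
  · intro q hq
    rw [hL' q hq.1, Submodule.span_singleton_smul_eq (IsUnit.mk0 _ hq.2)]
  · intro q hq φ h1 h2 h3
    have hwq : w q ≠ 0 := hq.2
    have hwq' : conj (w q) ≠ 0 := (map_ne_zero _).2 hwq
    have hLq := smoothOn_iff.1 hLs q hq.1
    have k1 : φ (L q) = 0 := by
      rw [map_smul, smul_eq_mul] at h1
      exact (mul_eq_zero.1 h1).resolve_left hwq
    have k2 : φ (bar L q) = 0 := by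
      rw [bar, conjVec_smul, map_smul, smul_eq_mul] at h2
      exact (mul_eq_zero.1 h2).resolve_left hwq'
    have k3 : φ (fieldT L q) = 0 := by
      rw [form_fieldT_smul hLq (hw q hq.1) φ k1 k2] at h3
      exact (mul_eq_zero.1 h3).resolve_left (mul_ne_zero hwq hwq')
    -- The scaling law of S is applied to the conjugate covector and then conjugated, which gives
    -- the law for the conjugate of S.
    have hconj := form_fieldS_smul (U := V) hq hVL (fun r hr => hw r hr.1) (conjForm φ)
      (by rw [conjForm_apply]; change conj (φ (bar L q)) = 0; rw [k2, map_zero])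
      (by rw [conjForm_apply, bar, conjVec_conjVec, k1, map_zero])
      (by rw [conjForm_apply, conjVec_fieldT hLq, k3, map_zero])
    rw [conjForm_apply, conjForm_apply] at hconj
    have hconj' := congrArg conj hconj
    simp only [map_mul, Complex.conj_conj] at hconj'
    have hA : φ (conjVec (fieldS L q)) = A q * φ (fieldS L q) := hexp q hq.1 φ k1 k2 k3 _
    rw [hconj', form_fieldS_smul (U := V) hq hVL (fun r hr => hw r hr.1) φ k1 k2 k3, hA]
    linear_combination conj (w q) * w q * φ (fieldS L q) * hwA q hq.1

end CRStructure

end Existence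

/-! ### Existence of sections: from a real frame to a reduced one. -/

section ExistenceOfSections

set_option linter.unusedSectionVars false

variable {M : Type*} [TopologicalSpace M] [ChartedSpace R4 M] [IsManifold (𝓡 4) ∞ M]

open CVectorField

variable {𝓛 : CRStructure M}

namespace LocalCoframe

/-- A real frame `(R, T, L, L̄)` with `L` a generator, `T = i [L, L̄]` and `R` the real part of
`[L, T]`. -/
structure IsPrereduced (D : LocalCoframe M) (𝓛 : CRStructure M) : Prop where
  real : D.IsRealFrame
  generator : 𝓛.IsGenerator (D.e 2) D.U
  tor_23 : ∀ p ∈ D.U, ∀ k, D.tor k 2 3 p = if k = 1 then Complex.I else 0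
  tor_012 : ∀ p ∈ D.U, D.tor 0 1 2 p = 1
  tor_113 : ∀ p ∈ D.U, D.tor 1 1 3 p = -D.tor 1 1 2 p

theorem exists_isPrereduced (h𝓛 : 𝓛.IsClassII) (p : M) :
    ∃ D : LocalCoframe M, D.IsPrereduced 𝓛 ∧ p ∈ D.U := by
  obtain ⟨U, L, hpU, hL, hS⟩ := CRStructure.exists_normalized_generator h𝓛 p
  have hLq : ∀ q ∈ U, L.SmoothAt q := smoothOn_iff.1 hL.1
  -- Since S and its conjugate agree modulo T, L, L̄, the real part R is S modulo these fields, so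
  -- replacing S by R keeps a frame.
  let R : CVectorField M := fun q => (1 / 2 : ℂ) • (fieldS L q + bar (fieldS L) q)
  let e : Fin 4 → CVectorField M := ![R, fieldT L, L, bar L]
  have he : ∀ i, (e i).SmoothOn U := by
    intro i
    refine smoothOn_iff.2 fun q hq => ?_
    have hS := SmoothAt_fieldS (hLq q hq)
    fin_cases i
    · exact (hS.add hS.bar).const_smul _
    · exact SmoothAt_fieldT (hLq q hq)
    · exact hLq q hq
    · exact (hLq q hq).bar
  have hli : ∀ q ∈ U, LinearIndependent ℂ fun i => e i q := by
    intro q hq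
    obtain ⟨ω₀, hω⟩ := IsDual.of_linearIndependent (hL.linearIndependent_frame h𝓛 hq)
    have w0 : ∀ i, ω₀ i (fieldS L q) = if i = 0 then 1 else 0 := fun i => hω i 0
    have w1 : ∀ i, ω₀ i (fieldT L q) = if i = 1 then 1 else 0 := fun i => hω i 1
    have w2 : ∀ i, ω₀ i (L q) = if i = 2 then 1 else 0 := fun i => hω i 2
    have w3 : ∀ i, ω₀ i (bar L q) = if i = 3 then 1 else 0 := fun i => hω i 3
    have hSS : ω₀ 0 (bar (fieldS L) q) = 1 := by
      rw [bar, hS q hq (ω₀ 0) (by simp [w2]) (by simp [w3]) (by simp [w1]), w0, if_pos rfl]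
    have hR : ω₀ 0 (R q) = 1 := by
      simp only [R, map_smul, map_add, hSS, w0, if_true, smul_eq_mul]
      norm_num
    rw [Fintype.linearIndependent_iff]
    intro g hg
    rw [Fin.sum_univ_four] at hg
    change g 0 • R q + g 1 • fieldT L q + g 2 • L q + g 3 • bar L q = 0 at hg
    have h0 : g 0 = 0 := by
      simpa [hR, w1, w2, w3] using congrArg (ω₀ 0) hg
    have h1 : g 1 = 0 := by
      simpa [h0, w1, w2, w3] using congrArg (ω₀ 1) hg
    have h2 : g 2 = 0 := by
      simpa [h0, w1, w2, w3] using congrArg (ω₀ 2) hg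
    have h3 : g 3 = 0 := by
      simpa [h0, w1, w2, w3] using congrArg (ω₀ 3) hg
    intro i
    fin_cases i <;> assumption
  let D : LocalCoframe M := ofFrame U e he hli
  have k0 : ∀ q ∈ U, ∀ k, D.θ q k (R q) = if k = 0 then 1 else 0 :=
    fun q hq k => D.θ_e (p := q) hq k 0
  have k1 : ∀ q ∈ U, ∀ k, D.θ q k (fieldT L q) = if k = 1 then 1 else 0 :=
    fun q hq k => D.θ_e (p := q) hq k 1
  have k2 : ∀ q ∈ U, ∀ k, D.θ q k (L q) = if k = 2 then 1 else 0 :=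
    fun q hq k => D.θ_e (p := q) hq k 2
  have k3 : ∀ q ∈ U, ∀ k, D.θ q k (bar L q) = if k = 3 then 1 else 0 :=
    fun q hq k => D.θ_e (p := q) hq k 3
  have hθS : ∀ k q, D.θ q k (fieldS L q) = D.tor k 1 2 q := by
    intro k q
    change D.θ q k (bracket L (fieldT L) q) = -D.θ q k (bracket (fieldT L) L q)
    rw [bracket_swap, map_neg]
  have hθS' : ∀ k, ∀ q ∈ U, D.θ q k (bar (fieldS L) q) = D.tor k 1 3 q := by
    intro k q hq
    change D.θ q k (conjVec (bracket L (fieldT L) q)) = -D.θ q k (bracket (fieldT L) (bar L) q)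
    rw [bar_bracket (hLq q hq) (SmoothAt_fieldT (hLq q hq)), bracket_swap, map_neg]
    rw [bracket_congr (Z := bar (fieldT L)) (Z' := fieldT L) (W' := bar L)
      ((D.eventually_mem (p := q) hq).mono fun r hr => conjVec_fieldT (hLq r hr))
      (Filter.Eventually.of_forall fun _ => rfl)]
  -- The brackets [L, T] and [L̄, T] are S and its conjugate and add up to 2R; their components are
  -- T^k_{ρζ} and T^k_{ρζ̄}.
  have hsum : ∀ q ∈ U, ∀ k, D.tor k 1 2 q + D.tor k 1 3 q = if k = 0 then 2 else 0 := by
    intro q hq k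
    have h := k0 q hq k
    simp only [R, map_smul, map_add, smul_eq_mul, hθS, hθS' k q hq] at h
    have h2 := congrArg (fun z : ℂ => 2 * z) h
    simp only [mul_ite, mul_one, mul_zero] at h2
    rw [← h2]
    ring
  refine ⟨D, ⟨?_, hL, ?_, ?_, ?_⟩, hpU⟩
  · intro q hq i
    fin_cases i
    · change conjVec ((1 / 2 : ℂ) • (fieldS L q + conjVec (fieldS L q)))
        = (1 / 2 : ℂ) • (fieldS L q + conjVec (fieldS L q))
      rw [conjVec_smul, map_add, conjVec_conjVec, add_comm]
      simp [map_ofNat]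
    · exact conjVec_fieldT (hLq q hq)
    · rfl
    · exact conjVec_conjVec (L q)
  · intro q hq k
    have h := k1 q hq k
    rw [fieldT, map_smul, smul_eq_mul] at h
    change -D.θ q k (bracket L (bar L) q) = _
    have h3 : D.θ q k (bracket L (bar L) q) = -(Complex.I * if k = 1 then 1 else 0) := by
      rw [← h, ← mul_assoc, Complex.I_mul_I]; ring
    rw [h3]
    split_ifs <;> simp
  · intro q hq
    rw [← hθS, ← hS q hq (D.θ q 0) (by simp [k2 q hq]) (by simp [k3 q hq]) (by simp [k1 q hq])]
    have h1 := hsum q hq 0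
    rw [← hθS, ← hθS' 0 q hq, ← hS q hq (D.θ q 0) (by simp [k2 q hq]) (by simp [k3 q hq])
      (by simp [k1 q hq]), if_pos rfl] at h1
    change D.θ q 0 (conjVec (fieldS L q)) + D.θ q 0 (conjVec (fieldS L q)) = 2 at h1
    linear_combination h1 / 2
  · intro q hq
    have h1 := hsum q hq 1
    rw [if_neg (by decide)] at h1
    linear_combination h1

namespace IsPrereduced

variable {D : LocalCoframe M} {p : M} (h : D.IsPrereduced 𝓛)

include h

theorem tor_013 (hp : p ∈ D.U) : D.tor 0 1 3 p = 1 := by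
  have h1 := h.real.conj_tor hp 0 1 2
  rw [h.tor_012 p hp, map_one] at h1
  exact h1.symm

/-- With C = T^σ_{σζ̄}, the σ-component of the Jacobi identity gives T^ρ_{ρζ} in terms of C. This is
what makes the shear parameter P of the reduction real. -/
theorem jacobi_123 (hp : p ∈ D.U) :
    conj (D.tor 0 0 3 p) - D.tor 0 0 3 p - 2 * D.tor 1 1 2 p = 0 := by
  have hc : ∀ i j, (∀ q ∈ D.U, D.tor 0 i j q = D.tor 0 i j p) → cderiv (D.tor 0 i j) p = 0 := by
    intro i j hij
    rw [cderiv_congr ((D.eventually_mem hp).mono hij), cderiv_const]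
  have hj := D.jacobi_tor hp 0 1 2 3
    (hc 2 3 fun q hq => by rw [h.tor_23 q hq, h.tor_23 p hp])
    (hc 3 1 fun q hq => by rw [D.tor_swap, D.tor_swap 0 3 1 p, h.tor_013 hq, h.tor_013 hp])
    (hc 1 2 fun q hq => by rw [h.tor_012 q hq, h.tor_012 p hp])
  have hC : conj (D.tor 0 0 3 p) = D.tor 0 0 2 p := h.real.conj_tor hp 0 0 3
  simp only [Fin.sum_univ_four, D.tor_self, D.tor_swap 0 1 0, D.tor_swap 0 2 0, D.tor_swap 0 3 0,
    D.tor_swap 0 2 1, D.tor_swap 0 3 1, D.tor_swap 1 3 1, D.tor_swap 0 3 2, h.tor_23 p hp,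
    h.tor_012 p hp, h.tor_013 hp, h.tor_113 p hp] at hj
  rw [hC]
  simp at hj
  linear_combination hj

end IsPrereduced

/-- A real frame with the normalized torsion whose third vector field generates the CR bundle is
adapted to the CR structure. -/
theorem IsRealFrame.isAdapted {D : LocalCoframe M} {p : M} (h : D.IsRealFrame) (h𝓛 : 𝓛.IsClassII)
    (hgen : 𝓛.IsGenerator (D.e 2) D.U) (h023 : ∀ q ∈ D.U, D.tor 0 2 3 q = 0)
    (h123 : D.tor 1 2 3 p = Complex.I) (h012 : D.tor 0 1 2 p = 1) (hp : p ∈ D.U) :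
    IsAdapted 𝓛 (D.θ p) := by
  have hbar : ∀ q ∈ D.U, ∀ᶠ r in nhds q, bar (D.e 2) r = D.e 3 r := fun q hq =>
    (D.eventually_mem hq).mono fun r hr => h r hr 2
  have hT : ∀ q ∈ D.U, ∀ k, D.θ q k (fieldT (D.e 2) q) = -(Complex.I * D.tor k 2 3 q) := by
    intro q hq k
    rw [fieldT, bracket_congr (Filter.Eventually.of_forall fun _ => rfl) (hbar q hq), map_smul,
      tor, smul_eq_mul]
    ring
  have hT1 : D.θ p 1 (fieldT (D.e 2) p) = 1 := by
    rw [hT p hp, h123, Complex.I_mul_I, neg_neg]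
  have hT0 : ∀ q ∈ D.U, D.θ q 0 (fieldT (D.e 2) q) = 0 := by
    intro q hq
    rw [hT q hq, h023 q hq, mul_zero, neg_zero]
  have hS : D.θ p 0 (fieldS (D.e 2) p) = 1 := by
    have e1 : (fun q => D.θ q 0 (fieldT (D.e 2) q)) =ᶠ[nhds p] fun _ => 0 :=
      (D.eventually_mem hp).mono hT0
    rw [fieldS, D.form_bracket hp (D.smoothAt_e hp 2) (SmoothAt_fieldT (D.smoothAt_e hp 2)),
      cderiv_congr e1, D.cderiv_θ_e hp, cderiv_const]
    simp only [Fin.sum_univ_four, D.θ_e hp, hT0 p hp, hT1, h023 p hp, D.tor_swap 0 2 1, h012,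
      D.tor_self]
    simp
  obtain ⟨ω₀, hω⟩ := IsDual.of_linearIndependent (hgen.linearIndependent_frame h𝓛 hp)
  have w0 : ∀ i, ω₀ i (fieldS (D.e 2) p) = if i = 0 then 1 else 0 := fun i => hω i 0
  have w1 : ∀ i, ω₀ i (fieldT (D.e 2) p) = if i = 1 then 1 else 0 := fun i => hω i 1
  have w2 : ∀ i, ω₀ i (D.e 2 p) = if i = 2 then 1 else 0 := fun i => hω i 2
  have w3 : ∀ i, ω₀ i (bar (D.e 2) p) = if i = 3 then 1 else 0 := fun i => hω i 3
  have hb : bar (D.e 2) p = D.e 3 p := h p hp 2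
  have ext : ∀ φ ψ : ℂ ⊗[ℝ] TangentSpace (𝓡 4) p →ₗ[ℂ] ℂ,
      φ (fieldS (D.e 2) p) = ψ (fieldS (D.e 2) p) → φ (fieldT (D.e 2) p) = ψ (fieldT (D.e 2) p) →
      φ (D.e 2 p) = ψ (D.e 2 p) → φ (bar (D.e 2) p) = ψ (bar (D.e 2) p) → φ = ψ := by
    intro φ ψ g0 g1 g2 g3
    refine hω.form_ext fun i => ?_
    fin_cases i
    exacts [g0, g1, g2, g3]
  -- The generator e_ζ itself serves, with a = 1; b, c, d are the values of ζ and ρ on its fields T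
  -- and S.
  refine ⟨fun v => ?_, D.U, D.e 2, ω₀, 1, D.θ p 2 (fieldT (D.e 2) p), D.θ p 1 (fieldS (D.e 2) p),
    D.θ p 2 (fieldS (D.e 2) p), hp, hgen, hω, one_ne_zero, ?_, ?_, ?_⟩
  · rw [h.conj_θ hp, conjVec_conjVec]
    rfl
  · apply ext
    · simp [hS, w0]
    · simp [hT0 p hp, w1]
    · simp [D.θ_e hp, w2]
    · simp [hb ▸ w3 0, hb, D.θ_e hp]
  · apply ext
    · simp [w0]
    · simp [hT1, w1]
    · simp [D.θ_e hp, w2]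
    · have a0 := w3 0
      have a1 := w3 1
      rw [hb] at a0 a1
      simp [hb, D.θ_e hp, a0, a1]
  · apply ext
    · simp [w0]
    · simp [w1]
    · simp [D.θ_e hp, w2]
    · have a0 := w3 0
      have a1 := w3 1
      have a2 := w3 2
      rw [hb] at a0 a1 a2
      simp [hb, D.θ_e hp, a0, a1, a2]

/-- The frame `(e₀ + P e₁ + q e₂ + q̄ e₃, e₁ + b e₂ + b̄ e₃, e₂, e₃)`. -/
def shearFrame (D : LocalCoframe M) (P q b : M → ℂ) : Fin 4 → CVectorField M :=
  ![fun r => D.e 0 r + P r • D.e 1 r + q r • D.e 2 r + conj (q r) • D.e 3 r,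
    fun r => D.e 1 r + b r • D.e 2 r + conj (b r) • D.e 3 r, D.e 2, D.e 3]

/-- The matrix of `shearFrame`. -/
def shearMatrix (P q b : M → ℂ) (r : M) : Matrix (Fin 4) (Fin 4) ℂ :=
  ![![1, 0, 0, 0], ![P r, 1, 0, 0], ![q r, b r, 1, 0], ![conj (q r), conj (b r), 0, 1]]

theorem θ_shearFrame (D : LocalCoframe M) (P q b : M → ℂ) {r : M} (hr : r ∈ D.U) (k i : Fin 4) :
    D.θ r k (shearFrame D P q b i r) = shearMatrix P q b r k i := by
  fin_cases i <;> fin_cases k <;> simp [shearFrame, shearMatrix, D.θ_e hr]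

/-- The local coframe of `shearFrame`. -/
def shear (D : LocalCoframe M) (P q b : M → ℂ) (hP : ∀ r ∈ D.U, SmoothFunAt P r)
    (hq : ∀ r ∈ D.U, SmoothFunAt q r) (hb : ∀ r ∈ D.U, SmoothFunAt b r) : LocalCoframe M :=
  ofFrame D.U (shearFrame D P q b)
    (fun i => smoothOn_iff.2 fun r hr => by
      have s := fun j => D.smoothAt_e hr j
      fin_cases i
      · exact (((s 0).add (SmoothAt.smul (hP r hr) (s 1))).add
          (SmoothAt.smul (hq r hr) (s 2))).add (SmoothAt.smul (hq r hr).conj (s 3))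
      · exact ((s 1).add (SmoothAt.smul (hb r hr) (s 2))).add (SmoothAt.smul (hb r hr).conj (s 3))
      · exact s 2
      · exact s 3)
    (fun r hr => by
      rw [Fintype.linearIndependent_iff]
      intro g hg
      have key : ∀ k, ∑ i, g i * shearMatrix P q b r k i = 0 := fun k => by
        simpa [θ_shearFrame D P q b hr] using congrArg (D.θ r k) hg
      have h0 : g 0 = 0 := by simpa [Fin.sum_univ_four, shearMatrix] using key 0
      have h1 : g 1 = 0 := by simpa [Fin.sum_univ_four, shearMatrix, h0] using key 1
      have h2 : g 2 = 0 := by simpa [Fin.sum_univ_four, shearMatrix, h0, h1] using key 2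
      have h3 : g 3 = 0 := by simpa [Fin.sum_univ_four, shearMatrix, h0, h1] using key 3
      intro i
      fin_cases i <;> assumption)

/-- A real shear of the frame keeps e_ζ and the values of T^σ_{ζζ̄}, T^ρ_{ζζ̄}, T^σ_{ρζ̄}. It gives
T^σ_{σζ̄} = C + P, T^ζ_{ζζ̄} = -ib and T^ρ_{ρζ̄} = -T^ρ_{ρζ} + ib - P, the right sides referring to
the old frame. The normalizations can therefore be solved for P and b, and then for q. -/
theorem IsPrereduced.exists_isReduced {D : LocalCoframe M} (h : D.IsPrereduced 𝓛)
    (h𝓛 : 𝓛.IsClassII) : ∃ D' : LocalCoframe M, D'.IsReduced 𝓛 ∧ D'.U = D.U := by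
  let C : M → ℂ := D.tor 0 0 3
  -- The two conditions of P³ are compatible exactly if C + 2P + T^ρ_{ρζ} = 0; by the Jacobi
  -- identity the solution is minus half the real part of C, so the new e_σ stays real.
  let P : M → ℂ := fun r => (-1 / 4 : ℂ) * (C r + conj (C r))
  -- Solves -ib = (C + P) / 3.
  let b : M → ℂ := fun r => (Complex.I / 3) * (C r + P r)
  -- Solves T^ρ_{σζ̄} = 0, which is linear in q with coefficient T^ρ_{ζζ̄} = i once P is known.
  let q : M → ℂ := fun r => -Complex.I * ((C r + P r) * P r - cderiv P r (D.e 3 r)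
    - D.tor 1 0 3 r - P r * D.tor 1 1 3 r)
  have sC : ∀ r ∈ D.U, SmoothFunAt C r := fun r hr => D.smoothFunAt_tor hr 0 0 3
  have sP : ∀ r ∈ D.U, SmoothFunAt P r := fun r hr =>
    (smoothFunAt_const _).mul ((sC r hr).add (sC r hr).conj)
  have sb : ∀ r ∈ D.U, SmoothFunAt b r := fun r hr =>
    (smoothFunAt_const _).mul ((sC r hr).add (sP r hr))
  have sq : ∀ r ∈ D.U, SmoothFunAt q r := fun r hr =>
    (smoothFunAt_const _).mul (((((sC r hr).add (sP r hr)).mul (sP r hr)).sub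
      (smoothFunAt_cderiv sP hr (D.smoothAt_e hr 3))).sub (D.smoothFunAt_tor hr 1 0 3) |>.sub
        ((sP r hr).mul (D.smoothFunAt_tor hr 1 1 3)))
  let D' : LocalCoframe M := D.shear P q b sP sq sb
  have hm : ∀ r ∈ D.U, ∀ k i, D.θ r k (D'.e i r) = shearMatrix P q b r k i :=
    fun r hr k i => D.θ_shearFrame P q b hr k i
  have hPr : ∀ r, conj (P r) = P r := by
    intro r
    simp only [P, map_mul, map_add, Complex.conj_conj, map_div₀, map_neg, map_one, map_ofNat]
    ring
  have hreal : D'.IsRealFrame := by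
    intro r hr i
    have hc : ∀ i, conjVec (D.e i r) = D.e (conjIdx i) r := h.real r hr
    fin_cases i
    · change conjVec (D.e 0 r + P r • D.e 1 r + q r • D.e 2 r + conj (q r) • D.e 3 r)
        = D.e 0 r + P r • D.e 1 r + q r • D.e 2 r + conj (q r) • D.e 3 r
      simp only [map_add, conjVec_smul, hc, conjIdx, hPr, Complex.conj_conj]
      exact add_right_comm _ _ _
    · change conjVec (D.e 1 r + b r • D.e 2 r + conj (b r) • D.e 3 r)
        = D.e 1 r + b r • D.e 2 r + conj (b r) • D.e 3 r
      simp only [map_add, conjVec_smul, hc, conjIdx, Complex.conj_conj]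
      exact add_right_comm _ _ _
    · exact hc 2
    · exact hc 3
  have hev : ∀ r ∈ D.U, ∀ k i, cderiv (fun s => D.θ s k (D'.e i s)) r
      = cderiv (fun s => shearMatrix P q b s k i) r := fun r hr k i =>
    cderiv_congr ((D.eventually_mem hr).mono fun s hs => hm s hs k i)
  have hchange : ∀ r ∈ D.U, ∀ k i j, ∑ l, D'.tor l i j r * shearMatrix P q b r k l =
      cderiv (fun s => shearMatrix P q b s k i) r (D'.e j r)
      - cderiv (fun s => shearMatrix P q b s k j) r (D'.e i r)
      + ∑ a, ∑ c, D.tor k a c r * (shearMatrix P q b r a i * shearMatrix P q b r c j) := by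
    intro r hr k i j
    have := tor_change (D := D) (D' := D') hr hr k i j
    simpa only [hm r hr, hev r hr] using this
  have hC : ∀ r ∈ D.U, C r + 2 * P r + D.tor 1 1 2 r = 0 := by
    intro r hr
    have := h.jacobi_123 hr
    simp only [P]
    linear_combination (-1 / 2 : ℂ) * this
  have t023 : ∀ r ∈ D.U, D'.tor 0 2 3 r = 0 := by
    intro r hr
    have := hchange r hr 0 2 3
    simpa [Fin.sum_univ_four, shearMatrix, h.tor_23 r hr, cderiv_const] using this
  have t123 : ∀ r ∈ D.U, D'.tor 1 2 3 r = Complex.I := by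
    intro r hr
    have := hchange r hr 1 2 3
    simpa [Fin.sum_univ_four, shearMatrix, h.tor_23 r hr, cderiv_const, t023 r hr] using this
  have t223 : ∀ r ∈ D.U, D'.tor 2 2 3 r = -(Complex.I * b r) := by
    intro r hr
    have := hchange r hr 2 2 3
    simp [Fin.sum_univ_four, shearMatrix, h.tor_23 r hr, cderiv_const, t023 r hr, t123 r hr] at this
    linear_combination this
  have t013 : ∀ r ∈ D.U, D'.tor 0 1 3 r = 1 := by
    intro r hr
    have := hchange r hr 0 1 3
    simpa [Fin.sum_univ_four, shearMatrix, h.tor_23 r hr, cderiv_const, h.tor_013 hr,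
      D.tor_self] using this
  have t113 : ∀ r ∈ D.U, D'.tor 1 1 3 r = -D.tor 1 1 2 r + Complex.I * b r - P r := by
    intro r hr
    have := hchange r hr 1 1 3
    simp [Fin.sum_univ_four, shearMatrix, h.tor_23 r hr, cderiv_const, h.tor_113 r hr,
      D.tor_self, t013 r hr] at this
    linear_combination this
  have t003 : ∀ r ∈ D.U, D'.tor 0 0 3 r = C r + P r := by
    intro r hr
    have := hchange r hr 0 0 3
    simp [Fin.sum_univ_four, shearMatrix, h.tor_23 r hr, cderiv_const, h.tor_013 hr,
      D.tor_self] at this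
    linear_combination this
  have t103 : ∀ r ∈ D.U, D'.tor 1 0 3 r = 0 := by
    intro r hr
    have := hchange r hr 1 0 3
    have e3 : D'.e 3 r = D.e 3 r := rfl
    simp [Fin.sum_univ_four, shearMatrix, h.tor_23 r hr, cderiv_const, e3,
      D.tor_self, t003 r hr] at this
    simp only [q] at this
    linear_combination this - ((C r + P r) * P r - cderiv P r (D.e 3 r) - D.tor 1 0 3 r
      - P r * D.tor 1 1 3 r) * Complex.I_sq
  -- In a real frame the conditions on the ζ coefficients are conjugate to those on the ζ̄
  -- coefficients.
  have t012 : ∀ r ∈ D.U, D'.tor 0 1 2 r = 1 := by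
    intro r hr
    have := hreal.conj_tor (p := r) hr 0 1 3
    rw [t013 r hr, map_one] at this
    exact this.symm
  have t102 : ∀ r ∈ D.U, D'.tor 1 0 2 r = 0 := by
    intro r hr
    have := hreal.conj_tor (p := r) hr 1 0 3
    rw [t103 r hr, map_zero] at this
    exact this.symm
  refine ⟨D', ⟨fun r hr => hreal.isAdapted h𝓛 h.generator t023 (t123 r hr) (t012 r hr) hr, t013,
    fun r hr => ⟨?_, ?_⟩, fun r hr => ⟨t102 r hr, t103 r hr⟩⟩, rfl⟩
  · rw [t223 r hr, t113 r hr]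
    simp only [b]
    linear_combination (1 / 2 : ℂ) * hC r hr - (C r + P r) / 2 * Complex.I_sq
  · rw [t223 r hr, t003 r hr]
    simp only [b]
    linear_combination (-(C r + P r) / 3) * Complex.I_sq

theorem exists_isReduced (h𝓛 : 𝓛.IsClassII) (p : M) :
    ∃ D : LocalCoframe M, D.IsReduced 𝓛 ∧ p ∈ D.U := by
  obtain ⟨D, h, hp⟩ := exists_isPrereduced h𝓛 p
  obtain ⟨D', h', hU⟩ := h.exists_isReduced h𝓛
  exact ⟨D', h', hU ▸ hp⟩

end LocalCoframe

end ExistenceOfSections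

/-! ### The model group acting on the cubic. -/

theorem two_le_infty : (2 : ℕ∞ω) ≤ ∞ :=
  WithTop.coe_le_coe.2 (le_top : (2 : ℕ∞) ≤ ⊤)

theorem mem_cubic {x : ℂ × ℂ × ℂ} : x ∈ cubic ↔ x.2.1.im = x.1.re ^ 2 + x.1.im ^ 2 ∧
    x.2.2.im = 2 * x.1.re * (x.1.re ^ 2 + x.1.im ^ 2) := by
  rw [cubic, mem_ofPred_eq, Complex.ext_iff, Complex.ext_iff]
  simp
  refine and_congr ⟨fun h => ?_, fun h => ⟨?_, ?_⟩⟩ ⟨fun h => ?_, fun h => ⟨?_, ?_⟩⟩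
  · linear_combination h.2 / 2
  · ring
  · linear_combination 2 * h
  · linear_combination h.2 / 2
  · left; ring
  · linear_combination 2 * h

namespace CubicGroup

theorem mul_act (g h : CubicGroup) (x : ℂ × ℂ × ℂ) : (g * h).act x = g.act (h.act x) := by
  obtain ⟨a, s, r, w⟩ := g
  obtain ⟨a', s', r', w'⟩ := h
  change act (mul (a, s, r, w) (a', s', r', w')) x = _
  have h1 := a.ne_zero
  have h2 := a'.ne_zero
  refine Prod.ext (Complex.ext ?_ ?_) (Prod.ext (Complex.ext ?_ ?_) (Complex.ext ?_ ?_)) <;>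
    simp [mul, act, Complex.normSq_apply, pow_succ, ← Complex.ofReal_inv] <;> ring

theorem act_mem_cubic (g : CubicGroup) {x : ℂ × ℂ × ℂ} (hx : x ∈ cubic) : g.act x ∈ cubic := by
  rw [mem_cubic] at hx ⊢
  obtain ⟨a, s, r, w⟩ := g
  obtain ⟨z, w₁, w₂⟩ := x
  simp only at hx
  simp [act, pow_succ, ← Complex.ofReal_inv, hx]
  constructor <;> ring

theorem act_zero (g : CubicGroup) : g.act 0 = (g.2.2.2,
    Complex.I * (g.2.2.2 * conj g.2.2.2) + 2 * (g.2.2.1 : ℂ),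
    2 * Complex.I * (g.2.2.2 * conj g.2.2.2) * (g.2.2.2.re : ℂ) + 4 * (g.2.1 : ℂ)) := by
  simp [act]

/-- A point of the cubic is determined by z, Re w₁ and Re w₂, and the elements with a = 1 carry the
origin to the point with these parameters w, 2r, 4s. -/
theorem exists_act_zero {x : ℂ × ℂ × ℂ} (hx : x ∈ cubic) : ∃ g : CubicGroup, g.act 0 = x := by
  rw [mem_cubic] at hx
  refine ⟨(1, (x.2.2.re / 4, x.2.1.re / 2, x.1)), (act_zero _).trans ?_⟩
  refine Prod.ext rfl (Prod.ext (Complex.ext ?_ ?_) (Complex.ext ?_ ?_))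
  · simp; ring
  · simp [hx]; ring
  · simp; ring
  · simp [hx]; ring

theorem exists_act_eq {x y : ℂ × ℂ × ℂ} (hx : x ∈ cubic) (hy : y ∈ cubic) :
    ∃ g : CubicGroup, g.act x = y := by
  obtain ⟨g, rfl⟩ := exists_act_zero hx
  obtain ⟨h, rfl⟩ := exists_act_zero hy
  refine ⟨h * g⁻¹, ?_⟩
  rw [← mul_act, inv_mul_cancel_right]

theorem act_zero_eq_zero {g : CubicGroup} : g.act 0 = 0 ↔ g ∈ range incl := by
  constructor
  · intro h
    rw [act_zero] at h
    have hw : g.2.2.2 = 0 := congrArg Prod.fst h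
    have hr := congrArg (fun x : ℂ × ℂ × ℂ => x.2.1) h
    have hs := congrArg (fun x : ℂ × ℂ × ℂ => x.2.2) h
    simp [hw] at hr hs
    exact ⟨g.1, Prod.ext rfl (Prod.ext hs.symm (Prod.ext hr.symm hw.symm))⟩
  · rintro ⟨a, rfl⟩
    rw [act_zero]
    change ((0 : ℂ), Complex.I * (0 * conj (0 : ℂ)) + 2 * ((0 : ℝ) : ℂ),
      2 * Complex.I * (0 * conj (0 : ℂ)) * ((0 : ℂ).re : ℂ) + 4 * ((0 : ℝ) : ℂ)) = 0
    simp

theorem eq_one_of_act {g : CubicGroup} (h : ∀ x ∈ cubic, g.act x = x) : g = 1 := by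
  obtain ⟨a, rfl⟩ := act_zero_eq_zero.1 (h 0 (by simp [mem_cubic]))
  -- An element fixing the origin lies in the isotropy group; one further point of the cubic with z
  -- ≠ 0 determines a.
  have h1 := congrArg Prod.fst (h (1, Complex.I, 2 * Complex.I) (by simp [mem_cubic]))
  change ((a : ℝ)⁻¹ : ℂ) * 1 + 0 = 1 at h1
  rw [mul_one, add_zero] at h1
  have h2 : (a : ℝ)⁻¹ = 1 := by exact_mod_cast h1
  have h3 : a = 1 := Units.ext (inv_eq_one.1 h2)
  rw [h3, map_one]

/-! ### The Lie algebra of the model, computed in the coordinates (a, s, r, w). -/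

theorem _root_.hasMFDerivAt_units_val (a : ℝˣ) :
    HasMFDerivAt 𝓘(ℝ, ℝ) 𝓘(ℝ, ℝ) (Units.val : ℝˣ → ℝ) a (ContinuousLinearMap.id ℝ ℝ) := by
  refine ⟨Units.continuous_val.continuousAt, ?_⟩
  refine ((hasFDerivAt_id (𝕜 := ℝ) (a : ℝ)).congr_of_eventuallyEq ?_).hasFDerivWithinAt
  have h := (chartAt ℝ a).open_target.mem_nhds (mem_chart_target ℝ a)
  filter_upwards [h] with y hy
  exact (chartAt ℝ a).right_inv hy

/-- The global coordinates `(a, s, r, w)`. -/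
def coord (g : CubicGroup) : ℝ × ℝ × ℝ × ℂ := ((g.1 : ℝ), g.2)

/-- Tangent spaces of the group are identified with ℝ × ℝ × ℝ × ℂ through the same coordinates, so
passing to `coord` changes no tangent vector. -/
theorem hasMFDerivAt_coord (g : CubicGroup) :
    HasMFDerivAt model 𝓘(ℝ, ℝ × ℝ × ℝ × ℂ) coord g (ContinuousLinearMap.id ℝ (ℝ × ℝ × ℝ × ℂ)) := by
  have h1 : HasMFDerivAt model 𝓘(ℝ, ℝ) (fun g : CubicGroup => (g.1 : ℝ)) g
      (ContinuousLinearMap.fst ℝ ℝ (ℝ × ℝ × ℂ)) :=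
    (hasMFDerivAt_units_val g.1).comp g (hasMFDerivAt_fst (M := ℝˣ) (M' := ℝ × ℝ × ℂ) g)
  have h2 : HasMFDerivAt model 𝓘(ℝ, ℝ × ℝ × ℂ) (fun g : CubicGroup => g.2) g
      (ContinuousLinearMap.snd ℝ ℝ (ℝ × ℝ × ℂ)) := hasMFDerivAt_snd (M := ℝˣ) (M' := ℝ × ℝ × ℂ) g
  exact ⟨h1.1.prodMk h2.1, h1.2.prodMk h2.2⟩

theorem contMDiff_coord : ContMDiff model 𝓘(ℝ, ℝ × ℝ × ℝ × ℂ) ∞ coord :=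
  contMDiff_coe.prodMk_space contMDiff_tail

/-- The left invariant vector field with value `v` at the identity, in coordinates. -/
def leftField (v y : ℝ × ℝ × ℝ × ℂ) : ℝ × ℝ × ℝ × ℂ :=
  (y.1 * v.1,
    y.1⁻¹ ^ 3 * v.2.1 + 2 * y.1⁻¹ ^ 2 * Complex.reCLM y.2.2.2 * v.2.2.1
      - y.1⁻¹ * (Complex.reCLM y.2.2.2 * Complex.imCLM (Complex.conjCLE y.2.2.2 * v.2.2.2)
        + (Complex.reCLM y.2.2.2 * Complex.reCLM y.2.2.2
          + Complex.imCLM y.2.2.2 * Complex.imCLM y.2.2.2) * Complex.imCLM v.2.2.2 / 2),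
    y.1⁻¹ ^ 2 * v.2.2.1 - y.1⁻¹ * Complex.imCLM (Complex.conjCLE y.2.2.2 * v.2.2.2),
    Complex.ofRealCLM y.1⁻¹ * v.2.2.2)

theorem contDiffAt_leftField (v : ℝ × ℝ × ℝ × ℂ) {y : ℝ × ℝ × ℝ × ℂ} (hy : y.1 ≠ 0) :
    ContDiffAt ℝ 1 (leftField v) y := by
  unfold leftField
  fun_prop (disch := assumption)

/-- Left translation in coordinates. -/
def leftMul (g : CubicGroup) (y : ℝ × ℝ × ℝ × ℂ) : ℝ × ℝ × ℝ × ℂ :=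
  ((g.1 : ℝ) * y.1,
    g.2.1 + (g.1 : ℝ)⁻¹ ^ 3 * y.2.1 + 2 * (g.1 : ℝ)⁻¹ ^ 2 * g.2.2.2.re * y.2.2.1
        - (g.1 : ℝ)⁻¹ ^ 2 * Complex.imCLM (conj g.2.2.2 * y.2.2.2 ^ 2) / 2
        - (g.1 : ℝ)⁻¹ * (g.2.2.2.re * Complex.imCLM (conj g.2.2.2 * y.2.2.2)
            + Complex.normSq g.2.2.2 * Complex.imCLM y.2.2.2 / 2),
      g.2.2.1 + (g.1 : ℝ)⁻¹ ^ 2 * y.2.2.1 - (g.1 : ℝ)⁻¹ * Complex.imCLM (conj g.2.2.2 * y.2.2.2),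
      g.2.2.2 + ((g.1 : ℝ)⁻¹ : ℂ) * y.2.2.2)

theorem differentiable_leftMul (g : CubicGroup) : Differentiable ℝ (leftMul g) := by
  unfold leftMul
  fun_prop

theorem hasDerivAt_line (y v : ℝ × ℝ × ℝ × ℂ) : HasDerivAt (fun t : ℝ => y + t • v) v 0 := by
  simpa using ((hasDerivAt_id (0 : ℝ)).smul_const v).const_add y

theorem hasDerivAt_of_eq_quadratic {f : ℝ → ℝ × ℝ × ℝ × ℂ} {c v q : ℝ × ℝ × ℝ × ℂ}
    (h : ∀ t, f t = c + t • v + t ^ 2 • q) : HasDerivAt f v 0 := by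
  have h1 : HasDerivAt (fun t : ℝ => c + t • v + t ^ 2 • q) v 0 := by
    simpa using! (((hasDerivAt_id (0 : ℝ)).smul_const v).const_add c).add
      ((hasDerivAt_pow 2 (0 : ℝ)).smul_const q)
  rwa [← funext h] at h1

theorem fderiv_leftMul (g : CubicGroup) (v : ℝ × ℝ × ℝ × ℂ) :
    fderiv ℝ (leftMul g) (1, 0, 0, 0) v = leftField v (coord g) := by
  have h0 : ((1, 0, 0, 0) : ℝ × ℝ × ℝ × ℂ) = (1, 0, 0, 0) + (0 : ℝ) • v := by simp
  have h1 : HasFDerivAt (leftMul g) (fderiv ℝ (leftMul g) (1, 0, 0, 0))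
      ((1, 0, 0, 0) + (0 : ℝ) • v) := by
    rw [← h0]; exact (differentiable_leftMul g _).hasFDerivAt
  have h2 := h1.comp_hasDerivAt (0 : ℝ) (hasDerivAt_line (1, 0, 0, 0) v)
  -- Left translation is quadratic along a line through the identity. The only quadratic term comes
  -- from the square of the w-coordinate, and it does not contribute to the derivative.
  refine h2.unique (hasDerivAt_of_eq_quadratic (c := coord g)
    (q := (0, - (g.1 : ℝ)⁻¹ ^ 2 * Complex.imCLM (conj g.2.2.2 * v.2.2.2 ^ 2) / 2, 0, 0)) fun t => ?_)
  obtain ⟨x, s, r, z⟩ := v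
  obtain ⟨a, s', r', w⟩ := g
  refine Prod.ext ?_ (Prod.ext ?_ (Prod.ext ?_ (Complex.ext ?_ ?_))) <;>
    simp [leftMul, leftField, coord, pow_succ, ← Complex.ofReal_inv,
      Complex.normSq_apply] <;> ring

theorem mulInvariantVectorField_eq (v : ℝ × ℝ × ℝ × ℂ) (g : CubicGroup) :
    (mulInvariantVectorField (vec v) g : ℝ × ℝ × ℝ × ℂ) = leftField v (coord g) := by
  have h1 : HasMFDerivAt model model (fun h : CubicGroup => g * h) 1
      (mfderiv model model (fun h : CubicGroup => g * h) 1) :=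
    ((contMDiff_mul_left (I := model) (n := ∞) (a := g)).contMDiffAt.mdifferentiableAt
      (by simp)).hasMFDerivAt
  have h2 := (hasMFDerivAt_coord (g * 1)).comp (1 : CubicGroup) h1
  have h3 : HasMFDerivAt 𝓘(ℝ, ℝ × ℝ × ℝ × ℂ) 𝓘(ℝ, ℝ × ℝ × ℝ × ℂ) (leftMul g)
      (coord (1 : CubicGroup)) (fderiv ℝ (leftMul g) (1, 0, 0, 0)) :=
    (differentiable_leftMul g (1, 0, 0, 0)).hasFDerivAt.hasMFDerivAt
  have h4 := h3.comp (1 : CubicGroup) (hasMFDerivAt_coord 1)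
  -- Definitionally, `coord` after left translation by g is `leftMul g` after `coord`.
  have h5 : HasMFDerivAt model 𝓘(ℝ, ℝ × ℝ × ℝ × ℂ) (coord ∘ fun h : CubicGroup => g * h) 1 _ := h4
  have h6 := hasMFDerivAt_unique h2 h5
  exact (congrArg (fun L : (ℝ × ℝ × ℝ × ℂ) →L[ℝ] (ℝ × ℝ × ℝ × ℂ) => L v) h6).trans
    (fderiv_leftMul g v)

theorem hasDerivAt_leftField (v v' : ℝ × ℝ × ℝ × ℂ) :
    HasDerivAt (fun t : ℝ => leftField v' ((1, 0, 0, 0) + t • v))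
      (v.1 * v'.1, -3 * v.1 * v'.2.1 + 2 * v.2.2.2.re * v'.2.2.1,
        -2 * v.1 * v'.2.2.1 - (conj v.2.2.2 * v'.2.2.2).im, -(v.1 : ℂ) * v'.2.2.2) 0 := by
  obtain ⟨x, s, r, z⟩ := v
  obtain ⟨x', s', r', z'⟩ := v'
  have ha : HasDerivAt (fun t : ℝ => 1 + t * x) x 0 := by
    simpa using ((hasDerivAt_id (0 : ℝ)).mul_const x).const_add 1
  have hk : HasDerivAt (fun t : ℝ => (1 + t * x)⁻¹) (-x) 0 := by
    simpa using! ha.inv (by simp)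
  have ht := hasDerivAt_id (0 : ℝ)
  have h1 := ha.mul_const x'
  have h2 := (((hk.pow 3).mul_const s').add ((((hk.pow 2).mul ht).mul_const (2 * z.re * r')))).sub
    ((hk.mul (ht.mul ht)).mul_const
      (z.re * (conj z * z').im + (z.re * z.re + z.im * z.im) * z'.im / 2))
  have h3 := ((hk.pow 2).mul_const r').sub ((hk.mul ht).mul_const (conj z * z').im)
  have h4 := hk.ofReal_comp.mul_const z'
  have h := h1.prodMk (h2.prodMk (h3.prodMk h4))
  refine (h.congr_deriv ?_).congr_of_eventuallyEq (Filter.Eventually.of_forall fun t => ?_)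
  · refine Prod.ext ?_ (Prod.ext ?_ (Prod.ext ?_ ?_)) <;> simp
  · refine Prod.ext ?_ (Prod.ext ?_ (Prod.ext ?_ ?_))
    · simp [leftField]
    · simp [leftField]
      ring
    · simp [leftField]
      ring
    · simp [leftField]

theorem fderiv_leftField (v v' : ℝ × ℝ × ℝ × ℂ) :
    fderiv ℝ (leftField v') (1, 0, 0, 0) v
      = (v.1 * v'.1, -3 * v.1 * v'.2.1 + 2 * v.2.2.2.re * v'.2.2.1,
        -2 * v.1 * v'.2.2.1 - (conj v.2.2.2 * v'.2.2.2).im, -(v.1 : ℂ) * v'.2.2.2) := by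
  have h0 : ((1, 0, 0, 0) : ℝ × ℝ × ℝ × ℂ) = (1, 0, 0, 0) + (0 : ℝ) • v := by simp
  have h1 : HasFDerivAt (leftField v') (fderiv ℝ (leftField v') (1, 0, 0, 0))
      ((1, 0, 0, 0) + (0 : ℝ) • v) := by
    rw [← h0]; exact ((contDiffAt_leftField v' one_ne_zero).differentiableAt one_ne_zero).hasFDerivAt
  have h2 := h1.comp_hasDerivAt (0 : ℝ) (hasDerivAt_line (1, 0, 0, 0) v)
  exact h2.unique
    (hasDerivAt_leftField v v')

theorem leftField_one (v : ℝ × ℝ × ℝ × ℂ) : leftField v (1, 0, 0, 0) = v := by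
  simp [leftField]

theorem mulInvariantVectorField_eq_mpullback_leftField (v : ℝ × ℝ × ℝ × ℂ) :
    (mulInvariantVectorField (vec v) : ∀ g : CubicGroup, TangentSpace model g)
      = mpullback model 𝓘(ℝ, ℝ × ℝ × ℝ × ℂ) coord (leftField v) := by
  ext1 g
  refine (mulInvariantVectorField_eq v g).trans ?_
  change _ = (mfderiv model 𝓘(ℝ, ℝ × ℝ × ℝ × ℂ) coord g).inverse (leftField v (coord g))
  rw [(hasMFDerivAt_coord g).mfderiv]
  exact (congrArg (fun L : (ℝ × ℝ × ℝ × ℂ) →L[ℝ] (ℝ × ℝ × ℝ × ℂ) => L (leftField v (coord g)))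
    (ContinuousLinearMap.inverse_id (R := ℝ) (M := ℝ × ℝ × ℝ × ℂ))).symm

theorem _root_.mlieBracket_eq_lieBracket {E : Type*} [NormedAddCommGroup E] [NormedSpace ℝ E]
    (V W : ∀ x : E, TangentSpace 𝓘(ℝ, E) x) (x : E) :
    mlieBracket 𝓘(ℝ, E) V W x = lieBracket ℝ V W x := by
  rw [← mlieBracketWithin_univ, mlieBracketWithin_eq_lieBracketWithin]
  exact congrFun (lieBracketWithin_univ (𝕜 := ℝ) (V := (V : E → E)) (W := (W : E → E))) x

/-- Left invariant fields are pulled back from explicit fields on the coordinate space, where the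
bracket at the identity is the difference of the two directional derivatives. -/
theorem bracket_vec (v v' : ℝ × ℝ × ℝ × ℂ) : ⁅vec v, vec v'⁆ =
    vec (0, -3 * (v.1 * v'.2.1 - v'.1 * v.2.1)
        + 2 * (v.2.2.2.re * v'.2.2.1 - v'.2.2.2.re * v.2.2.1),
      -2 * (v.1 * v'.2.2.1 - v'.1 * v.2.2.1) - 2 * (conj v.2.2.2 * v'.2.2.2).im,
      -((v.1 : ℂ) * v'.2.2.2 - (v'.1 : ℂ) * v.2.2.2)) := by
  have hd : ∀ w : ℝ × ℝ × ℝ × ℂ, MDifferentiableAt 𝓘(ℝ, ℝ × ℝ × ℝ × ℂ)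
      (𝓘(ℝ, ℝ × ℝ × ℝ × ℂ)).tangent
      (fun y => (⟨y, leftField w y⟩ : TangentBundle 𝓘(ℝ, ℝ × ℝ × ℝ × ℂ) (ℝ × ℝ × ℝ × ℂ)))
      (coord (1 : CubicGroup)) := by
    intro w
    exact (contMDiffAt_vectorSpace_iff_contDiffAt.2
      (contDiffAt_leftField w (y := coord 1) one_ne_zero)).mdifferentiableAt one_ne_zero
  have : IsManifold model (minSmoothness ℝ 2) CubicGroup :=
    IsManifold.of_le (n := ∞) (by simpa using two_le_infty)
  have h1 := mulInvariantVectorField_eq_mpullback_leftField v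
  have h2 := mulInvariantVectorField_eq_mpullback_leftField v'
  have h3 := mpullback_mlieBracket (I := model) (n := ∞) (x₀ := (1 : CubicGroup)) (hd v) (hd v')
    contMDiff_coord.contMDiffAt (by simpa using two_le_infty)
  rw [GroupLieAlgebra.bracket_def, h1, h2, ← h3]
  change (mfderiv model 𝓘(ℝ, ℝ × ℝ × ℝ × ℂ) coord (1 : CubicGroup)).inverse
    (mlieBracket 𝓘(ℝ, ℝ × ℝ × ℝ × ℂ) (leftField v) (leftField v') (coord 1)) = _
  rw [(hasMFDerivAt_coord 1).mfderiv]
  refine (congrArg (fun L : (ℝ × ℝ × ℝ × ℂ) →L[ℝ] (ℝ × ℝ × ℝ × ℂ) =>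
    L (mlieBracket 𝓘(ℝ, ℝ × ℝ × ℝ × ℂ) (leftField v) (leftField v') (coord 1)))
    (ContinuousLinearMap.inverse_id (R := ℝ) (M := ℝ × ℝ × ℝ × ℂ))).trans ?_
  change mlieBracket 𝓘(ℝ, ℝ × ℝ × ℝ × ℂ) (leftField v) (leftField v') (1, 0, 0, 0) = _
  refine (mlieBracket_eq_lieBracket _ _ _).trans ?_
  refine (congrArg₂ (fun a b : ℝ × ℝ × ℝ × ℂ =>
    fderiv ℝ (leftField v') (1, 0, 0, 0) a - fderiv ℝ (leftField v) (1, 0, 0, 0) b)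
    (leftField_one v) (leftField_one v')).trans ?_
  rw [fderiv_leftField, fderiv_leftField]
  change _ = ((0, _) : ℝ × ℝ × ℝ × ℂ)
  refine Prod.ext ?_ (Prod.ext ?_ (Prod.ext ?_ ?_)) <;> simp <;> ring

/-- The vectors e_ζ, e_ζ̄ live in ℂ ⊗ 𝔤; their brackets are encoded by those of the real elements z
e_ζ + z̄ e_ζ̄ for all z, from which real bilinearity recovers them. -/
theorem brackets :
    ⁅vec (1, 0, 0, 0), vec (0, 1, 0, 0)⁆ = vec (0, -3, 0, 0) ∧
      ⁅vec (1, 0, 0, 0), vec (0, 0, 1, 0)⁆ = vec (0, 0, -2, 0) ∧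
      ⁅vec (0, 1, 0, 0), vec (0, 0, 1, 0)⁆ = 0 ∧
      ∀ z z' : ℂ,
        ⁅vec (1, 0, 0, 0), vec (0, 0, 0, z)⁆ = vec (0, 0, 0, -z) ∧
        ⁅vec (0, 1, 0, 0), vec (0, 0, 0, z)⁆ = 0 ∧
        ⁅vec (0, 0, 1, 0), vec (0, 0, 0, z)⁆ = vec (0, -(z + conj z).re, 0, 0) ∧
        ⁅vec (0, 0, 0, z), vec (0, 0, 0, z')⁆
          = vec (0, 0, (-Complex.I * (z * conj z' - conj z * z')).re, 0) := by
  have h0 : (0 : Lie𝔤) = vec (0, 0, 0, 0) := rfl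
  rw [h0]
  refine ⟨?_, ?_, ?_, fun z z' => ⟨?_, ?_, ?_, ?_⟩⟩ <;> rw [bracket_vec] <;> congr 1
  · simp
  · simp
  · simp
  · simp
  · simp
  · simp
    ring
  · simp
    ring

end CubicGroup

/-! ### The isotropy subgroup and its adjoint action. -/

namespace CubicGroup

instance : T2Space CubicGroup := inferInstanceAs (T2Space (ℝˣ × (ℝ × ℝ × ℂ)))

theorem isClosedEmbedding_incl : Topology.IsClosedEmbedding incl :=
  Function.LeftInverse.isClosedEmbedding (f := fun g : CubicGroup => g.1) (fun _ => rfl)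
    (continuous_fst : Continuous fun x : ℝˣ × (ℝ × ℝ × ℂ) => x.1)
    (continuous_id.prodMk continuous_const : Continuous fun a : ℝˣ => (a, ((0, 0, 0) : ℝ × ℝ × ℂ)))

theorem contMDiff_incl : ContMDiff 𝓘(ℝ, ℝ) model ∞ incl :=
  (contMDiff_id.prodMk contMDiff_const : ContMDiff 𝓘(ℝ, ℝ) model ∞
    fun a : ℝˣ => (a, ((0, 0, 0) : ℝ × ℝ × ℂ)))

theorem mfderiv_incl (X : ℝ) : (mfderiv 𝓘(ℝ, ℝ) model incl 1 X : ℝ × ℝ × ℝ × ℂ) = (X, 0, 0, 0) := by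
  have h : HasMFDerivAt 𝓘(ℝ, ℝ) model (fun a : ℝˣ => (a, ((0, 0, 0) : ℝ × ℝ × ℂ))) 1 _ :=
    (hasMFDerivAt_id (1 : ℝˣ)).prodMk (hasMFDerivAt_const ((0, 0, 0) : ℝ × ℝ × ℂ) (1 : ℝˣ))
  have h' : mfderiv 𝓘(ℝ, ℝ) model incl 1 = _ := h.mfderiv
  rw [h']
  rfl

/-- The action of the isotropy group on the Lie algebra. -/
def adDiag (h : ℝ) : (ℝ × ℝ × ℝ × ℂ) →L[ℝ] (ℝ × ℝ × ℝ × ℂ) :=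
  (ContinuousLinearMap.id ℝ ℝ).prodMap ((h ^ 3 • ContinuousLinearMap.id ℝ ℝ).prodMap
    ((h ^ 2 • ContinuousLinearMap.id ℝ ℝ).prodMap (h • ContinuousLinearMap.id ℝ ℂ)))

theorem coord_conj (h : ℝˣ) (k : CubicGroup) :
    coord ((incl h)⁻¹ * k * ((incl h)⁻¹)⁻¹) = adDiag h (coord k) := by
  rw [← map_inv, ← map_inv, inv_inv]
  obtain ⟨a, s, r, w⟩ := k
  change coord (mul (mul (h⁻¹, (0, 0, 0)) (a, (s, r, w))) (h, (0, 0, 0))) = _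
  have := h.ne_zero
  have := a.ne_zero
  refine Prod.ext ?_ (Prod.ext ?_ (Prod.ext ?_ ?_))
  · simp [coord, mul, adDiag]
  · simp [coord, mul, adDiag]
  · simp [coord, mul, adDiag]
  · simp [coord, mul, adDiag]

/-- Conjugation by an isotropy element is linear in the coordinates, hence equal to its own
derivative; its weights 0, 3, 2, 1 are those of Λ, σ, ρ, ζ. -/
theorem Ad_incl_inv (h : ℝˣ) (X : ℝ × ℝ × ℝ × ℂ) :
    Ad model (incl h)⁻¹ (vec X) = vec (X.1, (h : ℝ) ^ 3 * X.2.1, (h : ℝ) ^ 2 * X.2.2.1,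
      (h : ℝ) • X.2.2.2) := by
  have hs : ContMDiff model model ∞ fun k : CubicGroup => (incl h)⁻¹ * k * ((incl h)⁻¹)⁻¹ :=
    (contMDiff_mul_right (a := ((incl h)⁻¹)⁻¹)).comp (contMDiff_mul_left (a := (incl h)⁻¹))
  have h1 := (hs.mdifferentiable (by simp) 1).hasMFDerivAt
  have h2 := (hasMFDerivAt_coord _).comp (1 : CubicGroup) h1
  have h3 : HasMFDerivAt 𝓘(ℝ, ℝ × ℝ × ℝ × ℂ) 𝓘(ℝ, ℝ × ℝ × ℝ × ℂ) (adDiag h)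
      (coord (1 : CubicGroup)) (adDiag h) := (adDiag h).hasMFDerivAt
  have h4 := h3.comp (1 : CubicGroup) (hasMFDerivAt_coord 1)
  have h5 : (coord ∘ fun k : CubicGroup => (incl h)⁻¹ * k * ((incl h)⁻¹)⁻¹)
      = adDiag h ∘ coord := funext (coord_conj h)
  rw [h5] at h2
  have h6 := hasMFDerivAt_unique h2 h4
  exact congrArg (fun L : (ℝ × ℝ × ℝ × ℂ) →L[ℝ] (ℝ × ℝ × ℝ × ℂ) => L X) h6

end CubicGroup

/-! ### The forms on P⁴ and the Cartan connection. -/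

section Connection

set_option linter.unusedSectionVars false

variable {M : Type*} [TopologicalSpace M] [ChartedSpace R4 M] [IsManifold (𝓡 4) ∞ M]

theorem hasMFDerivAt_opens_val (U : Opens M) (p : U) :
    HasMFDerivAt (𝓡 4) (𝓡 4) (Subtype.val : U → M) p (ContinuousLinearMap.id ℝ R4) := by
  refine ⟨continuous_subtype_val.continuousAt, ?_⟩
  have h1 := U.chartAt_subtype_val_symm_eventuallyEq (H := R4) (x := p)
  have h2 := (chartAt R4 (p : M)).open_target.mem_nhds (mem_chart_target R4 (p : M))
  refine ((hasFDerivAt_id (𝕜 := ℝ) (chartAt R4 (p : M) p)).congr_of_eventuallyEq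
    ?_).hasFDerivWithinAt
  filter_upwards [h1, h2] with y hy hy2
  change chartAt R4 (p : M) (((chartAt R4 p).symm y : U) : M) = y
  exact (congrArg (chartAt R4 (p : M)) hy.symm).trans ((chartAt R4 (p : M)).right_inv hy2)

namespace LocalCoframe

variable (D : LocalCoframe M) {𝓛 : CRStructure M}

theorem contMDiff_proj : ContMDiff modelP (𝓡 4) ∞ fun y : D.Triv => (y.1 : M) :=
  contMDiff_subtype_val.comp contMDiff_fst

theorem contMDiff_fibre : ContMDiff modelP 𝓘(ℝ, ℝ) ∞ fun y : D.Triv => (y.2 : ℝ) :=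
  Units.contMDiff_val.comp contMDiff_snd

theorem dproj_apply (x : D.Triv) (v : TangentSpace modelP x) :
    (D.dproj x v : R4) = (v : R4 × ℝ).1 := by
  have h := (hasMFDerivAt_opens_val D.U x.1).comp x (hasMFDerivAt_fst (I := 𝓡 4) (I' := 𝓘(ℝ, ℝ)) x)
  have h' : mfderiv modelP (𝓡 4) (fun y : D.Triv => (y.1 : M)) x = _ := h.mfderiv
  change (mfderiv modelP (𝓡 4) (fun y : D.Triv => (y.1 : M)) x v : R4) = _
  rw [h']
  rfl

theorem da_apply (x : D.Triv) (v : TangentSpace modelP x) : D.da x v = (v : R4 × ℝ).2 := by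
  have h := (hasMFDerivAt_units_val x.2).comp x (hasMFDerivAt_snd (I := 𝓡 4) (I' := 𝓘(ℝ, ℝ)) x)
  have h' : mfderiv modelP 𝓘(ℝ, ℝ) (fun y : D.Triv => (y.2 : ℝ)) x = _ := h.mfderiv
  change (mfderiv modelP 𝓘(ℝ, ℝ) (fun y : D.Triv => (y.2 : ℝ)) x v : ℝ) = _
  rw [h']
  rfl

theorem taut_apply (i : Fin 4) (x : D.Triv) (v : TangentSpace modelP x) :
    D.taut i x v = weightCoeff x.2 i * onReal (D.θ x.1 i) (D.dproj x v) := by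
  change onReal ((D.θ x.1).scale (x.2 : ℝ) i) (D.dproj x v) = _
  rw [Coframe.scale_apply]
  rfl

theorem Lambda_apply (x : D.Triv) (v : TangentSpace modelP x) :
    D.Lambda x v = ((x.2 : ℝ)⁻¹ * D.da x v : ℝ) + onReal (D.lam x.1) (D.dproj x v) := by
  rw [Complex.ofReal_mul, Complex.ofReal_inv]
  rfl

theorem omega_apply (x : D.Triv) (v : TangentSpace modelP x) : D.omega x v =
    CubicGroup.vec ((D.Lambda x v).re, (D.taut 0 x v).re, (D.taut 1 x v).re, D.taut 2 x v) := rfl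

theorem smoothFormOn_lam : SmoothFormOn D.lam D.U := by
  refine smoothFormOn_iff.2 fun p hp => ?_
  have t := fun k i j => D.smoothFunAt_tor (p := p) hp k i j
  have f := fun i => D.smoothFormAt_θ (p := p) hp i
  have h := (((SmoothFormAt.smul ((smoothFunAt_const (1 / 2)).mul (t 1 0 1)) (f 0)).add
    (SmoothFormAt.smul ((smoothFunAt_const (-1 / 3)).mul (t 0 0 1)) (f 1))).add
    (SmoothFormAt.smul ((smoothFunAt_const (-1 / 3)).mul (t 0 0 2)) (f 2))).add
    (SmoothFormAt.smul ((smoothFunAt_const (-1 / 3)).mul (t 0 0 3)) (f 3))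
  refine h.congr (Filter.Eventually.of_forall fun q => ?_)
  rw [lam]
  module

theorem contMDiff_onReal_dproj {θ : ∀ p : M, ℂ ⊗[ℝ] TangentSpace (𝓡 4) p →ₗ[ℂ] ℂ}
    (hθ : SmoothFormOn θ D.U) : ContMDiff modelP.tangent 𝓘(ℝ, ℂ) ∞
      fun v : TangentBundle modelP D.Triv => onReal (θ v.1.1) (D.dproj v.1 v.2) :=
  hθ.comp_contMDiff (D.contMDiff_proj.contMDiff_tangentMap (m := ∞) (by simp)) fun v => v.1.1.2

theorem contMDiff_da : ContMDiff modelP.tangent 𝓘(ℝ, ℝ) ∞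
    fun v : TangentBundle modelP D.Triv => D.da v.1 v.2 := by
  have h := D.contMDiff_fibre.contMDiff_tangentMap (m := ∞) (by simp)
  exact (contMDiff_snd_tangentBundle_modelSpace ℝ 𝓘(ℝ, ℝ)).comp h

theorem contMDiff_omega : ContMDiff (M' := ℝ × ℝ × ℝ × ℂ) modelP.tangent 𝓘(ℝ, ℝ × ℝ × ℝ × ℂ) ∞
    fun v : TangentBundle modelP D.Triv => (D.omega v.1 v.2 : ℝ × ℝ × ℝ × ℂ) := by
  have ha : ContMDiff modelP.tangent 𝓘(ℝ, ℝ) ∞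
      fun v : TangentBundle modelP D.Triv => (v.1.2 : ℝ) :=
    D.contMDiff_fibre.comp (Bundle.contMDiff_proj _)
  have hof : ∀ {f : TangentBundle modelP D.Triv → ℝ}, ContMDiff modelP.tangent 𝓘(ℝ, ℝ) ∞ f →
      ContMDiff modelP.tangent 𝓘(ℝ, ℂ) ∞ fun v => (f v : ℂ) :=
    fun hf => Complex.ofRealCLM.contDiff.contMDiff.comp hf
  have hre : ∀ {f : TangentBundle modelP D.Triv → ℂ}, ContMDiff modelP.tangent 𝓘(ℝ, ℂ) ∞ f →
      ContMDiff modelP.tangent 𝓘(ℝ, ℝ) ∞ fun v => (f v).re :=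
    fun hf => Complex.reCLM.contDiff.contMDiff.comp hf
  have hw : ∀ i, ContMDiff modelP.tangent 𝓘(ℝ, ℂ) ∞
      fun v : TangentBundle modelP D.Triv => weightCoeff v.1.2 i := by
    intro i
    fin_cases i
    · exact (hof (ha.pow 3)).congr fun v => (Complex.ofReal_pow _ 3).symm
    · exact (hof (ha.pow 2)).congr fun v => (Complex.ofReal_pow _ 2).symm
    · exact hof ha
    · exact hof ha
  have htaut : ∀ i, ContMDiff modelP.tangent 𝓘(ℝ, ℂ) ∞
      fun v : TangentBundle modelP D.Triv => D.taut i v.1 v.2 := fun i =>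
    ((contDiff_mul (𝕜 := ℝ) (𝔸 := ℂ)).contMDiff.comp
      ((hw i).prodMk_space (D.contMDiff_onReal_dproj (D.smooth_θ i)))).congr fun v => D.taut_apply i v.1 v.2
  have hL : ContMDiff modelP.tangent 𝓘(ℝ, ℂ) ∞
      fun v : TangentBundle modelP D.Triv => D.Lambda v.1 v.2 :=
    ((hof ((ha.inv₀ fun v => v.1.2.ne_zero).mul D.contMDiff_da)).add
        (D.contMDiff_onReal_dproj D.smoothFormOn_lam)).congr fun v => D.Lambda_apply v.1 v.2
  exact (hre hL).prodMk_space ((hre (htaut 0)).prodMk_space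
    ((hre (htaut 1)).prodMk_space (htaut 2)))

theorem isPrincipalBundle : IsPrincipalBundle (𝓡 4) modelP 𝓘(ℝ, ℝ) (fun x : D.Triv => x.1)
    (fun x (b : ℝˣ) => (x.1, x.2 * b)) where
  smooth_proj := contMDiff_fst
  smooth_act := (contMDiff_fst.comp contMDiff_fst).prodMk
    ((contMDiff_snd.comp contMDiff_fst).mul contMDiff_snd)
  act_one x := by simp
  act_mul x g h := by simp [mul_assoc]
  proj_act x h := rfl
  locally_trivial p := ⟨⊤, (Homeomorph.refl _).toOpenPartialHomeomorph, trivial, by simp, by simp,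
    contMDiff_id.contMDiffOn, contMDiff_id.contMDiffOn, fun q _ h => ⟨rfl, fun k => rfl⟩⟩

section Real

variable {D} (hD : D.IsRealFrame)

include hD

theorem IsRealFrame.Lambda_im (x : D.Triv) (v : TangentSpace modelP x) :
    (D.Lambda x v).im = 0 := by
  rw [Lambda_apply, Complex.add_im, Complex.ofReal_im, hD.onReal_lam_im x.1.2, add_zero]

theorem IsRealFrame.taut_im (x : D.Triv) (v : TangentSpace modelP x) :
    (D.taut 0 x v).im = 0 ∧ (D.taut 1 x v).im = 0 := by
  rw [taut_apply, taut_apply]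
  have h0 : weightCoeff x.2 0 = (((x.2 : ℝ) ^ 3 : ℝ) : ℂ) := by simp [weightCoeff]
  have h1 : weightCoeff x.2 1 = (((x.2 : ℝ) ^ 2 : ℝ) : ℂ) := by simp [weightCoeff]
  rw [h0, h1, Complex.im_ofReal_mul, Complex.im_ofReal_mul, hD.onReal_im x.1.2 rfl,
    hD.onReal_im x.1.2 rfl]
  simp

theorem IsRealFrame.taut_conj (x : D.Triv) (v : TangentSpace modelP x) :
    D.taut 3 x v = conj (D.taut 2 x v) := by
  have h : onReal (D.θ x.1 3) (D.dproj x v) = conj (onReal (D.θ x.1 2) (D.dproj x v)) := by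
    have e : conjVec ((1 : ℂ) ⊗ₜ[ℝ] D.dproj x v) = (1 : ℂ) ⊗ₜ[ℝ] D.dproj x v := by simp
    exact ((hD.conj_θ x.1.2 2 _).trans (congrArg (D.θ x.1 3) e)).symm
  rw [taut_apply, taut_apply, h, map_mul]
  simp [weightCoeff]

/-- If ω(v) = 0, reality recovers the vanishing of all four tautological forms, so v projects to 0
on M; then Λ reduces to da/a and v = 0. Both sides have dimension 5. -/
theorem IsRealFrame.omega_bijective (x : D.Triv) : Function.Bijective (D.omega x) := by
  have hinj : Function.Injective (D.omega x) := by
    rw [← LinearMap.ker_eq_bot, LinearMap.ker_eq_bot']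
    intro v hv
    have hv' : ((D.Lambda x v).re, (D.taut 0 x v).re, (D.taut 1 x v).re, D.taut 2 x v)
      = ((0, 0, 0, 0) : ℝ × ℝ × ℝ × ℂ) := hv
    simp only [Prod.mk.injEq] at hv'
    obtain ⟨e1, e2, e3, e4⟩ := hv'
    have t0 : D.taut 0 x v = 0 := Complex.ext e2 (hD.taut_im x v).1
    have t1 : D.taut 1 x v = 0 := Complex.ext e3 (hD.taut_im x v).2
    have t3 : D.taut 3 x v = 0 := by rw [hD.taut_conj, e4, map_zero]
    have tz : ∀ i, onReal (D.θ x.1 i) (D.dproj x v) = 0 := by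
      intro i
      have : D.taut i x v = 0 := by fin_cases i <;> assumption
      rw [taut_apply] at this
      exact (mul_eq_zero.1 this).resolve_left (weightCoeff_ne_zero x.2.ne_zero i)
    have hp : D.dproj x v = 0 := by
      have h1 : (1 : ℂ) ⊗ₜ[ℝ] D.dproj x v = 0 := by
        refine (D.dual x.1 x.1.2).vec_ext fun i => ?_
        rw [map_zero]
        exact tz i
      simpa [rePart] using congrArg rePart h1
    have ha : D.da x v = 0 := by
      rw [Lambda_apply, hp, map_zero, add_zero, Complex.ofReal_re] at e1
      exact (mul_eq_zero.1 e1).resolve_left (inv_ne_zero x.2.ne_zero)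
    have p1 := D.dproj_apply x v
    have p2 := D.da_apply x v
    rw [hp] at p1
    rw [ha] at p2
    exact Prod.ext p1.symm p2.symm
  refine ⟨hinj, ?_⟩
  have hdim : Module.finrank ℝ (R4 × ℝ) = Module.finrank ℝ (ℝ × ℝ × ℝ × ℂ) := by
    simp [Complex.finrank_real_complex]
  let f : (R4 × ℝ) →ₗ[ℝ] (ℝ × ℝ × ℝ × ℂ) := D.omega x
  exact (LinearMap.injective_iff_surjective_of_finrank_eq_finrank (f := f) hdim).1 hinj

end Real

/-- The chain rule, so that pullbacks of the forms need only the two components of a map into P⁴. -/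
theorem dproj_mfderiv {E H N : Type*} [NormedAddCommGroup E] [NormedSpace ℝ E] [TopologicalSpace H]
    [TopologicalSpace N] [ChartedSpace H N] {I : ModelWithCorners ℝ E H} {f : N → D.Triv} {y : N}
    (hf : MDifferentiableAt I modelP f y) (v : TangentSpace I y) :
    D.dproj (f y) (mfderiv I modelP f y v) = mfderiv I (𝓡 4) (fun z => ((f z).1 : M)) y v :=
  (mfderiv_comp_apply y (D.contMDiff_proj.mdifferentiable (by simp) (f y)) hf v).symm

theorem da_mfderiv {E H N : Type*} [NormedAddCommGroup E] [NormedSpace ℝ E] [TopologicalSpace H]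
    [TopologicalSpace N] [ChartedSpace H N] {I : ModelWithCorners ℝ E H} {f : N → D.Triv} {y : N}
    (hf : MDifferentiableAt I modelP f y) (v : TangentSpace I y) :
    D.da (f y) (mfderiv I modelP f y v) = mfderiv I 𝓘(ℝ, ℝ) (fun z => ((f z).2 : ℝ)) y v :=
  (mfderiv_comp_apply y (D.contMDiff_fibre.mdifferentiable (by simp) (f y)) hf v).symm

/-- Along the fibre the base point is constant, so only da/a survives, and the derivative of the
orbit map multiplies X by the fibre coordinate. -/
theorem omega_vertical (x : D.Triv) (X : ℝ) :
    (D.omega (x.1, x.2 * 1) (mfderiv 𝓘(ℝ, ℝ) modelP (fun h : ℝˣ => ((x.1, x.2 * h) : D.Triv)) 1 X)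
      : ℝ × ℝ × ℝ × ℂ) = (X, 0, 0, 0) := by
  have hf : MDifferentiableAt 𝓘(ℝ, ℝ) modelP (fun h : ℝˣ => ((x.1, x.2 * h) : D.Triv)) 1 :=
    ((contMDiff_const.prodMk (contMDiff_const.mul contMDiff_id) : ContMDiff 𝓘(ℝ, ℝ) modelP ∞
      fun h : ℝˣ => ((x.1, x.2 * h) : D.Triv)).mdifferentiable (by simp)) 1
  have h1 := D.dproj_mfderiv hf X
  have h2 := D.da_mfderiv hf X
  have h3 : mfderiv 𝓘(ℝ, ℝ) (𝓡 4) (fun _ : ℝˣ => (x.1 : M)) 1 = 0 := mfderiv_const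
  have h4 : HasMFDerivAt 𝓘(ℝ, ℝ) 𝓘(ℝ, ℝ) (fun h : ℝˣ => ((x.2 * h : ℝˣ) : ℝ)) 1
      (((x.2 : ℝ) • ContinuousLinearMap.id ℝ ℝ).comp (ContinuousLinearMap.id ℝ ℝ)) :=
    ((x.2 : ℝ) • ContinuousLinearMap.id ℝ ℝ).hasMFDerivAt.comp (1 : ℝˣ) (hasMFDerivAt_units_val 1)
  set w := mfderiv 𝓘(ℝ, ℝ) modelP (fun h : ℝˣ => ((x.1, x.2 * h) : D.Triv)) 1 X
  have h1' : D.dproj (x.1, x.2 * 1) w = 0 := h1.trans (congrArg (fun L => L X) h3)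
  have h2' : D.da (x.1, x.2 * 1) w = (x.2 : ℝ) * X := h2.trans (by rw [h4.mfderiv]; rfl)
  rw [omega_apply, Lambda_apply, taut_apply, taut_apply, taut_apply, h1', h2']
  have := x.2.ne_zero
  change ((_, _, _, _) : ℝ × ℝ × ℝ × ℂ) = _
  simp

/-- Right translation by h multiplies the fibre coordinate by a constant: da/a and λ are invariant,
and the tautological forms scale by h³, h², h. -/
theorem omega_equivariant (x : D.Triv) (h : ℝˣ) (v : TangentSpace modelP x) :
    D.omega (x.1, x.2 * h) (mfderiv modelP modelP (fun y : D.Triv => ((y.1, y.2 * h) : D.Triv)) x v)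
      = Ad CubicGroup.model (CubicGroup.incl h)⁻¹ (D.omega x v) := by
  have hf : MDifferentiableAt modelP modelP (fun y : D.Triv => ((y.1, y.2 * h) : D.Triv)) x :=
    ((contMDiff_fst.prodMk (contMDiff_snd.mul contMDiff_const) : ContMDiff modelP modelP ∞
      fun y : D.Triv => ((y.1, y.2 * h) : D.Triv)).mdifferentiable (by simp)) x
  have h1 : D.dproj (x.1, x.2 * h) _ = D.dproj x v := D.dproj_mfderiv hf v
  have h2 := D.da_mfderiv hf v
  have h4 : HasMFDerivAt modelP 𝓘(ℝ, ℝ) (fun y : D.Triv => ((y.2 * h : ℝˣ) : ℝ)) x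
      (((h : ℝ) • ContinuousLinearMap.id ℝ ℝ).comp
        (mfderiv modelP 𝓘(ℝ, ℝ) (fun y : D.Triv => (y.2 : ℝ)) x)) := by
    have h5 := ((h : ℝ) • ContinuousLinearMap.id ℝ ℝ).hasMFDerivAt.comp x
      (D.contMDiff_fibre.mdifferentiable (by simp) x).hasMFDerivAt
    refine h5.congr_of_eventuallyEq (Filter.Eventually.of_forall fun y => ?_)
    simp [mul_comm]
  set w := mfderiv modelP modelP (fun y : D.Triv => ((y.1, y.2 * h) : D.Triv)) x v
  have h2' : D.da (x.1, x.2 * h) w = (h : ℝ) * D.da x v := h2.trans (by rw [h4.mfderiv]; rfl)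
  rw [omega_apply, omega_apply, CubicGroup.Ad_incl_inv]
  congr 1
  have hx := x.2.ne_zero
  have hh := h.ne_zero
  simp only [Lambda_apply, taut_apply, h1, h2']
  refine Prod.ext ?_ (Prod.ext ?_ (Prod.ext ?_ ?_))
  · simp
    field_simp
  · have e : weightCoeff ((x.2 * h : ℝˣ) : ℝ) 0 = (((h : ℝ) ^ 3 : ℝ) : ℂ) * weightCoeff x.2 0 := by
      simp [weightCoeff]
      ring
    change (weightCoeff ((x.2 * h : ℝˣ) : ℝ) 0 * _).re = _ * (weightCoeff x.2 0 * _).re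
    rw [e, mul_assoc, Complex.re_ofReal_mul]
  · have e : weightCoeff ((x.2 * h : ℝˣ) : ℝ) 1 = (((h : ℝ) ^ 2 : ℝ) : ℂ) * weightCoeff x.2 1 := by
      simp [weightCoeff]
      ring
    change (weightCoeff ((x.2 * h : ℝˣ) : ℝ) 1 * _).re = _ * (weightCoeff x.2 1 * _).re
    rw [e, mul_assoc, Complex.re_ofReal_mul]
  · have e : weightCoeff ((x.2 * h : ℝˣ) : ℝ) 2 = ((h : ℝ) : ℂ) * weightCoeff x.2 2 := by
      simp [weightCoeff]
      ring
    change weightCoeff ((x.2 * h : ℝˣ) : ℝ) 2 * _ = (h : ℝ) • (weightCoeff x.2 2 * _)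
    rw [e, mul_assoc, Complex.real_smul]

end LocalCoframe

/-- Over one section reality of the frame is enough; the torsion normalizations serve to make P⁴ and
Λ independent of the section. -/
theorem LocalCoframe.IsRealFrame.isCartanConnection {D : LocalCoframe M} (hD : D.IsRealFrame) :
    IsCartanConnection (𝓡 4) LocalCoframe.modelP 𝓘(ℝ, ℝ) CubicGroup.model CubicGroup.incl
      (fun x : D.Triv => x.1) (fun x b => (x.1, x.2 * b)) D.omega where
  closed_subgroup := CubicGroup.isClosedEmbedding_incl
  smooth_subgroup := CubicGroup.contMDiff_incl
  principal := D.isPrincipalBundle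
  dim_eq := by simp [Complex.finrank_real_complex]
  smooth := D.contMDiff_omega
  vertical x X := (D.omega_vertical x X).trans (CubicGroup.mfderiv_incl X).symm
  equivariant := D.omega_equivariant
  isomorphism := hD.omega_bijective

end Connection

end

theorem mainTheorem2 {M : Type*} [TopologicalSpace M] [ChartedSpace R4 M] [IsManifold (𝓡 4) ∞ M]
    (𝓛 : CRStructure M) (h𝓛 : 𝓛.IsClassII) :
    -- `𝔊` acts effectively and transitively on the cubic, and `𝔊₀` is the isotropy group of `0`
    ((∀ (g h : CubicGroup) (x : ℂ × ℂ × ℂ), (g * h).act x = g.act (h.act x)) ∧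
      (∀ (g : CubicGroup), ∀ x ∈ cubic, g.act x ∈ cubic) ∧
      (∀ x ∈ cubic, ∀ y ∈ cubic, ∃ g : CubicGroup, g.act x = y) ∧
      (∀ g : CubicGroup, (∀ x ∈ cubic, g.act x = x) → g = 1) ∧
      (∀ g : CubicGroup, g.act 0 = 0 ↔ g ∈ range CubicGroup.incl)) ∧
    -- the brackets of the basis `e_α, e_σ, e_ρ, e_ζ, e_ζ̄` of `ℂ ⊗ 𝔤`
    (⁅CubicGroup.vec (1, 0, 0, 0), CubicGroup.vec (0, 1, 0, 0)⁆ = CubicGroup.vec (0, -3, 0, 0) ∧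
      ⁅CubicGroup.vec (1, 0, 0, 0), CubicGroup.vec (0, 0, 1, 0)⁆ = CubicGroup.vec (0, 0, -2, 0) ∧
      ⁅CubicGroup.vec (0, 1, 0, 0), CubicGroup.vec (0, 0, 1, 0)⁆ = 0 ∧
      ∀ z z' : ℂ,
        ⁅CubicGroup.vec (1, 0, 0, 0), CubicGroup.vec (0, 0, 0, z)⁆
          = CubicGroup.vec (0, 0, 0, -z) ∧
        ⁅CubicGroup.vec (0, 1, 0, 0), CubicGroup.vec (0, 0, 0, z)⁆ = 0 ∧
        ⁅CubicGroup.vec (0, 0, 1, 0), CubicGroup.vec (0, 0, 0, z)⁆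
          = CubicGroup.vec (0, -(z + conj z).re, 0, 0) ∧
        ⁅CubicGroup.vec (0, 0, 0, z), CubicGroup.vec (0, 0, 0, z')⁆
          = CubicGroup.vec (0, 0, (-Complex.I * (z * conj z' - conj z * z')).re, 0)) ∧
    -- `P⁴` has local sections near each point of `M`
    (∀ p : M, ∃ D : LocalCoframe M, D.IsReduced 𝓛 ∧ p ∈ D.U) ∧
    -- two local sections of `P⁴` differ by a smooth function with values in `G₄ = ℝ ∖ {0}`, and the
    -- forms `Λ = da / a + λ` that they define on `P⁴` agree
    (∀ D D' : LocalCoframe M, D.IsReduced 𝓛 → D'.IsReduced 𝓛 → ∃ h : M → ℝ,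
      ContMDiffOn (𝓡 4) 𝓘(ℝ, ℝ) ∞ h (D.U ∩ D'.U) ∧
      ∀ p ∈ D.U ⊓ D'.U, h p ≠ 0 ∧ D'.θ p = (D.θ p).scale (h p) ∧
        ∀ v : TangentSpace (𝓡 4) p, onReal (D'.lam p) v = onReal (D.lam p) v
          + (((h p)⁻¹ * diffReal h p v : ℝ) : ℂ)) ∧
    (∀ D : LocalCoframe M, D.IsReduced 𝓛 →
      -- the local section trivializes `P⁴`
      (∀ p ∈ D.U, BijOn (fun a : ℝˣ => (D.θ p).scale (a : ℝ)) univ (P4 𝓛 p)) ∧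
      -- the forms `Λ, σ, ρ` on `P⁴` are real and `ζ̄` is the conjugate of `ζ`
      (∀ (x : D.Triv) (v : TangentSpace LocalCoframe.modelP x), (D.Lambda x v).im = 0 ∧
        (D.taut 0 x v).im = 0 ∧ (D.taut 1 x v).im = 0 ∧ D.taut 3 x v = conj (D.taut 2 x v)) ∧
      -- `ω` is a Cartan connection
      IsCartanConnection (𝓡 4) LocalCoframe.modelP 𝓘(ℝ, ℝ) CubicGroup.model CubicGroup.incl
        (fun x : D.Triv => x.1) (fun x b => (x.1, x.2 * b)) D.omega) := by
  refine ⟨⟨CubicGroup.mul_act, fun g _ => g.act_mem_cubic,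
    fun _ hx _ hy => CubicGroup.exists_act_eq hx hy, fun _ => CubicGroup.eq_one_of_act,
    fun _ => CubicGroup.act_zero_eq_zero⟩, CubicGroup.brackets, LocalCoframe.exists_isReduced h𝓛,
    fun _ _ h h' => h.exists_scale h', fun D h => ⟨fun _ => h.bijOn_P4, fun x v => ?_,
      h.isRealFrame.isCartanConnection⟩⟩
  have hD := h.isRealFrame
  exact ⟨hD.Lambda_im x v, (hD.taut_im x v).1, (hD.taut_im x v).2, hD.taut_conj x v⟩
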